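/- Let $\overline M=M\cup\{P_1,\dots,P_k\}$ be a compact connected surface with (possibly empty) boundary $\partial M$ and finitely many conical singularities. That is, $M$ is a connected smooth surface with boundary and a smooth Riemannian metric $g$; there are pairwise disjoint open sets $C_i\subset M\setminus\partial M$ and diffeomorphisms $C_i\cong(0,1)\times S^1$ in which $g=dr^2+r^2g_i(r)$, where $g_i(r)$ is a family of metrics on $S^1$ that is smooth up to $r=0$; for $0<s<1$ the set $\{r\le s\}\subset C_i$ is closed in $M$, and the complement in $M$ of $\bigcup_i\{r<s\}$ is compact; and $P_i$ is the point $r=0$ added to $C_i$, with the sets $\{P_i\}\cup\{r<s\}$ as neighbourhoods. The angle of $P_i$ is $\lim_{r\to0}\ell_r/r$, where $\ell_r$ is the $g$-length of the circle $\{r\}\times S^1$ in $C_i$. A curve in $\overline M$ with $n$ components is a family $\gamma=(\gamma_1,\dots,\gamma_n)$ of nonconstant continuous maps $\gamma_j:[0,1]\to\overline M$ of finite length such that, for all but finitely many $t\in(0,1)$, $\gamma_j(t)\in M$ and $\gamma_j$ is $C^1$ near $t$, and such that either $\gamma_j(0)=\gamma_j(1)$ or $\gamma_j(0),\gamma_j(1)\in\partial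 M$. Its length is $\sum_j\int_0^1|\gamma_j'(t)|_g\,dt$. For $\kappa>0$, it divides $\overline M$ into two parts of area ratio $\kappa$ if the complement of $\bigcup_j\gamma_j([0,1])$ is the union of two disjoint open sets $U,V$ with $\operatorname{area}(U)=\kappa\operatorname{area}(V)$, the area being the Riemannian area. Let $P$ be one of the conical singularities and suppose that its angle is $\alpha<2\pi$. Let $\kappa>0$ and $n\ge0$, and let $\gamma$ be a curve with $n$ components that divides $\overline M$ into two parts of area ratio $\kappa$ and has minimal length among all curves with $n$ components that do so. Then $\gamma$ does not pass through $P$. -/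

import Mathlib

open Set MeasureTheory Filter Manifold Bundle
open scoped Manifold ContDiff Topology ENNReal

noncomputable section

/-- The regular part `M` is a connected smooth surface with (possibly empty) boundary and a smooth
Riemannian metric.  This structure says that `M`, after adding one tip for each `i : ι`, becomes a
compact surface with conical singularities: `M` is the union of a compact surface and of the
truncated cones `(0, 1) × S¹`, on which the metric is `dr² + r² h(r, θ) dθ²` with `h(r, θ) dθ²` a
family of metrics on the circle that is smooth up to `r = 0`.

The circle is `ℝ / 2πℤ`, so the cones are given by polar coordinates `(r, θ) ∈ (0, 1) × ℝ` that
are `2π`-periodic in `θ`. -/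
structure ConicalSurface (M : Type*) [TopologicalSpace M]
    [ChartedSpace (EuclideanHalfSpace 2) M] [IsManifold (𝓡∂ 2) ∞ M]
    [RiemannianBundle (fun x : M => TangentSpace (𝓡∂ 2) x)] (ι : Type*) where
  /-- The polar coordinates of the `i`-th cone, relevant on `(0, 1) × ℝ` only. -/
  polar : ι → ℝ × ℝ → M
  /-- The coefficient `h` of the metric `h(r, θ) dθ²` on the cross section. -/
  cross : ι → ℝ × ℝ → ℝ
  contMDiffOn_polar : ∀ i, ContMDiffOn 𝓘(ℝ, ℝ × ℝ) (𝓡∂ 2) ∞ (polar i) (Ioo 0 1 ×ˢ univ)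
  /-- The cones do not meet the boundary of `M`. -/
  isInteriorPoint_polar : ∀ i, ∀ r ∈ Ioo (0 : ℝ) 1, ∀ θ : ℝ, (𝓡∂ 2).IsInteriorPoint (polar i (r, θ))
  /-- `polar i` induces an injective map on `(0, 1) × ℝ / 2πℤ`. -/
  polar_eq_iff : ∀ i, ∀ r ∈ Ioo (0 : ℝ) 1, ∀ r' ∈ Ioo (0 : ℝ) 1, ∀ θ θ' : ℝ,
    polar i (r, θ) = polar i (r', θ') ↔ r = r' ∧ ∃ k : ℤ, θ' = θ + k * (2 * Real.pi)
  /-- Different cones are disjoint. -/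
  disjoint_polar : ∀ i j, i ≠ j →
    Disjoint (polar i '' (Ioo 0 1 ×ˢ univ)) (polar j '' (Ioo 0 1 ×ˢ univ))
  /-- The cones are attached along `r = 1` only: nothing in `M` is approached as `r → 0`. -/
  isClosed_polar : ∀ i, ∀ s ∈ Ioo (0 : ℝ) 1, IsClosed (polar i '' (Ioc 0 s ×ˢ univ))
  /-- What remains of `M` outside the cones is compact. -/
  isCompact_compl : ∀ s ∈ Ioo (0 : ℝ) 1, IsCompact (⋃ i, polar i '' (Ioo 0 s ×ˢ univ))ᶜ
  contDiffOn_cross : ∀ i, ContDiffOn ℝ ∞ (cross i) (Ico 0 1 ×ˢ univ)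
  cross_pos : ∀ i, ∀ r ∈ Ico (0 : ℝ) 1, ∀ θ : ℝ, 0 < cross i (r, θ)
  /-- `g(∂_r, ∂_r) = 1`. -/
  inner_radial_radial : ∀ i, ∀ r ∈ Ioo (0 : ℝ) 1, ∀ θ : ℝ,
    inner ℝ (mfderiv 𝓘(ℝ, ℝ × ℝ) (𝓡∂ 2) (polar i) (r, θ) ((1, 0) : ℝ × ℝ))
      (mfderiv 𝓘(ℝ, ℝ × ℝ) (𝓡∂ 2) (polar i) (r, θ) ((1, 0) : ℝ × ℝ)) = (1 : ℝ)
  /-- `g(∂_r, ∂_θ) = 0`. -/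
  inner_radial_angular : ∀ i, ∀ r ∈ Ioo (0 : ℝ) 1, ∀ θ : ℝ,
    inner ℝ (mfderiv 𝓘(ℝ, ℝ × ℝ) (𝓡∂ 2) (polar i) (r, θ) ((1, 0) : ℝ × ℝ))
      (mfderiv 𝓘(ℝ, ℝ × ℝ) (𝓡∂ 2) (polar i) (r, θ) ((0, 1) : ℝ × ℝ)) = (0 : ℝ)
  /-- `g(∂_θ, ∂_θ) = r² h(r, θ)`. -/
  inner_angular_angular : ∀ i, ∀ r ∈ Ioo (0 : ℝ) 1, ∀ θ : ℝ,
    inner ℝ (mfderiv 𝓘(ℝ, ℝ × ℝ) (𝓡∂ 2) (polar i) (r, θ) ((0, 1) : ℝ × ℝ))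
      (mfderiv 𝓘(ℝ, ℝ × ℝ) (𝓡∂ 2) (polar i) (r, θ) ((0, 1) : ℝ × ℝ)) = r ^ 2 * cross i (r, θ)

/-- The density `√(det g_{ab})` of the Riemannian area in the coordinates given by a chart `φ`. -/
def chartAreaDensity {M : Type*} [TopologicalSpace M]
    [ChartedSpace (EuclideanHalfSpace 2) M]
    [RiemannianBundle (fun x : M => TangentSpace (𝓡∂ 2) x)]
    (φ : OpenPartialHomeomorph M (EuclideanHalfSpace 2)) (y : EuclideanSpace ℝ (Fin 2)) : ℝ :=
  Real.sqrt (Matrix.det (Matrix.of fun a b : Fin 2 =>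
    (inner ℝ
      (mfderivWithin 𝓘(ℝ, EuclideanSpace ℝ (Fin 2)) (𝓡∂ 2) (φ.extend (𝓡∂ 2)).symm
        (range (𝓡∂ 2)) y (EuclideanSpace.single a (1 : ℝ)))
      (mfderivWithin 𝓘(ℝ, EuclideanSpace ℝ (Fin 2)) (𝓡∂ 2) (φ.extend (𝓡∂ 2)).symm
        (range (𝓡∂ 2)) y (EuclideanSpace.single b (1 : ℝ))) : ℝ)))

/-- The Riemannian area measure of `M`.  For each chart `φ`, the measure with density
`√(det g_{ab})` in the coordinates of `φ`, transported to `M`, is the area measure restricted to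
the domain of `φ`; the area measure itself is the supremum of these measures. -/
def riemannianArea (M : Type*) [TopologicalSpace M] [MeasurableSpace M]
    [ChartedSpace (EuclideanHalfSpace 2) M]
    [RiemannianBundle (fun x : M => TangentSpace (𝓡∂ 2) x)] : Measure M :=
  ⨆ φ ∈ atlas (EuclideanHalfSpace 2) M,
    Measure.map (φ.extend (𝓡∂ 2)).symm
      ((volume.restrict (φ.extend (𝓡∂ 2)).target).withDensity
        fun y => ENNReal.ofReal (chartAreaDensity φ y))

namespace ConicalSurface

variable {M : Type*} [TopologicalSpace M]
  [ChartedSpace (EuclideanHalfSpace 2) M] [IsManifold (𝓡∂ 2) ∞ M]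
  [RiemannianBundle (fun x : M => TangentSpace (𝓡∂ 2) x)] {ι : Type*}

/-- The length of the circle at distance `r` from the `i`-th tip. -/
def circleLength (S : ConicalSurface M ι) (i : ι) (r : ℝ) : ℝ :=
  ∫ θ in (0 : ℝ)..(2 * Real.pi),
    ‖mfderiv 𝓘(ℝ, ℝ × ℝ) (𝓡∂ 2) (S.polar i) (r, θ) ((0, 1) : ℝ × ℝ)‖

/-- `α = lim_{r → 0} ℓ_r / r` is the angle of the `i`-th conical singularity. -/
def HasConeAngle (S : ConicalSurface M ι) (i : ι) (α : ℝ) : Prop :=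
  Tendsto (fun r => S.circleLength i r / r) (𝓝[>] 0) (𝓝 α)

/-- The singular surface: the regular part `M` together with the tips. -/
def Completion (_S : ConicalSurface M ι) : Type _ := M ⊕ ι

/-- The inclusion of the regular part. -/
def reg (S : ConicalSurface M ι) (x : M) : S.Completion := Sum.inl x

/-- The conical singularities. -/
def tip (S : ConicalSurface M ι) (i : ι) : S.Completion := Sum.inr i

/-- The topology of the singular surface, which is that of its metric: `M` is open with its own
topology, and the sets `{r < s}` together with the tip are a basis of neighbourhoods of the tip. -/
instance (S : ConicalSurface M ι) : TopologicalSpace S.Completion where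
  IsOpen U := IsOpen {x | S.reg x ∈ U} ∧
    ∀ i, S.tip i ∈ U → ∃ s ∈ Ioo (0 : ℝ) 1, ∀ r ∈ Ioo 0 s, ∀ θ : ℝ, S.reg (S.polar i (r, θ)) ∈ U
  isOpen_univ := ⟨by simp, fun _ _ => ⟨1 / 2, by norm_num, fun _ _ _ => trivial⟩⟩
  isOpen_inter U V hU hV := by
    refine ⟨hU.1.inter hV.1, fun i hi => ?_⟩
    obtain ⟨s, hs, h⟩ := hU.2 i hi.1
    obtain ⟨s', hs', h'⟩ := hV.2 i hi.2
    exact ⟨min s s', ⟨lt_min hs.1 hs'.1, (min_le_left _ _).trans_lt hs.2⟩, fun r hr θ =>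
      ⟨h r ⟨hr.1, hr.2.trans_le (min_le_left _ _)⟩ θ,
        h' r ⟨hr.1, hr.2.trans_le (min_le_right _ _)⟩ θ⟩⟩
  isOpen_sUnion 𝒰 h := by
    refine ⟨?_, ?_⟩
    · have : {x | S.reg x ∈ ⋃₀ 𝒰} = ⋃ U ∈ 𝒰, {x | S.reg x ∈ U} := by
        ext x; simp
      rw [this]
      exact isOpen_biUnion fun U hU => (h U hU).1
    · rintro i ⟨U, hU, hi⟩
      obtain ⟨s, hs, h'⟩ := (h U hU).2 i hi
      exact ⟨s, hs, fun r hr θ => ⟨U, hU, h' r hr θ⟩⟩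

/-- The area of a subset of the singular surface (the tips have area zero). -/
def area [MeasurableSpace M] (S : ConicalSurface M ι) (U : Set S.Completion) : ℝ≥0∞ :=
  riemannianArea M {x | S.reg x ∈ U}

/-- The boundary of the singular surface, that is the boundary of `M`. -/
def boundary (S : ConicalSurface M ι) : Set S.Completion :=
  S.reg '' (𝓡∂ 2).boundary M

/-- A left inverse of `reg`; its value at the tips is irrelevant. -/
def toReg [Nonempty M] (S : ConicalSurface M ι) : S.Completion → M :=
  Sum.elim id fun _ => Classical.arbitrary M

/-- The length of a curve `[0, 1] → S.Completion` which is at a tip for finitely many parameters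
only. -/
def curveLength [Nonempty M] (S : ConicalSurface M ι) (c : ℝ → S.Completion) : ℝ≥0∞ :=
  pathELength (𝓡∂ 2) (S.toReg ∘ c) 0 1

/-- A nonconstant piecewise `C¹` curve of finite length, parametrized by `[0, 1]`, that is closed
or has both end points on the boundary.  It may pass through tips, at finitely many parameters;
there it is only required to be continuous. -/
structure IsCurve [Nonempty M] (S : ConicalSurface M ι) (c : ℝ → S.Completion) : Prop where
  continuousOn : ContinuousOn c (Icc 0 1)
  piecewise_contMDiff : ∃ F : Set ℝ, F.Finite ∧ ∀ t ∈ Ioo (0 : ℝ) 1 \ F,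
    c t ∈ range S.reg ∧ ContMDiffAt 𝓘(ℝ, ℝ) (𝓡∂ 2) 1 (S.toReg ∘ c) t
  length_lt_top : S.curveLength c < ⊤
  nonconstant : ∃ t ∈ Icc (0 : ℝ) 1, c t ≠ c 0
  closed_or_boundary : c 0 = c 1 ∨ (c 0 ∈ S.boundary ∧ c 1 ∈ S.boundary)

/-- The set of points through which a curve with components `c j` passes. -/
def trace (S : ConicalSurface M ι) {n : ℕ} (c : Fin n → ℝ → S.Completion) : Set S.Completion :=
  ⋃ j, c j '' Icc 0 1

/-- The length of a curve with components `c j`. -/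
def length [Nonempty M] (S : ConicalSurface M ι) {n : ℕ} (c : Fin n → ℝ → S.Completion) : ℝ≥0∞ :=
  ∑ j, S.curveLength (c j)

/-- The curve with components `c j` divides the singular surface into two parts (disjoint open
sets) `U` and `V` with `area U / area V = κ`. -/
def Divides [Nonempty M] [MeasurableSpace M] (S : ConicalSurface M ι) (κ : ℝ) {n : ℕ}
    (c : Fin n → ℝ → S.Completion) : Prop :=
  (∀ j, S.IsCurve (c j)) ∧
    ∃ U V : Set S.Completion, IsOpen U ∧ IsOpen V ∧ Disjoint U V ∧ U ∪ V = (S.trace c)ᶜ ∧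
      S.area U = ENNReal.ofReal κ * S.area V

end ConicalSurface

end

/-! ### Polar coordinates of a cone: metric, local inverses and speed of curves. -/

noncomputable section
namespace ConicalSurface

variable {M : Type*} [TopologicalSpace M]
  [ChartedSpace (EuclideanHalfSpace 2) M] [IsManifold (𝓡∂ 2) ∞ M]
  [RiemannianBundle (fun x : M => TangentSpace (𝓡∂ 2) x)] {ι : Type*}

/-! Near the tip the surface is almost a flat cone of angle `α < 2π`. On such a cone `N` radii of
length `r` are not the shortest star through their `N` end points. If the common point is moved from
the tip by `δ r` in a direction `φ₀`, then the radius at angular distance `d` from `φ₀` gets length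
about `r √(1 - 2δ cos d + δ²)`. The mean of `cos d` over all directions is `2 sin (α/2) / α`, which
is positive because `α < 2π`. Hence for a suitable `φ₀` (`exists_direction`) and `δ = 2 sin (α/2) /
α` the star is shorter than `r N` by a fixed proportion (`sum_armLength_le`).

Suppose that a minimizer passes through the tip. By the coarea inequality and Sard's theorem there
are arbitrarily small `r` such that the curve crosses the circle of radius `r` transversally at
finitely many parameters, `N ≥ 1` of them, and has length at least `r N` inside
(`exists_good_level`). Replacing the inside by a star (`exists_surgery`) saves at least a constant
times `r`. The star still separates: projection from its vertex to the circle, truncated at the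
point opposite to the vertex, is a retraction whose fibres over the crossings are the arms
(`starRetract_mem_iff`), so the preimages of the old parts are the new parts
(`exists_star_competitor`).

Areas change by `O(r²)` only (`exists_area_ball_le`). If both parts meet the cone, a deformation
away from the tip, with parameter `t = O(r²)`, restores the area ratio and multiplies lengths by at
most `1 + C|t|` (`exists_deformation`, `exists_balance`). If one part misses the cone, no area
changes at all, since the curve has area zero there (`area_eq_of_misses_cone`). For small `r` the
gain of order `r` beats the cost of order `r²`, which contradicts minimality (`tip_notMem_trace`).
The angular coordinate of period `α` is the arc length of the cross section at the tip
(`polarChart_arcSymm`). -/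

/-- Polar coordinates `(r, φ) ∈ (0, 1) × ℝ` of the `i`-th cone, of period `α` in `φ`, in which the
metric is `dr² + r² H(r, φ) dφ²` with `H → 1` uniformly as `r → 0`. -/
structure PolarChart (S : ConicalSurface M ι) (i : ι) (p : ℝ × ℝ → M) (H : ℝ × ℝ → ℝ)
    (α : ℝ) : Prop where
  pos : 0 < α
  smooth : ContMDiffOn 𝓘(ℝ, ℝ × ℝ) (𝓡∂ 2) 1 p (Ioo 0 1 ×ˢ univ)
  interior : ∀ r ∈ Ioo (0 : ℝ) 1, ∀ φ : ℝ, (𝓡∂ 2).IsInteriorPoint (p (r, φ))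
  eq_iff : ∀ r ∈ Ioo (0 : ℝ) 1, ∀ r' ∈ Ioo (0 : ℝ) 1, ∀ φ φ' : ℝ,
    p (r, φ) = p (r', φ') ↔ r = r' ∧ ∃ k : ℤ, φ' = φ + k * α
  range_eq : ∀ r ∈ Ioo (0 : ℝ) 1, range (fun φ => p (r, φ)) = range (fun θ => S.polar i (r, θ))
  cross_contDiffOn : ContDiffOn ℝ 1 H (Ioo 0 1 ×ˢ univ)
  cross_pos : ∀ r ∈ Ioo (0 : ℝ) 1, ∀ φ : ℝ, 0 < H (r, φ)
  inner_radial_radial : ∀ r ∈ Ioo (0 : ℝ) 1, ∀ φ : ℝ,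
    inner ℝ (mfderiv 𝓘(ℝ, ℝ × ℝ) (𝓡∂ 2) p (r, φ) ((1, 0) : ℝ × ℝ))
      (mfderiv 𝓘(ℝ, ℝ × ℝ) (𝓡∂ 2) p (r, φ) ((1, 0) : ℝ × ℝ)) = (1 : ℝ)
  inner_radial_angular : ∀ r ∈ Ioo (0 : ℝ) 1, ∀ φ : ℝ,
    inner ℝ (mfderiv 𝓘(ℝ, ℝ × ℝ) (𝓡∂ 2) p (r, φ) ((1, 0) : ℝ × ℝ))
      (mfderiv 𝓘(ℝ, ℝ × ℝ) (𝓡∂ 2) p (r, φ) ((0, 1) : ℝ × ℝ)) = (0 : ℝ)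
  inner_angular_angular : ∀ r ∈ Ioo (0 : ℝ) 1, ∀ φ : ℝ,
    inner ℝ (mfderiv 𝓘(ℝ, ℝ × ℝ) (𝓡∂ 2) p (r, φ) ((0, 1) : ℝ × ℝ))
      (mfderiv 𝓘(ℝ, ℝ × ℝ) (𝓡∂ 2) p (r, φ) ((0, 1) : ℝ × ℝ)) = r ^ 2 * H (r, φ)
  cross_tendsto : ∀ η > 0, ∃ s ∈ Ioo (0 : ℝ) 1, ∀ r ∈ Ioo 0 s, ∀ φ : ℝ, |H (r, φ) - 1| < η

/-- The coordinate domain of polar coordinates. -/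
def strip : Set (ℝ × ℝ) := Ioo 0 1 ×ˢ univ

lemma isOpen_strip : IsOpen strip := isOpen_Ioo.prod isOpen_univ

lemma mem_strip {y : ℝ × ℝ} : y ∈ strip ↔ 0 < y.1 ∧ y.1 < 1 := by
  simp [strip, mem_prod]

lemma strip_mem_nhds {y : ℝ × ℝ} (hy : y ∈ strip) : strip ∈ 𝓝 y := isOpen_strip.mem_nhds hy

/-- The derivatives take values in tangent spaces at points that are only propositionally equal, so
they are compared by heterogeneous equality, and their norms after substituting one point for the
other. -/
lemma enorm_mfderiv_congr {c c' : ℝ → M} {t : ℝ} (h : c =ᶠ[𝓝 t] c') :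
    ‖mfderiv 𝓘(ℝ, ℝ) (𝓡∂ 2) c t 1‖ₑ = ‖mfderiv 𝓘(ℝ, ℝ) (𝓡∂ 2) c' t 1‖ₑ := by
  have key : ∀ (x x' : M) (_ : x = x')
      (A : TangentSpace 𝓘(ℝ, ℝ) t →L[ℝ] TangentSpace (𝓡∂ 2) x)
      (A' : TangentSpace 𝓘(ℝ, ℝ) t →L[ℝ] TangentSpace (𝓡∂ 2) x'),
      A ≍ A' → ‖A 1‖ₑ = ‖A' 1‖ₑ := by
    rintro x _ rfl A A' hA
    rw [eq_of_heq hA]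
  exact key _ _ h.self_of_nhds _ _
    (heq_of_eq (h.mfderiv_eq (I := 𝓘(ℝ, ℝ)) (I' := 𝓡∂ 2)))

namespace PolarChart

variable {S : ConicalSurface M ι} {i : ι} {p : ℝ × ℝ → M} {H : ℝ × ℝ → ℝ} {α : ℝ}

lemma contMDiffAt (h : PolarChart S i p H α) {y : ℝ × ℝ} (hy : y ∈ strip) :
    ContMDiffAt 𝓘(ℝ, ℝ × ℝ) (𝓡∂ 2) 1 p y :=
  (h.smooth y hy).contMDiffAt (strip_mem_nhds hy)

lemma mdifferentiableAt (h : PolarChart S i p H α) {y : ℝ × ℝ} (hy : y ∈ strip) :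
    MDifferentiableAt 𝓘(ℝ, ℝ × ℝ) (𝓡∂ 2) p y :=
  (h.contMDiffAt hy).mdifferentiableAt one_ne_zero

lemma continuousAt (h : PolarChart S i p H α) {y : ℝ × ℝ} (hy : y ∈ strip) :
    ContinuousAt p y := (h.contMDiffAt hy).continuousAt

lemma inner_mfderiv (h : PolarChart S i p H α) {y : ℝ × ℝ} (hy : y ∈ strip) (v w : ℝ × ℝ) :
    (inner ℝ (mfderiv 𝓘(ℝ, ℝ × ℝ) (𝓡∂ 2) p y v) (mfderiv 𝓘(ℝ, ℝ × ℝ) (𝓡∂ 2) p y w) : ℝ) =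
      v.1 * w.1 + y.1 ^ 2 * H y * (v.2 * w.2) := by
  obtain ⟨r, φ⟩ := y
  have hr : r ∈ Ioo (0 : ℝ) 1 := mem_strip.1 hy
  have e : ∀ v : ℝ × ℝ, mfderiv 𝓘(ℝ, ℝ × ℝ) (𝓡∂ 2) p (r, φ) v =
      v.1 • mfderiv 𝓘(ℝ, ℝ × ℝ) (𝓡∂ 2) p (r, φ) ((1, 0) : ℝ × ℝ) +
      v.2 • mfderiv 𝓘(ℝ, ℝ × ℝ) (𝓡∂ 2) p (r, φ) ((0, 1) : ℝ × ℝ) := by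
    intro v
    have hv : v = v.1 • ((1, 0) : ℝ × ℝ) + v.2 • ((0, 1) : ℝ × ℝ) := by ext <;> simp
    conv_lhs => rw [hv]
    erw [map_add, map_smul, map_smul]
  have h1 := h.inner_radial_radial r hr φ
  have h2 := h.inner_radial_angular r hr φ
  have h3 := h.inner_angular_angular r hr φ
  rw [e v, e w]
  simp only [inner_add_left, inner_add_right, real_inner_smul_left, real_inner_smul_right]
  rw [real_inner_comm, real_inner_comm] at h2
  rw [h1, h3, h2, real_inner_comm, h2]
  ring

lemma norm_mfderiv (h : PolarChart S i p H α) {y : ℝ × ℝ} (hy : y ∈ strip) (v : ℝ × ℝ) :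
    ‖mfderiv 𝓘(ℝ, ℝ × ℝ) (𝓡∂ 2) p y v‖ = Real.sqrt (v.1 ^ 2 + y.1 ^ 2 * H y * v.2 ^ 2) := by
  rw [@norm_eq_sqrt_real_inner, h.inner_mfderiv hy]
  congr 1; ring

lemma coeff_pos (h : PolarChart S i p H α) {y : ℝ × ℝ} (hy : y ∈ strip) :
    0 < y.1 ^ 2 * H y :=
  mul_pos (pow_pos (mem_strip.1 hy).1 2) (h.cross_pos y.1 (mem_strip.1 hy) y.2)

/-- Positive definiteness of `dr² + r² H dφ²`. It makes the differential of `p` injective, as the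
inverse function theorem requires. -/
lemma mfderiv_eq_zero (h : PolarChart S i p H α) {y : ℝ × ℝ} (hy : y ∈ strip) {v : ℝ × ℝ}
    (hv : mfderiv 𝓘(ℝ, ℝ × ℝ) (𝓡∂ 2) p y v = 0) : v = 0 := by
  have h1 := h.norm_mfderiv hy v
  rw [hv] at h1
  have hc := h.coeff_pos hy
  have h2 : v.1 ^ 2 + y.1 ^ 2 * H y * v.2 ^ 2 ≤ 0 :=
    Real.sqrt_eq_zero'.1 (by rw [← h1]; exact norm_zero)
  have h3 : 0 ≤ y.1 ^ 2 * H y * v.2 ^ 2 := by positivity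
  have h4 : v.1 ^ 2 = 0 := le_antisymm (by linarith) (sq_nonneg _)
  have h5 : y.1 ^ 2 * H y * v.2 ^ 2 = 0 := le_antisymm (by nlinarith) h3
  ext
  · simpa using h4
  · simpa [hc.ne'] using h5

/-- The polar coordinates have local `C¹` inverses. -/
lemma exists_localInverse (h : PolarChart S i p H α) {y₀ : ℝ × ℝ} (hy : y₀ ∈ strip) :
    ∃ g : M → ℝ × ℝ, ContMDiffAt (𝓡∂ 2) 𝓘(ℝ, ℝ × ℝ) 1 g (p y₀) ∧ g (p y₀) = y₀ ∧
      (∀ᶠ x in 𝓝 (p y₀), p (g x) = x) ∧ ∀ᶠ y in 𝓝 y₀, g (p y) = y := by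
  set x₀ := p y₀ with hx₀
  set e := extChartAt (𝓡∂ 2) x₀ with he
  have hint : (𝓡∂ 2).IsInteriorPoint x₀ := h.interior y₀.1 (mem_strip.1 hy) y₀.2
  -- At an interior point the half space is a neighbourhood of the coordinates, so the inverse chart
  -- is differentiable there without restriction to its range.
  have hrange : range (𝓡∂ 2) ∈ 𝓝 (e x₀) := range_mem_nhds_isInteriorPoint hint
  set f : ℝ × ℝ → EuclideanSpace ℝ (Fin 2) := fun y => e (p y) with hf
  have hfC : ContDiffAt ℝ 1 f y₀ := by
    rw [← contMDiffAt_iff_contDiffAt]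
    exact (contMDiffAt_extChartAt (n := 1)).comp y₀ (h.contMDiffAt hy)
  have hfd : HasFDerivAt f (fderiv ℝ f y₀) y₀ := (hfC.differentiableAt one_ne_zero).hasFDerivAt
  have hsrc : ∀ᶠ y in 𝓝 y₀, p y ∈ e.source :=
    (h.continuousAt hy).eventually (extChartAt_source_mem_nhds x₀)
  have hpe : p =ᶠ[𝓝 y₀] fun y => e.symm (f y) := by
    filter_upwards [hsrc] with y hy'
    exact (e.left_inv hy').symm
  have hsymm : MDifferentiableAt 𝓘(ℝ, EuclideanSpace ℝ (Fin 2)) (𝓡∂ 2) e.symm (f y₀) :=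
    (mdifferentiableWithinAt_extChartAt_symm (mem_extChartAt_target x₀)).mdifferentiableAt hrange
  have hcomp : mfderiv 𝓘(ℝ, ℝ × ℝ) (𝓡∂ 2) p y₀ =
      (mfderiv 𝓘(ℝ, EuclideanSpace ℝ (Fin 2)) (𝓡∂ 2) e.symm (f y₀)).comp (fderiv ℝ f y₀) := by
    have hc := mfderiv_comp (I := 𝓘(ℝ, ℝ × ℝ)) (I' := 𝓘(ℝ, EuclideanSpace ℝ (Fin 2)))
      (I'' := 𝓡∂ 2) y₀ hsymm
      ((hfC.differentiableAt one_ne_zero).mdifferentiableAt)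
    rw [mfderiv_eq_fderiv] at hc
    have := hpe.mfderiv_eq (I := 𝓘(ℝ, ℝ × ℝ)) (I' := 𝓡∂ 2)
    apply ContinuousLinearMap.ext
    intro v
    have h1 := congrArg (fun L => (L : ℝ × ℝ →L[ℝ] EuclideanSpace ℝ (Fin 2)) v) this
    have h2 := congrArg (fun L => (L : ℝ × ℝ →L[ℝ] EuclideanSpace ℝ (Fin 2)) v) hc
    exact h1.trans h2
  have hinj : Function.Injective (fderiv ℝ f y₀) := by
    refine (injective_iff_map_eq_zero _).2 fun v hv => h.mfderiv_eq_zero hy ?_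
    rw [hcomp]
    change (mfderiv 𝓘(ℝ, EuclideanSpace ℝ (Fin 2)) (𝓡∂ 2) e.symm (f y₀)) (fderiv ℝ f y₀ v) = 0
    rw [hv]
    exact map_zero _
  -- An injective linear map between planes is invertible.
  let A : (ℝ × ℝ) ≃L[ℝ] EuclideanSpace ℝ (Fin 2) :=
    (LinearEquiv.ofInjectiveOfFinrankEq (fderiv ℝ f y₀ : ℝ × ℝ →ₗ[ℝ] EuclideanSpace ℝ (Fin 2))
      hinj (by simp)).toContinuousLinearEquiv
  have hA : (A : ℝ × ℝ →L[ℝ] EuclideanSpace ℝ (Fin 2)) = fderiv ℝ f y₀ := by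
    ext v <;> rfl
  have hfA : HasFDerivAt f (A : ℝ × ℝ →L[ℝ] EuclideanSpace ℝ (Fin 2)) y₀ := hA ▸ hfd
  have hstrict := hfC.hasStrictFDerivAt' hfA one_ne_zero
  set gl := hfC.localInverse hfA one_ne_zero with hgl
  have hglC : ContDiffAt ℝ 1 gl (f y₀) := hfC.to_localInverse hfA one_ne_zero
  have hgl0 : gl (f y₀) = y₀ := hfC.localInverse_apply_image hfA one_ne_zero
  have hl : ∀ᶠ y in 𝓝 y₀, gl (f y) = y := hstrict.eventually_left_inverse
  have hr : ∀ᶠ z in 𝓝 (f y₀), f (gl z) = z := hstrict.eventually_right_inverse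
  have hecont : ContinuousAt e x₀ := continuousAt_extChartAt x₀
  have hgcont : ContinuousAt (fun x => gl (e x)) x₀ :=
    ContinuousAt.comp (g := gl) hglC.continuousAt hecont
  refine ⟨fun x => gl (e x), ?_, hgl0, ?_, hl⟩
  · exact (contMDiffAt_iff_contDiffAt.2 hglC).comp x₀ (contMDiffAt_extChartAt (n := 1))
  · have h1 : ∀ᶠ x in 𝓝 x₀, p (gl (e x)) ∈ e.source := by
      have : Tendsto (fun x => gl (e x)) (𝓝 x₀) (𝓝 y₀) := by
        have := hgcont.tendsto
        simpa only [show gl (e x₀) = y₀ from hgl0] using this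
      exact this.eventually hsrc
    filter_upwards [h1, hecont.eventually hr, extChartAt_source_mem_nhds (I := 𝓡∂ 2) x₀]
      with x hx1 hx2 hx3
    exact e.injOn hx1 hx3 hx2

/-- `p` is a local homeomorphism. Through this equality of filters, continuity of a map at a point
of the cone is checked in polar coordinates. -/
lemma map_nhds (h : PolarChart S i p H α) {y₀ : ℝ × ℝ} (hy : y₀ ∈ strip) :
    map p (𝓝 y₀) = 𝓝 (p y₀) := by
  obtain ⟨g, hg, hg0, hr, -⟩ := h.exists_localInverse hy
  refine le_antisymm (h.continuousAt hy) ?_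
  have ht : Tendsto g (𝓝 (p y₀)) (𝓝 y₀) := by
    have := hg.continuousAt.tendsto
    rwa [hg0] at this
  calc 𝓝 (p y₀) = map (fun x => p (g x)) (𝓝 (p y₀)) := by
        rw [Filter.map_congr (show (fun x => p (g x)) =ᶠ[𝓝 (p y₀)] id from hr), Filter.map_id]
    _ = map p (map g (𝓝 (p y₀))) := (Filter.map_map).symm
    _ ≤ map p (𝓝 y₀) := Filter.map_mono ht

lemma isOpen_image (h : PolarChart S i p H α) {E : Set (ℝ × ℝ)} (hE : IsOpen E)
    (hs : E ⊆ strip) : IsOpen (p '' E) := by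
  rw [isOpen_iff_mem_nhds]
  rintro _ ⟨y, hy, rfl⟩
  rw [← h.map_nhds (hs hy)]
  exact image_mem_map (hE.mem_nhds hy)

/-- A `C¹` curve through a point of the cone is given by a `C¹` curve of polar coordinates. -/
lemma exists_lift (h : PolarChart S i p H α) {c : ℝ → M} {t : ℝ} {y₀ : ℝ × ℝ} (hy : y₀ ∈ strip)
    (hc : ContMDiffAt 𝓘(ℝ, ℝ) (𝓡∂ 2) 1 c t) (hct : c t = p y₀) :
    ∃ y : ℝ → ℝ × ℝ, ContDiffAt ℝ 1 y t ∧ y t = y₀ ∧ ∀ᶠ s in 𝓝 t, y s ∈ strip ∧ c s = p (y s) := by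
  obtain ⟨g, hg, hg0, hr, -⟩ := h.exists_localInverse hy
  have hy1 : ContMDiffAt 𝓘(ℝ, ℝ) 𝓘(ℝ, ℝ × ℝ) 1 (fun s => g (c s)) t := by
    rw [← hct] at hg
    exact hg.comp t hc
  have hyt : g (c t) = y₀ := by rw [hct, hg0]
  refine ⟨fun s => g (c s), contMDiffAt_iff_contDiffAt.1 hy1, hyt, ?_⟩
  have h1 : ∀ᶠ s in 𝓝 t, g (c s) ∈ strip := by
    refine hy1.continuousAt.eventually ?_
    simp only [hyt]
    exact strip_mem_nhds hy
  have h2 : ∀ᶠ s in 𝓝 t, p (g (c s)) = c s := by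
    rw [← hct] at hr
    exact hc.continuousAt.eventually hr
  filter_upwards [h1, h2] with s hs1 hs2 using ⟨hs1, hs2.symm⟩

lemma contMDiffAt_comp (h : PolarChart S i p H α) {y : ℝ → ℝ × ℝ} {t : ℝ} (hy : y t ∈ strip)
    (hyd : ContDiffAt ℝ 1 y t) :
    ContMDiffAt 𝓘(ℝ, ℝ) (𝓡∂ 2) 1 (fun s => p (y s)) t :=
  (h.contMDiffAt hy).comp t (contMDiffAt_iff_contDiffAt.2 hyd)

/-- The speed of a curve in the cone. -/
lemma norm_mfderiv_curve (h : PolarChart S i p H α) {c : ℝ → M} {y : ℝ → ℝ × ℝ} {t : ℝ}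
    {v : ℝ × ℝ} (hy : y t ∈ strip) (hyd : HasDerivAt y v t) (hc : ∀ᶠ s in 𝓝 t, c s = p (y s)) :
    ‖mfderiv 𝓘(ℝ, ℝ) (𝓡∂ 2) c t 1‖ₑ =
      ENNReal.ofReal (Real.sqrt (v.1 ^ 2 + (y t).1 ^ 2 * H (y t) * v.2 ^ 2)) := by
  have hc' : c =ᶠ[𝓝 t] p ∘ y := hc
  have key : mfderiv 𝓘(ℝ, ℝ) (𝓡∂ 2) (p ∘ y) t =
      (mfderiv 𝓘(ℝ, ℝ × ℝ) (𝓡∂ 2) p (y t)).comp (mfderiv 𝓘(ℝ, ℝ) 𝓘(ℝ, ℝ × ℝ) y t) :=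
    mfderiv_comp (I' := 𝓘(ℝ, ℝ × ℝ)) t (h.mdifferentiableAt hy)
      hyd.differentiableAt.mdifferentiableAt
  have hd : mfderiv 𝓘(ℝ, ℝ) 𝓘(ℝ, ℝ × ℝ) y t (1 : ℝ) = v := by
    rw [mfderiv_eq_fderiv]
    have := hyd.hasFDerivAt.fderiv
    rw [this]
    exact one_smul ℝ v
  have h2 : ‖mfderiv 𝓘(ℝ, ℝ) (𝓡∂ 2) (p ∘ y) t 1‖ =
      Real.sqrt (v.1 ^ 2 + (y t).1 ^ 2 * H (y t) * v.2 ^ 2) := by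
    rw [← h.norm_mfderiv hy v, ← hd]
    rw [key]
    rfl
  rw [enorm_mfderiv_congr hc', ← h2]
  exact (ofReal_norm _).symm

end PolarChart
end ConicalSurface
end

/-! ### The Riemannian area of subsets of a cone in polar coordinates. -/

noncomputable section
namespace ConicalSurface

lemma measurableSet_inter_preimage_of_continuousOn {X Y : Type*} [TopologicalSpace X]
    [MeasurableSpace X] [OpensMeasurableSpace X] [TopologicalSpace Y] [MeasurableSpace Y]
    [BorelSpace Y] {f : X → Y} {s : Set X} {A : Set Y} (hf : ContinuousOn f s)
    (hs : MeasurableSet s) (hA : MeasurableSet A) : MeasurableSet (s ∩ f ⁻¹' A) := by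
  have h1 : Measurable (s.domRestrict f) := (continuousOn_iff_continuous_domRestrict.1 hf).measurable
  have h2 : MeasurableSet ((↑) '' (s.domRestrict f ⁻¹' A) : Set X) := hs.subtype_image (h1 hA)
  have : ((↑) '' (s.domRestrict f ⁻¹' A) : Set X) = s ∩ f ⁻¹' A := by
    ext x; simp [and_comm]
  rwa [← this]

lemma det_clm_prod (A : ℝ × ℝ →L[ℝ] ℝ × ℝ) :
    A.det = (A (1, 0)).1 * (A (0, 1)).2 - (A (0, 1)).1 * (A (1, 0)).2 := by
  rw [ContinuousLinearMap.det, ← LinearMap.det_toMatrix (Module.Basis.finTwoProd ℝ),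
    Matrix.det_fin_two]
  simp [LinearMap.toMatrix_apply]

/-- `det (Aᵀ G A) = (det A)² det G`, where `Aᵀ G A` is the diagonal matrix with entries `1` and `K`.
-/
lemma gram_det {a b c d g₀ g₁ g₂ K : ℝ} (h₁ : a * a * g₀ + (a * c + c * a) * g₁ + c * c * g₂ = 1)
    (h₂ : a * b * g₀ + (a * d + c * b) * g₁ + c * d * g₂ = 0)
    (h₃ : b * b * g₀ + (b * d + d * b) * g₁ + d * d * g₂ = K) :
    (a * d - b * c) ^ 2 * (g₀ * g₂ - g₁ * g₁) = K := by
  linear_combination (b * b * g₀ + (b * d + d * b) * g₁ + d * d * g₂) * h₁ + h₃ -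
    (a * b * g₀ + (a * d + c * b) * g₁ + c * d * g₂) * h₂

variable {M : Type*} [TopologicalSpace M]
  [ChartedSpace (EuclideanHalfSpace 2) M] [IsManifold (𝓡∂ 2) ∞ M]
  [RiemannianBundle (fun x : M => TangentSpace (𝓡∂ 2) x)] {ι : Type*}

/-- The density of the area of a cone in polar coordinates. -/
def areaDensity (H : ℝ × ℝ → ℝ) (y : ℝ × ℝ) : ℝ := y.1 * Real.sqrt (H y)

/-- The identification of the Euclidean plane with `ℝ × ℝ`. -/
def planeEquiv : EuclideanSpace ℝ (Fin 2) ≃L[ℝ] ℝ × ℝ :=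
  (EuclideanSpace.equiv (Fin 2) ℝ).trans (ContinuousLinearEquiv.finTwoArrow ℝ ℝ)

lemma planeEquiv_apply (z : EuclideanSpace ℝ (Fin 2)) : planeEquiv z = (z 0, z 1) := rfl

lemma measurePreserving_planeEquiv : MeasurePreserving planeEquiv := by
  have h1 := PiLp.volume_preserving_ofLp (Fin 2)
  exact (volume_preserving_finTwoArrow ℝ).comp h1

lemma euclidean_eq_sum (z : EuclideanSpace ℝ (Fin 2)) :
    z = z 0 • EuclideanSpace.single 0 (1 : ℝ) + z 1 • EuclideanSpace.single 1 (1 : ℝ) := by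
  ext i
  fin_cases i <;> simp

namespace PolarChart

variable {S : ConicalSurface M ι} {i : ι} {p : ℝ × ℝ → M} {H : ℝ × ℝ → ℝ} {α : ℝ}

lemma continuousOn (h : PolarChart S i p H α) : ContinuousOn p strip := h.smooth.continuousOn

lemma extend_mem_interior_range (h : PolarChart S i p H α)
    {φ : OpenPartialHomeomorph M (EuclideanHalfSpace 2)}
    (hφ : φ ∈ atlas (EuclideanHalfSpace 2) M) {y : ℝ × ℝ} (hy : y ∈ strip) (hs : p y ∈ φ.source) :
    range (𝓡∂ 2) ∈ 𝓝 (φ.extend (𝓡∂ 2) (p y)) := by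
  have h1 := ((𝓡∂ 2).isInteriorPoint_iff_of_mem_atlas (n := ∞) (by simp) hφ hs).1
    (h.interior y.1 (mem_strip.1 hy) y.2)
  have h2 : _root_.interior (φ.extend (𝓡∂ 2)).target ⊆ _root_.interior (range (𝓡∂ 2)) :=
    interior_mono (φ.extend_target_subset_range)
  exact mem_interior_iff_mem_nhds.1 (h2 h1)

lemma contDiffAt_extend (h : PolarChart S i p H α)
    {φ : OpenPartialHomeomorph M (EuclideanHalfSpace 2)}
    (hφ : φ ∈ atlas (EuclideanHalfSpace 2) M) {y : ℝ × ℝ} (hy : y ∈ strip) (hs : p y ∈ φ.source) :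
    ContDiffAt ℝ 1 (fun z => φ.extend (𝓡∂ 2) (p z)) y := by
  rw [← contMDiffAt_iff_contDiffAt]
  have : IsManifold (𝓡∂ 2) 1 M := inferInstance
  exact (φ.contMDiffAt_extend (n := 1) (IsManifold.subset_maximalAtlas hφ) hs).comp y
    (h.contMDiffAt hy)

/-- The coordinate change from polar coordinates to the chart pulls the Gram matrix of the chart
back to the matrix with diagonal `1, r² H`. Taking square roots of determinants gives the density `r
√H`. -/
lemma abs_det_mul_chartAreaDensity (h : PolarChart S i p H α)
    {φ : OpenPartialHomeomorph M (EuclideanHalfSpace 2)}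
    (hφ : φ ∈ atlas (EuclideanHalfSpace 2) M) {y : ℝ × ℝ} (hy : y ∈ strip) (hs : p y ∈ φ.source) :
    |(fderiv ℝ (fun z => planeEquiv (φ.extend (𝓡∂ 2) (p z))) y).det| *
      chartAreaDensity φ (φ.extend (𝓡∂ 2) (p y)) = areaDensity H y := by
  set f : ℝ × ℝ → EuclideanSpace ℝ (Fin 2) := fun z => φ.extend (𝓡∂ 2) (p z) with hf
  have hfC : ContDiffAt ℝ 1 f y := h.contDiffAt_extend hφ hy hs
  have hrange := h.extend_mem_interior_range hφ hy hs
  have hd : fderiv ℝ (fun z => planeEquiv (f z)) y =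
      (planeEquiv : EuclideanSpace ℝ (Fin 2) →L[ℝ] ℝ × ℝ).comp (fderiv ℝ f y) :=
    planeEquiv.comp_fderiv
  set B : EuclideanSpace ℝ (Fin 2) →L[ℝ] TangentSpace (𝓡∂ 2) ((φ.extend (𝓡∂ 2)).symm (f y)) :=
    mfderivWithin 𝓘(ℝ, EuclideanSpace ℝ (Fin 2)) (𝓡∂ 2) (φ.extend (𝓡∂ 2)).symm
      (range (𝓡∂ 2)) (f y) with hB
  have hsrc : p y ∈ (φ.extend (𝓡∂ 2)).source := by rwa [φ.extend_source]
  have hpe : p =ᶠ[𝓝 y] fun z => (φ.extend (𝓡∂ 2)).symm (f z) := by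
    filter_upwards [(h.continuousAt hy).eventually (φ.open_source.mem_nhds hs)] with z hz
    exact ((φ.extend (𝓡∂ 2)).left_inv (by rwa [φ.extend_source])).symm
  have hsymm : MDifferentiableAt 𝓘(ℝ, EuclideanSpace ℝ (Fin 2)) (𝓡∂ 2)
      (φ.extend (𝓡∂ 2)).symm (f y) := by
    have : IsManifold (𝓡∂ 2) 1 M := inferInstance
    have h1 := contMDiffOn_extend_symm (n := 1) (I := 𝓡∂ 2) (IsManifold.subset_maximalAtlas hφ)
    have h2 : (𝓡∂ 2) '' φ.target ∈ 𝓝 (f y) := by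
      have h3 := ((𝓡∂ 2).isInteriorPoint_iff_of_mem_atlas (n := ∞) (by simp) hφ hs).1
        (h.interior y.1 (mem_strip.1 hy) y.2)
      have := mem_interior_iff_mem_nhds.1 h3
      rwa [φ.extend_target, ← (𝓡∂ 2).image_eq] at this
    exact (h1.contMDiffAt h2).mdifferentiableAt one_ne_zero
  have hcomp : ∀ v w : ℝ × ℝ, (inner ℝ (B (fderiv ℝ f y v)) (B (fderiv ℝ f y w)) : ℝ) =
      v.1 * w.1 + y.1 ^ 2 * H y * (v.2 * w.2) := by
    intro v w
    rw [← h.inner_mfderiv hy]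
    have hc := mfderiv_comp (I := 𝓘(ℝ, ℝ × ℝ)) (I' := 𝓘(ℝ, EuclideanSpace ℝ (Fin 2)))
      (I'' := 𝓡∂ 2) y hsymm ((hfC.differentiableAt one_ne_zero).mdifferentiableAt)
    rw [mfderiv_eq_fderiv] at hc
    have hB' : B = mfderiv 𝓘(ℝ, EuclideanSpace ℝ (Fin 2)) (𝓡∂ 2) (φ.extend (𝓡∂ 2)).symm (f y) :=
      mfderivWithin_of_mem_nhds hrange
    have e1 := hpe.mfderiv_eq (I := 𝓘(ℝ, ℝ × ℝ)) (I' := 𝓡∂ 2)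
    have key : ∀ (x x' : M) (_ : x = x')
        (A : ℝ × ℝ →L[ℝ] TangentSpace (𝓡∂ 2) x)
        (A' : ℝ × ℝ →L[ℝ] TangentSpace (𝓡∂ 2) x'),
        A ≍ A' → (inner ℝ (A v) (A w) : ℝ) = inner ℝ (A' v) (A' w) := by
      rintro x _ rfl A A' hA
      rw [eq_of_heq hA]
    refine key _ _ ((φ.extend (𝓡∂ 2)).left_inv hsrc) (B.comp (fderiv ℝ f y)) _ ?_
    rw [hB']
    exact heq_of_eq (hc.symm.trans e1.symm)
  set A := fderiv ℝ f y with hA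
  set g : Fin 2 → Fin 2 → ℝ := fun a b =>
    inner ℝ (B (EuclideanSpace.single a (1 : ℝ))) (B (EuclideanSpace.single b (1 : ℝ))) with hg
  have hgs : g 1 0 = g 0 1 := real_inner_comm _ _
  have hexp : ∀ z z' : EuclideanSpace ℝ (Fin 2), (inner ℝ (B z) (B z') : ℝ) =
      z 0 * z' 0 * g 0 0 + (z 0 * z' 1 + z 1 * z' 0) * g 0 1 + z 1 * z' 1 * g 1 1 := by
    intro z z'
    have e : ∀ z : EuclideanSpace ℝ (Fin 2), B z = z 0 • B (EuclideanSpace.single 0 (1 : ℝ)) +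
        z 1 • B (EuclideanSpace.single 1 (1 : ℝ)) := by
      intro z
      conv_lhs => rw [euclidean_eq_sum z]
      rw [map_add, map_smul, map_smul]
    rw [e z, e z']
    simp only [inner_add_left, inner_add_right, real_inner_smul_left, real_inner_smul_right]
    have : (inner ℝ (B (EuclideanSpace.single 1 (1 : ℝ))) (B (EuclideanSpace.single 0 (1 : ℝ))) : ℝ)
      = g 0 1 := hgs
    rw [this]
    simp only [hg]
    ring
  have E1 := hcomp (1, 0) (1, 0)
  have E2 := hcomp (1, 0) (0, 1)
  have E3 := hcomp (0, 1) (0, 1)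
  rw [hexp] at E1 E2 E3
  simp only [mul_one, mul_zero, add_zero, zero_add] at E1 E2 E3
  have hdens : chartAreaDensity φ (f y) = Real.sqrt (g 0 0 * g 1 1 - g 0 1 * g 0 1) := by
    unfold chartAreaDensity
    rw [Matrix.det_fin_two]
    simp only [Matrix.of_apply]
    congr 1
    have : g 0 0 * g 1 1 - g 0 1 * g 0 1 = g 0 0 * g 1 1 - g 0 1 * g 1 0 := by rw [hgs]
    rw [this]
    rfl
  have hω : areaDensity H y = Real.sqrt (y.1 ^ 2 * H y) := by
    rw [areaDensity, Real.sqrt_mul (sq_nonneg _), Real.sqrt_sq (mem_strip.1 hy).1.le]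
  rw [hdens, hω, hd, det_clm_prod, ← Real.sqrt_sq_eq_abs, ← Real.sqrt_mul (sq_nonneg _)]
  congr 1
  simp only [ContinuousLinearMap.comp_apply, ContinuousLinearEquiv.coe_coe, planeEquiv_apply]
  exact gram_det E1 E2 E3

/-- A fundamental domain of the polar coordinates. -/
def window (φ₁ α : ℝ) : Set (ℝ × ℝ) := Ioo 0 1 ×ˢ Ico φ₁ (φ₁ + α)

lemma measurableSet_window (φ₁ α : ℝ) : MeasurableSet (window φ₁ α) :=
  measurableSet_Ioo.prod measurableSet_Ico

lemma window_subset (φ₁ α : ℝ) : window φ₁ α ⊆ strip := prod_mono Subset.rfl (subset_univ _)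

lemma injOn_window (h : PolarChart S i p H α) (φ₁ : ℝ) : InjOn p (window φ₁ α) := by
  rintro ⟨r, φ⟩ ⟨hr, hφ⟩ ⟨r', φ'⟩ ⟨hr', hφ'⟩ he
  obtain ⟨h1, k, hk⟩ := (h.eq_iff r hr r' hr' φ φ').1 he
  simp only [mem_Ico] at hφ hφ'
  have hpos := h.pos
  have hk1 : (k : ℝ) < 1 := by
    by_contra hcon
    push Not at hcon
    nlinarith
  have hk2 : (-1 : ℝ) < k := by
    by_contra hcon
    push Not at hcon
    nlinarith
  have hk0 : k = 0 := by
    have a : k < 1 := by exact_mod_cast hk1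
    have b : -1 < k := by exact_mod_cast hk2
    omega
  subst hk0
  ext
  · exact h1
  · simpa using hk.symm

lemma exists_mem_window (h : PolarChart S i p H α) (φ₁ : ℝ) {y : ℝ × ℝ} (hy : y ∈ strip) :
    ∃ y' ∈ window φ₁ α, p y' = p y := by
  refine ⟨(y.1, toIcoMod h.pos φ₁ y.2), ⟨mem_strip.1 hy, toIcoMod_mem_Ico h.pos φ₁ y.2⟩, ?_⟩
  refine (h.eq_iff _ (mem_strip.1 hy) _ (mem_strip.1 hy) _ _).2
    ⟨rfl, toIcoDiv h.pos φ₁ y.2, ?_⟩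
  rw [← zsmul_eq_mul, toIcoMod_add_toIcoDiv_zsmul]

lemma isOpen_cone (h : PolarChart S i p H α) : IsOpen (p '' strip) :=
  h.isOpen_image isOpen_strip Subset.rfl

variable [MeasurableSpace M] [BorelSpace M]

/-- The area measure in the coordinates of a chart. -/
def _root_.ConicalSurface.chartArea (φ : OpenPartialHomeomorph M (EuclideanHalfSpace 2)) :
    Measure M :=
  Measure.map (φ.extend (𝓡∂ 2)).symm
      ((volume.restrict (φ.extend (𝓡∂ 2)).target).withDensity
        fun y => ENNReal.ofReal (chartAreaDensity φ y))

lemma measurableSet_preimage (h : PolarChart S i p H α) (φ₁ : ℝ) {X : Set M}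
    (hX : MeasurableSet X) : MeasurableSet (window φ₁ α ∩ p ⁻¹' X) :=
  measurableSet_inter_preimage_of_continuousOn (h.continuousOn.mono (window_subset _ _))
    (measurableSet_window _ _) hX

/-- Change of variables along the passage `T` from polar coordinates to the chart. It is injective
on a window of width `α`, and the window still covers the whole cone. -/
lemma chartArea_apply (h : PolarChart S i p H α)
    {φ : OpenPartialHomeomorph M (EuclideanHalfSpace 2)}
    (hφ : φ ∈ atlas (EuclideanHalfSpace 2) M) (φ₁ : ℝ) {X : Set M} (hX : MeasurableSet X)
    (hXc : X ⊆ p '' strip) :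
    chartArea φ X = ∫⁻ y in window φ₁ α ∩ p ⁻¹' (X ∩ φ.source),
      ENNReal.ofReal (areaDensity H y) := by
  set e := φ.extend (𝓡∂ 2) with he
  have htm : MeasurableSet e.target := by
    rw [he, φ.extend_target]
    exact (φ.open_target.preimage (𝓡∂ 2).continuous_symm).measurableSet.inter
      (𝓡∂ 2).isClosed_range.measurableSet
  have hec : ContinuousOn e.symm e.target := φ.continuousOn_extend_symm
  have hmeas : AEMeasurable e.symm ((volume.restrict e.target).withDensity
        fun y => ENNReal.ofReal (chartAreaDensity φ y)) :=
    (hec.aemeasurable htm).mono_ac (withDensity_absolutelyContinuous _ _)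
  have hZm : MeasurableSet (e.target ∩ e.symm ⁻¹' X) :=
    measurableSet_inter_preimage_of_continuousOn hec htm hX
  have h0 : ((volume.restrict e.target).withDensity
        fun y => ENNReal.ofReal (chartAreaDensity φ y)) e.targetᶜ = 0 := by
    refine withDensity_absolutelyContinuous _ _ ?_
    rw [Measure.restrict_apply htm.compl]
    simp
  have h1 : chartArea φ X = ∫⁻ z in e.target ∩ e.symm ⁻¹' X,
      ENNReal.ofReal (chartAreaDensity φ z) := by
    rw [chartArea, Measure.map_apply_of_aemeasurable hmeas hX,
      ← measure_inter_conull h0, inter_comm, withDensity_apply _ hZm,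
      Measure.restrict_restrict hZm]
    congr 2
    rw [inter_comm, ← inter_assoc, inter_self]
  set E := window φ₁ α ∩ p ⁻¹' (X ∩ φ.source) with hE
  have hEm : MeasurableSet E := h.measurableSet_preimage φ₁ (hX.inter φ.open_source.measurableSet)
  have hEs : E ⊆ strip := inter_subset_left.trans (window_subset _ _)
  set T : ℝ × ℝ → ℝ × ℝ := fun z => planeEquiv (e (p z)) with hT
  have hTinj : InjOn T E := by
    intro y hy y' hy' hyy
    refine h.injOn_window φ₁ hy.1 hy'.1 (e.injOn ?_ ?_ (planeEquiv.injective hyy))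
    · rw [he, φ.extend_source]; exact hy.2.2
    · rw [he, φ.extend_source]; exact hy'.2.2
  have hTd : ∀ y ∈ E, HasFDerivWithinAt T (fderiv ℝ T y) E y := by
    intro y hy
    have := (h.contDiffAt_extend hφ (hEs hy) hy.2.2).differentiableAt one_ne_zero
    exact (planeEquiv.differentiableAt.comp y this).hasFDerivAt.hasFDerivWithinAt
  have himg : planeEquiv.symm ⁻¹' (e.target ∩ e.symm ⁻¹' X) = T '' E := by
    ext z
    constructor
    · rintro ⟨hz1, hz2⟩
      obtain ⟨y, hy, hyz⟩ := hXc hz2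
      obtain ⟨y', hy', hyy'⟩ := h.exists_mem_window φ₁ hy
      have hpz : p y' = e.symm (planeEquiv.symm z) := hyy'.trans hyz
      refine ⟨y', ⟨hy', ?_, ?_⟩, ?_⟩
      · rw [hpz]; exact hz2
      · rw [hpz, ← φ.extend_source (I := 𝓡∂ 2)]; exact e.map_target hz1
      · simp only [hT, hpz]
        rw [e.right_inv hz1]; simp
    · rintro ⟨y, hy, rfl⟩
      have hs : p y ∈ e.source := by rw [he, φ.extend_source]; exact hy.2.2
      simp only [hT, mem_preimage, mem_inter_iff, ContinuousLinearEquiv.symm_apply_apply]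
      refine ⟨e.map_source hs, ?_⟩
      rw [e.left_inv hs]; exact hy.2.1
  have hmp : MeasurePreserving planeEquiv.symm := by
    have := measurePreserving_planeEquiv.symm planeEquiv.toHomeomorph.toMeasurableEquiv
    exact this
  have hemb : MeasurableEmbedding planeEquiv.symm :=
    planeEquiv.symm.toHomeomorph.measurableEmbedding
  rw [h1, ← hmp.setLIntegral_comp_preimage_emb hemb, himg,
    lintegral_image_eq_lintegral_abs_det_fderiv_mul volume hEm hTd hTinj]
  refine setLIntegral_congr_fun hEm fun y hy => ?_
  simp only [hT, ContinuousLinearEquiv.symm_apply_apply]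
  rw [← ENNReal.ofReal_mul (abs_nonneg _), h.abs_det_mul_chartAreaDensity hφ (hEs hy) hy.2.2]

/-- The area measure of the cone in polar coordinates. -/
def coneArea (p : ℝ × ℝ → M) (H : ℝ × ℝ → ℝ) (α φ₁ : ℝ) : Measure M :=
  Measure.map p ((volume.restrict (window φ₁ α)).withDensity
    fun y => ENNReal.ofReal (areaDensity H y))

lemma coneArea_apply (h : PolarChart S i p H α) (φ₁ : ℝ) {X : Set M} (hX : MeasurableSet X) :
    coneArea p H α φ₁ X = ∫⁻ y in window φ₁ α ∩ p ⁻¹' X, ENNReal.ofReal (areaDensity H y) := by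
  have hm := measurableSet_window φ₁ α
  have hmeas : AEMeasurable p ((volume.restrict (window φ₁ α)).withDensity
      fun y => ENNReal.ofReal (areaDensity H y)) :=
    ((h.continuousOn.mono (window_subset _ _)).aemeasurable hm).mono_ac
      (withDensity_absolutelyContinuous _ _)
  have h0 : ((volume.restrict (window φ₁ α)).withDensity
      fun y => ENNReal.ofReal (areaDensity H y)) (window φ₁ α)ᶜ = 0 := by
    refine withDensity_absolutelyContinuous _ _ ?_
    rw [Measure.restrict_apply hm.compl]
    simp
  have hZm := h.measurableSet_preimage φ₁ hX
  rw [coneArea, Measure.map_apply_of_aemeasurable hmeas hX, ← measure_inter_conull h0, inter_comm,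
    withDensity_apply _ hZm, Measure.restrict_restrict hZm]
  congr 2
  rw [inter_comm, ← inter_assoc, inter_self]

/-- The area is a least upper bound of measures, so it suffices to bound each chart measure by
`coneArea` plus the area restricted to the complement of the cone. The second summand vanishes on
subsets of the cone. -/
lemma riemannianArea_le (h : PolarChart S i p H α) (φ₁ : ℝ) {X : Set M} (hX : MeasurableSet X)
    (hXc : X ⊆ p '' strip) : riemannianArea M X ≤ coneArea p H α φ₁ X := by
  have hc := h.isOpen_cone.measurableSet
  have hle : riemannianArea M ≤
      coneArea p H α φ₁ + (riemannianArea M).restrict (p '' strip)ᶜ := by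
    conv_lhs => rw [riemannianArea]
    refine iSup₂_le fun φ hφ => ?_
    change chartArea φ ≤ _
    refine Measure.le_iff.2 fun A hA => ?_
    rw [← measure_inter_add_sdiff A hc, Measure.add_apply]
    refine add_le_add ?_ ?_
    · rw [h.chartArea_apply hφ φ₁ (hA.inter hc) inter_subset_right, h.coneArea_apply φ₁ hA]
      exact lintegral_mono_set fun y hy => ⟨hy.1, hy.2.1.1⟩
    · rw [Measure.restrict_apply hA, ← sdiff_eq]
      exact Measure.le_iff'.1 (le_iSup₂_of_le φ hφ le_rfl : chartArea φ ≤ riemannianArea M) _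
  refine (Measure.le_iff'.1 hle X).trans ?_
  rw [Measure.add_apply, Measure.restrict_apply hX]
  have : X ∩ (p '' strip)ᶜ = ∅ := by
    rw [← sdiff_eq]; exact sdiff_eq_empty.2 hXc
  simp [this]

/-- The area of a subset of the cone, computed in polar coordinates. -/
lemma riemannianArea_eq (h : PolarChart S i p H α) (φ₁ : ℝ) {X : Set M} (hX : MeasurableSet X)
    (hXc : X ⊆ p '' strip) :
    riemannianArea M X =
      ∫⁻ y in window φ₁ α ∩ p ⁻¹' X, ENNReal.ofReal (areaDensity H y) := by
  have hc := h.isOpen_cone.measurableSet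
  rw [← h.coneArea_apply φ₁ hX]
  -- Countably many chart domains cover the cone, so it is enough to compare the two measures inside
  -- one chart domain. There the chart measure itself equals `coneArea`, which gives the inequality
  -- missing from `riemannianArea_le`.
  obtain ⟨C, hCc, hCu⟩ := TopologicalSpace.countable_cover_nhds
    (f := fun y : strip => {z : strip | p z ∈ (chartAt (EuclideanHalfSpace 2) (p y)).source})
    (fun y => by
      have : ContinuousAt (fun z : strip => p z) y :=
        (continuousOn_iff_continuous_domRestrict.1 h.continuousOn).continuousAt
      exact this.preimage_mem_nhds
        ((chartAt (EuclideanHalfSpace 2) (p y)).open_source.mem_nhds (mem_chart_source _ _)))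
  have hcover : p '' strip =
      ⋃ y ∈ C, p '' strip ∩ (chartAt (EuclideanHalfSpace 2) (p (y : ℝ × ℝ))).source := by
    refine Subset.antisymm ?_ (iUnion₂_subset fun y _ => inter_subset_left)
    rintro _ ⟨z, hz, rfl⟩
    have : (⟨z, hz⟩ : strip) ∈ ⋃ y ∈ C,
      {z : strip | p z ∈ (chartAt (EuclideanHalfSpace 2) (p y)).source} := by
      rw [hCu]; trivial
    obtain ⟨y, hy, hyz⟩ := mem_iUnion₂.1 this
    exact mem_iUnion₂.2 ⟨y, hy, ⟨z, hz, rfl⟩, hyz⟩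
  have key : (riemannianArea M).restrict (p '' strip) =
      (coneArea p H α φ₁).restrict (p '' strip) := by
    rw [hcover, Measure.restrict_biUnion_congr hCc]
    intro y _
    set φ := chartAt (EuclideanHalfSpace 2) (p (y : ℝ × ℝ)) with hφ
    have hφm : φ ∈ atlas (EuclideanHalfSpace 2) M := chart_mem_atlas _ _
    ext A hA
    have hs : MeasurableSet (p '' strip ∩ φ.source) := hc.inter φ.open_source.measurableSet
    have hsub : A ∩ (p '' strip ∩ φ.source) ⊆ p '' strip := fun x hx => hx.2.1
    rw [Measure.restrict_apply hA, Measure.restrict_apply hA]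
    refine le_antisymm (h.riemannianArea_le φ₁ (hA.inter hs) hsub) ?_
    have h1 : chartArea φ ≤ riemannianArea M := le_iSup₂_of_le φ hφm le_rfl
    refine le_trans (le_of_eq ?_) (Measure.le_iff'.1 h1 _)
    rw [h.chartArea_apply hφm φ₁ (hA.inter hs) hsub, h.coneArea_apply φ₁ (hA.inter hs)]
    rw [inter_assoc, inter_assoc, inter_self]
  have h2 : (riemannianArea M).restrict (p '' strip) X =
      (coneArea p H α φ₁).restrict (p '' strip) X := by rw [key]
  rwa [Measure.restrict_apply hX, Measure.restrict_apply hX, inter_eq_left.2 hXc] at h2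

end PolarChart
end ConicalSurface
end

/-! ### Topology of the completed surface and the distance to a tip. -/

noncomputable section
namespace ConicalSurface

variable {M : Type*} [TopologicalSpace M]
  [ChartedSpace (EuclideanHalfSpace 2) M] [IsManifold (𝓡∂ 2) ∞ M]
  [RiemannianBundle (fun x : M => TangentSpace (𝓡∂ 2) x)] {ι : Type*}

lemma isOpen_completion_iff (S : ConicalSurface M ι) {U : Set S.Completion} :
    IsOpen U ↔ IsOpen {x | S.reg x ∈ U} ∧
    ∀ i, S.tip i ∈ U → ∃ s ∈ Ioo (0 : ℝ) 1, ∀ r ∈ Ioo 0 s, ∀ θ : ℝ, S.reg (S.polar i (r, θ)) ∈ U :=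
  Iff.rfl

lemma reg_injective (S : ConicalSurface M ι) : Function.Injective S.reg := Sum.inl_injective

lemma reg_ne_tip (S : ConicalSurface M ι) (x : M) (i : ι) : S.reg x ≠ S.tip i := Sum.inl_ne_inr

lemma isOpenEmbedding_reg (S : ConicalSurface M ι) : Topology.IsOpenEmbedding S.reg := by
  refine .of_continuous_injective_isOpenMap ?_ S.reg_injective ?_
  · exact ⟨fun U hU => (S.isOpen_completion_iff.1 hU).1⟩
  · intro O hO
    refine S.isOpen_completion_iff.2 ⟨?_, ?_⟩
    · convert hO using 1
      ext x
      simp [S.reg_injective.eq_iff]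
    · rintro i ⟨x, -, hx⟩
      exact absurd hx (S.reg_ne_tip x i)

lemma map_reg_nhds (S : ConicalSurface M ι) (x : M) : map S.reg (𝓝 x) = 𝓝 (S.reg x) :=
  S.isOpenEmbedding_reg.map_nhds_eq x

lemma toReg_reg [Nonempty M] (S : ConicalSurface M ι) (x : M) : S.toReg (S.reg x) = x := rfl

lemma reg_or_tip (S : ConicalSurface M ι) (z : S.Completion) :
    (∃ x, z = S.reg x) ∨ ∃ i, z = S.tip i := by
  rcases z with x | i
  · exact Or.inl ⟨x, rfl⟩
  · exact Or.inr ⟨i, rfl⟩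

open Classical in
/-- The distance to the `i`-th tip inside the `i`-th cone, and `1` outside of this cone. -/
def radius (S : ConicalSurface M ι) (i : ι) : S.Completion → ℝ :=
  Sum.elim (fun x => if hx : ∃ y ∈ strip, S.polar i y = x then hx.choose.1 else 1)
    fun j => if j = i then 0 else 1

lemma radius_polar (S : ConicalSurface M ι) (i : ι) {y : ℝ × ℝ} (hy : y ∈ strip) :
    S.radius i (S.reg (S.polar i y)) = y.1 := by
  have hx : ∃ y' ∈ strip, S.polar i y' = S.polar i y := ⟨y, hy, rfl⟩
  have h1 : S.radius i (S.reg (S.polar i y)) = hx.choose.1 := dif_pos hx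
  rw [h1]
  exact ((S.polar_eq_iff i _ (mem_strip.1 hx.choose_spec.1) _ (mem_strip.1 hy) _ _).1
    hx.choose_spec.2).1

lemma radius_reg_of_notMem (S : ConicalSurface M ι) (i : ι) {x : M}
    (hx : x ∉ S.polar i '' strip) : S.radius i (S.reg x) = 1 :=
  dif_neg hx

@[simp] lemma radius_tip_self (S : ConicalSurface M ι) (i : ι) : S.radius i (S.tip i) = 0 :=
  if_pos rfl

lemma radius_tip_of_ne (S : ConicalSurface M ι) {i j : ι} (h : j ≠ i) :
    S.radius i (S.tip j) = 1 := if_neg h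

lemma radius_reg_pos (S : ConicalSurface M ι) (i : ι) (x : M) : 0 < S.radius i (S.reg x) := by
  by_cases hx : x ∈ S.polar i '' strip
  · obtain ⟨y, hy, rfl⟩ := hx
    rw [S.radius_polar i hy]
    exact (mem_strip.1 hy).1
  · rw [S.radius_reg_of_notMem i hx]; exact one_pos

lemma radius_eq_zero (S : ConicalSurface M ι) {i : ι} {z : S.Completion}
    (hz : S.radius i z = 0) : z = S.tip i := by
  rcases S.reg_or_tip z with ⟨x, rfl⟩ | ⟨j, rfl⟩
  · exact absurd hz (S.radius_reg_pos i x).ne'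
  · by_contra hne
    have : j ≠ i := fun h => hne (by rw [h])
    rw [S.radius_tip_of_ne this] at hz
    exact one_ne_zero hz

lemma radius_nonneg (S : ConicalSurface M ι) (i : ι) (z : S.Completion) : 0 ≤ S.radius i z := by
  rcases S.reg_or_tip z with ⟨x, rfl⟩ | ⟨j, rfl⟩
  · exact (S.radius_reg_pos i x).le
  · by_cases h : j = i
    · subst h; simp
    · rw [S.radius_tip_of_ne h]; exact zero_le_one

lemma radius_le_one (S : ConicalSurface M ι) (i : ι) (z : S.Completion) : S.radius i z ≤ 1 := by
  rcases S.reg_or_tip z with ⟨x, rfl⟩ | ⟨j, rfl⟩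
  · by_cases hx : x ∈ S.polar i '' strip
    · obtain ⟨y, hy, rfl⟩ := hx
      rw [S.radius_polar i hy]
      exact (mem_strip.1 hy).2.le
    · exact (S.radius_reg_of_notMem i hx).le
  · by_cases h : j = i
    · subst h; simp
    · exact (S.radius_tip_of_ne h).le

namespace PolarChart

variable {S : ConicalSurface M ι} {i : ι} {p : ℝ × ℝ → M} {H : ℝ × ℝ → ℝ} {α : ℝ}

lemma exists_polar_eq (h : PolarChart S i p H α) {y : ℝ × ℝ} (hy : y ∈ strip) :
    ∃ θ, p y = S.polar i (y.1, θ) := by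
  have : p (y.1, y.2) ∈ range (fun φ => p (y.1, φ)) := ⟨y.2, rfl⟩
  rw [h.range_eq y.1 (mem_strip.1 hy)] at this
  obtain ⟨θ, hθ⟩ := this
  exact ⟨θ, hθ.symm⟩

lemma exists_eq_polar (h : PolarChart S i p H α) {y : ℝ × ℝ} (hy : y ∈ strip) :
    ∃ φ, S.polar i y = p (y.1, φ) := by
  have : S.polar i (y.1, y.2) ∈ range (fun φ => S.polar i (y.1, φ)) := ⟨y.2, rfl⟩
  rw [← h.range_eq y.1 (mem_strip.1 hy)] at this
  obtain ⟨θ, hθ⟩ := this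
  exact ⟨θ, hθ.symm⟩

lemma radius_apply (h : PolarChart S i p H α) {y : ℝ × ℝ} (hy : y ∈ strip) :
    S.radius i (S.reg (p y)) = y.1 := by
  obtain ⟨θ, hθ⟩ := h.exists_polar_eq hy
  rw [hθ, S.radius_polar i (y := (y.1, θ)) (mem_strip.2 (mem_strip.1 hy))]

lemma image_prod (h : PolarChart S i p H α) {A : Set ℝ} (hA : A ⊆ Ioo 0 1) :
    p '' (A ×ˢ univ) = S.polar i '' (A ×ˢ univ) := by
  ext x
  constructor
  · rintro ⟨y, hy, rfl⟩
    obtain ⟨θ, hθ⟩ := h.exists_polar_eq (mem_strip.2 (hA hy.1))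
    exact ⟨(y.1, θ), ⟨hy.1, trivial⟩, hθ.symm⟩
  · rintro ⟨y, hy, rfl⟩
    obtain ⟨θ, hθ⟩ := h.exists_eq_polar (mem_strip.2 (hA hy.1))
    exact ⟨(y.1, θ), ⟨hy.1, trivial⟩, hθ.symm⟩

lemma exists_of_radius_lt_one (h : PolarChart S i p H α) {z : S.Completion}
    (hz : S.radius i z < 1) : z = S.tip i ∨ ∃ y ∈ strip, z = S.reg (p y) := by
  rcases S.reg_or_tip z with ⟨x, rfl⟩ | ⟨j, rfl⟩
  · right
    by_cases hx : x ∈ S.polar i '' strip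
    · rw [strip, ← h.image_prod Subset.rfl] at hx
      obtain ⟨y, hy, rfl⟩ := hx
      exact ⟨y, hy, rfl⟩
    · rw [S.radius_reg_of_notMem i hx] at hz
      exact absurd hz (lt_irrefl 1)
  · by_cases hj : j = i
    · exact Or.inl (by rw [hj])
    · rw [S.radius_tip_of_ne hj] at hz
      exact absurd hz (lt_irrefl 1)

lemma exists_of_radius_mem (h : PolarChart S i p H α) {z : S.Completion}
    (hz : S.radius i z ∈ Ioo (0 : ℝ) 1) : ∃ y ∈ strip, z = S.reg (p y) := by
  rcases h.exists_of_radius_lt_one hz.2 with rfl | h1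
  · simp at hz
  · exact h1

lemma setOf_radius_reg_lt (h : PolarChart S i p H α) {s : ℝ} (hs : s ≤ 1) :
    {x | S.radius i (S.reg x) < s} = p '' (Ioo 0 s ×ˢ univ) := by
  ext x
  constructor
  · intro hx
    obtain ⟨y, hy, hxy⟩ := h.exists_of_radius_mem
      ⟨S.radius_reg_pos i x, lt_of_lt_of_le hx hs⟩
    have hxy' := S.reg_injective hxy
    subst hxy'
    rw [mem_ofPred_eq, h.radius_apply hy] at hx
    exact ⟨y, ⟨⟨(mem_strip.1 hy).1, hx⟩, trivial⟩, rfl⟩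
  · rintro ⟨y, hy, rfl⟩
    rw [mem_ofPred_eq, h.radius_apply (mem_strip.2 ⟨hy.1.1, hy.1.2.trans_le hs⟩)]
    exact hy.1.2

lemma isOpen_radius_lt (h : PolarChart S i p H α) (s : ℝ) :
    IsOpen {z | S.radius i z < s} := by
  rcases le_or_gt s 0 with hs | hs
  · convert isOpen_empty
    ext z
    simpa using hs.trans (S.radius_nonneg i z)
  rcases lt_or_ge 1 s with hs1 | hs1
  · convert isOpen_univ
    ext z
    simpa using (S.radius_le_one i z).trans_lt hs1
  refine S.isOpen_completion_iff.2 ⟨?_, ?_⟩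
  · change IsOpen {x | S.radius i (S.reg x) < s}
    rw [h.setOf_radius_reg_lt hs1]
    exact h.isOpen_image (isOpen_Ioo.prod isOpen_univ)
      (prod_mono (Ioo_subset_Ioo_right hs1) Subset.rfl)
  · intro j hj
    have hji : j = i := by
      by_contra hne
      rw [mem_ofPred_eq, S.radius_tip_of_ne hne] at hj
      linarith
    subst hji
    refine ⟨s / 2, ⟨by linarith, by linarith⟩, fun r hr θ => ?_⟩
    rw [mem_ofPred_eq, S.radius_polar j (mem_strip.2 ⟨hr.1, by linarith [hr.2]⟩)]
    linarith [hr.2]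

/-- For `0 < s < 1` the complement in `M` is a truncated cone `{r ≤ s}`, which is closed by
`isClosed_polar`. Another tip has radius `1` and a neighbourhood within its own cone, disjoint from
the `i`-th one. -/
lemma isOpen_lt_radius (h : PolarChart S i p H α) (s : ℝ) :
    IsOpen {z | s < S.radius i z} := by
  rcases lt_or_ge s 0 with hs | hs
  · convert isOpen_univ
    ext z
    simpa using hs.trans_le (S.radius_nonneg i z)
  rcases le_or_gt 1 s with hs1 | hs1
  · convert isOpen_empty
    ext z
    simpa using (S.radius_le_one i z).trans hs1
  refine S.isOpen_completion_iff.2 ⟨?_, ?_⟩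
  · rcases hs.eq_or_lt with rfl | hs
    · convert isOpen_univ
      ext x
      simpa using S.radius_reg_pos i x
    have hcl := S.isClosed_polar i s ⟨hs, hs1⟩
    have hsub : Ioc 0 s ⊆ Ioo 0 1 := fun r hr => ⟨hr.1, hr.2.trans_lt hs1⟩
    rw [← h.image_prod hsub] at hcl
    convert hcl.isOpen_compl
    ext x
    simp only [mem_ofPred_eq, mem_compl_iff]
    rw [← not_iff_not, not_not, not_lt]
    constructor
    · intro hx
      obtain ⟨y, hy, hxy⟩ := h.exists_of_radius_mem
        ⟨S.radius_reg_pos i x, lt_of_le_of_lt hx hs1⟩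
      have hxy' := S.reg_injective hxy
      subst hxy'
      rw [h.radius_apply hy] at hx
      exact ⟨y, ⟨⟨(mem_strip.1 hy).1, hx⟩, trivial⟩, rfl⟩
    · rintro ⟨y, hy, rfl⟩
      rw [h.radius_apply (mem_strip.2 (hsub hy.1))]
      exact hy.1.2
  · intro j hj
    have hji : j ≠ i := by
      rintro rfl
      simp only [mem_ofPred_eq, radius_tip_self] at hj
      linarith
    refine ⟨1 / 2, by norm_num, fun r hr θ => ?_⟩
    have hmem : S.polar j (r, θ) ∈ S.polar j '' (Ioo 0 1 ×ˢ univ) :=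
      ⟨(r, θ), ⟨⟨hr.1, by linarith [hr.2]⟩, trivial⟩, rfl⟩
    have := Set.disjoint_left.1 (S.disjoint_polar j i hji) hmem
    rw [mem_ofPred_eq, S.radius_reg_of_notMem i this]
    exact hs1

lemma continuous_radius (h : PolarChart S i p H α) : Continuous (S.radius i) := by
  rw [OrderTopology.topology_eq_generate_intervals (α := ℝ), continuous_generateFrom_iff]
  rintro U ⟨a, rfl | rfl⟩
  · exact h.isOpen_lt_radius a
  · exact h.isOpen_radius_lt a

lemma mem_nhds_tip (h : PolarChart S i p H α) {W : Set S.Completion} {s : ℝ}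
    (hs : s ∈ Ioo (0 : ℝ) 1) (htip : S.tip i ∈ W)
    (hW : ∀ y ∈ strip, y.1 < s → S.reg (p y) ∈ W) : W ∈ 𝓝 (S.tip i) := by
  refine mem_of_superset ((h.isOpen_radius_lt s).mem_nhds (by simpa using hs.1)) fun z hz => ?_
  rcases h.exists_of_radius_lt_one (lt_trans hz hs.2) with rfl | ⟨y, hy, rfl⟩
  · exact htip
  · refine hW y hy ?_
    rwa [mem_ofPred_eq, h.radius_apply hy] at hz

lemma continuousAt_reg (h : PolarChart S i p H α) {y : ℝ × ℝ} (hy : y ∈ strip) :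
    ContinuousAt (fun y => S.reg (p y)) y :=
  ContinuousAt.comp (g := S.reg) S.isOpenEmbedding_reg.continuous.continuousAt (h.continuousAt hy)

/-- Cones consist of interior points. Hence end points of curves on `∂M` are not affected by any
modification inside a cone. -/
lemma notMem_boundary (h : PolarChart S i p H α) {z : S.Completion} (hz : z ∈ S.boundary) :
    S.radius i z = 1 := by
  obtain ⟨x, hx, rfl⟩ := hz
  refine S.radius_reg_of_notMem i fun hx' => ?_
  rw [strip, ← h.image_prod Subset.rfl] at hx'
  obtain ⟨y, hy, rfl⟩ := hx'
  exact ((𝓡∂ 2).isInteriorPoint_iff_not_isBoundaryPoint _).1 (h.interior y.1 hy.1 y.2) hx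

/-- A curve is `C¹` in polar coordinates near each regular parameter at which it is in the cone. -/
lemma exists_lift_curve [Nonempty M] (h : PolarChart S i p H α) {c : ℝ → S.Completion} {F : Set ℝ}
    (hF : F.Finite) (hc : ∀ t ∈ Ioo (0 : ℝ) 1 \ F,
      c t ∈ range S.reg ∧ ContMDiffAt 𝓘(ℝ, ℝ) (𝓡∂ 2) 1 (S.toReg ∘ c) t)
    {t : ℝ} (ht : t ∈ Ioo (0 : ℝ) 1 \ F) {y₀ : ℝ × ℝ} (hy₀ : y₀ ∈ strip)
    (hct : c t = S.reg (p y₀)) :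
    ∃ y : ℝ → ℝ × ℝ, ContDiffAt ℝ 1 y t ∧ y t = y₀ ∧
      ∀ᶠ s in 𝓝 t, y s ∈ strip ∧ c s = S.reg (p (y s)) := by
  obtain ⟨y, hy1, hy2, hy3⟩ := h.exists_lift hy₀ (hc t ht).2
    (by rw [Function.comp_apply, hct, S.toReg_reg])
  refine ⟨y, hy1, hy2, ?_⟩
  have hO : Ioo (0 : ℝ) 1 \ F ∈ 𝓝 t := (isOpen_Ioo.sdiff hF.isClosed).mem_nhds ht
  filter_upwards [hy3, hO] with s hs hsO
  obtain ⟨x, hx⟩ := (hc s hsO).1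
  refine ⟨hs.1, ?_⟩
  rw [← hs.2, Function.comp_apply, ← hx, S.toReg_reg]

/-- The speed of a curve is at least the derivative of the distance to the tip. -/
lemma hasDerivAt_radius_curve [Nonempty M] (h : PolarChart S i p H α) {c : ℝ → S.Completion}
    {F : Set ℝ} (hF : F.Finite) (hc : ∀ t ∈ Ioo (0 : ℝ) 1 \ F,
      c t ∈ range S.reg ∧ ContMDiffAt 𝓘(ℝ, ℝ) (𝓡∂ 2) 1 (S.toReg ∘ c) t)
    {t : ℝ} (ht : t ∈ Ioo (0 : ℝ) 1 \ F) (hr : S.radius i (c t) ∈ Ioo (0 : ℝ) 1) :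
    DifferentiableAt ℝ (fun s => S.radius i (c s)) t ∧
      ENNReal.ofReal |deriv (fun s => S.radius i (c s)) t| ≤
        ‖mfderiv 𝓘(ℝ, ℝ) (𝓡∂ 2) (S.toReg ∘ c) t 1‖ₑ := by
  obtain ⟨y₀, hy₀, hct⟩ := h.exists_of_radius_mem hr
  obtain ⟨y, hy1, hy2, hy3⟩ := h.exists_lift_curve hF hc ht hy₀ hct
  have hyd := (hy1.differentiableAt one_ne_zero).hasDerivAt
  have h1 : HasDerivAt (fun s => (y s).1) (deriv y t).1 t := hyd.fst
  have h2 : (fun s => S.radius i (c s)) =ᶠ[𝓝 t] fun s => (y s).1 := by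
    filter_upwards [hy3] with s hs
    rw [hs.2, h.radius_apply hs.1]
  have h3 := h1.congr_of_eventuallyEq h2
  refine ⟨h3.differentiableAt, ?_⟩
  rw [h3.deriv, h.norm_mfderiv_curve (y := y) (by rw [hy2]; exact hy₀) hyd
    (by filter_upwards [hy3] with s hs; rw [Function.comp_apply, hs.2, S.toReg_reg])]
  refine ENNReal.ofReal_le_ofReal ?_
  rw [← Real.sqrt_sq_eq_abs]
  refine Real.sqrt_le_sqrt ?_
  have := (h.coeff_pos (y := y t) (by rw [hy2]; exact hy₀)).le
  nlinarith [mul_nonneg this (sq_nonneg (deriv y t).2)]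

end PolarChart
end ConicalSurface
end

/-! ### Counting preimages of levels: coarea inequality, Sard's theorem and good levels. -/

noncomputable section
namespace ConicalSurface

/-- A measurable upper bound for the number of preimages of `s` under a differentiable function,
whose integral is bounded by the total variation. -/
lemma exists_indicatrix {f : ℝ → ℝ} {v : ℝ → ℝ≥0∞} {O : Set ℝ} (hO : MeasurableSet O)
    (hO1 : O ⊆ Ico 0 1)
    (hd : ∀ t ∈ O, DifferentiableAt ℝ f t ∧ ENNReal.ofReal |deriv f t| ≤ v t) :
    ∃ G : ℝ → ℝ≥0∞, Measurable G ∧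
      (∀ s, ∀ A : Finset ℝ, (∀ t ∈ A, t ∈ O ∧ f t = s) → (A.card : ℝ≥0∞) ≤ G s) ∧
      ∀ r, ∫⁻ s in Iio r, G s ≤ ∫⁻ t in O ∩ {t | f t < r}, v t := by
  have hcont : ContinuousOn f O := fun t ht => (hd t ht).1.continuousAt.continuousWithinAt
  let I : ℕ → ℕ → Set ℝ := fun k m => O ∩ {t | ⌊t * k⌋₊ = m}
  have hIm : ∀ k m, MeasurableSet (I k m) := fun k m =>
    hO.inter ((Nat.measurable_floor.comp (measurable_id.mul_const _)) (measurableSet_singleton m))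
  -- The images of the cells of length `1/k` are not known to be measurable. Measurable hulls
  -- replace them at no cost in measure.
  let hull : ℕ → ℕ → Set ℝ := fun k m => toMeasurable volume (f '' I k m)
  let N : ℕ → ℝ → ℝ≥0∞ := fun k s => ∑ m ∈ Finset.range k, (hull k m).indicator 1 s
  have hNm : ∀ k, Measurable (N k) := fun k => Finset.measurable_sum _ fun m _ =>
    measurable_one.indicator (measurableSet_toMeasurable _ _)
  refine ⟨fun s => liminf (fun k => N k s) atTop, Measurable.liminf hNm, ?_, ?_⟩
  · intro s A hA
    -- As soon as the cells are shorter than the smallest gap in `A`, different points of `A` lie in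
    -- different cells, and each of them counts in `N k s`.
    obtain ⟨δ, hδ, hδA⟩ : ∃ δ > 0, ∀ t ∈ A, ∀ t' ∈ A, t ≠ t' → δ ≤ |t - t'| := by
      by_cases hne : (A.offDiag).Nonempty
      · obtain ⟨q, hq, hmin⟩ := A.offDiag.exists_min_image (fun q => |q.1 - q.2|) hne
        rw [Finset.mem_offDiag] at hq
        refine ⟨|q.1 - q.2|, abs_pos.2 (sub_ne_zero.2 hq.2.2), fun t ht t' ht' htt => ?_⟩
        exact hmin (t, t') (Finset.mem_offDiag.2 ⟨ht, ht', htt⟩)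
      · refine ⟨1, one_pos, fun t ht t' ht' htt => ?_⟩
        exact absurd ⟨(t, t'), Finset.mem_offDiag.2 ⟨ht, ht', htt⟩⟩ hne
    obtain ⟨k₀, hk₀⟩ := exists_nat_gt (1 / δ)
    refine le_liminf_of_le (by isBoundedDefault) ?_
    filter_upwards [eventually_ge_atTop (max k₀ 1)] with k hk
    have hk1 : 1 ≤ k := (le_max_right _ _).trans hk
    have hkδ : 1 < δ * k := by
      have : (k₀ : ℝ) ≤ k := by exact_mod_cast (le_max_left _ _).trans hk
      have h2 : 1 / δ < k := hk₀.trans_le this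
      rw [div_lt_iff₀ hδ] at h2
      linarith
    have hkpos : (0 : ℝ) < k := by exact_mod_cast hk1
    have hmaps : ∀ t ∈ A, ⌊t * k⌋₊ ∈ Finset.range k := by
      intro t ht
      have := hO1 (hA t ht).1
      rw [Finset.mem_range, Nat.floor_lt (by have := this.1; positivity)]
      nlinarith [this.2]
    have hinj : Set.InjOn (fun t : ℝ => ⌊t * k⌋₊) A := by
      intro t ht t' ht' htt
      by_contra hne
      have h1 := hδA t ht t' ht' hne
      have ht0 := (hO1 (hA t ht).1).1
      have ht0' := (hO1 (hA t' ht').1).1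
      have a1 := Nat.floor_le (show 0 ≤ t * k by positivity)
      have a2 := Nat.lt_floor_add_one (t * k)
      have b1 := Nat.floor_le (show 0 ≤ t' * k by positivity)
      have b2 := Nat.lt_floor_add_one (t' * k)
      simp only at htt
      rw [htt] at a1 a2
      have h3 : |t - t'| * k < 1 := by
        rw [← abs_of_pos hkpos, ← abs_mul, abs_lt]
        constructor <;> nlinarith
      nlinarith
    calc (A.card : ℝ≥0∞) = ∑ m ∈ A.image (fun t : ℝ => ⌊t * k⌋₊), (1 : ℝ≥0∞) := by
          rw [Finset.sum_const, Finset.card_image_of_injOn hinj]; simp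
      _ ≤ ∑ m ∈ A.image (fun t : ℝ => ⌊t * k⌋₊), (hull k m).indicator 1 s := by
          refine Finset.sum_le_sum fun m hm => ?_
          obtain ⟨t, ht, rfl⟩ := Finset.mem_image.1 hm
          rw [indicator_of_mem]
          · simp
          · exact subset_toMeasurable _ _ ⟨t, ⟨(hA t ht).1, rfl⟩, (hA t ht).2⟩
      _ ≤ N k s := Finset.sum_le_sum_of_subset (Finset.image_subset_iff.2 hmaps)
  · intro r
    -- Fatou's lemma reduces the bound to a fixed subdivision, where the image of each cell has
    -- measure at most the integral of `|f'|` over the cell.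
    refine (lintegral_liminf_le hNm).trans (liminf_le_of_frequently_le' (Frequently.of_forall ?_))
    intro k
    have hfr : MeasurableSet (O ∩ {t | f t < r}) :=
      measurableSet_inter_preimage_of_continuousOn hcont hO measurableSet_Iio
    calc ∫⁻ s in Iio r, N k s = ∑ m ∈ Finset.range k, volume (hull k m ∩ Iio r) := by
          rw [lintegral_finsetSum _ fun m _ =>
            measurable_one.indicator (measurableSet_toMeasurable _ _)]
          refine Finset.sum_congr rfl fun m _ => ?_
          rw [lintegral_indicator_one (measurableSet_toMeasurable _ _),
            Measure.restrict_apply (measurableSet_toMeasurable _ _)]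
      _ ≤ ∑ m ∈ Finset.range k, ∫⁻ t in I k m ∩ {t | f t < r}, v t := by
          refine Finset.sum_le_sum fun m _ => ?_
          have hm : MeasurableSet (I k m ∩ {t | f t < r}) := by
            have : I k m ∩ {t | f t < r} = (O ∩ {t | f t < r}) ∩ I k m := by
              ext t; simp only [I, mem_inter_iff]; tauto
            rw [this]
            exact hfr.inter (hIm k m)
          have hsub : I k m ∩ {t | f t < r} ⊆ O := fun t ht => ht.1.1
          -- A measurable hull has the measure of the original set also after intersection with a
          -- measurable set.
          rw [Measure.measure_toMeasurable_inter_of_sFinite measurableSet_Iio]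
          have himg : f '' I k m ∩ Iio r ⊆ f '' (I k m ∩ {t | f t < r}) := by
            rintro _ ⟨⟨t, ht, rfl⟩, htr⟩
            exact ⟨t, ⟨ht, htr⟩, rfl⟩
          refine (measure_mono himg).trans ((addHaar_image_le_lintegral_abs_det_fderiv volume hm
            (f' := fun t => ContinuousLinearMap.toSpanSingleton ℝ (deriv f t)) fun t ht =>
            (hd t (hsub ht)).1.hasDerivAt.hasFDerivAt.hasFDerivWithinAt).trans ?_)
          refine setLIntegral_mono' hm fun t ht => ?_
          rw [ContinuousLinearMap.det_toSpanSingleton]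
          exact (hd t (hsub ht)).2
      _ ≤ ∫⁻ t in O ∩ {t | f t < r}, v t := by
          rw [← lintegral_biUnion_finset]
          · refine lintegral_mono_set ?_
            refine iUnion₂_subset fun m _ t ht => ⟨ht.1.1, ht.2⟩
          · intro m _ m' _ hne
            refine disjoint_left.2 fun t ht ht' => hne ?_
            exact ht.1.2.symm.trans ht'.1.2
          · intro m _
            have : I k m ∩ {t | f t < r} = (O ∩ {t | f t < r}) ∩ I k m := by
              ext t; simp only [I, mem_inter_iff]; tauto
            rw [this]
            exact hfr.inter (hIm k m)

/-- Sard's theorem in dimension one. -/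
lemma volume_criticalValues {f : ℝ → ℝ} {O : Set ℝ} (hd : ∀ t ∈ O, DifferentiableAt ℝ f t) :
    volume (f '' {t ∈ O | deriv f t = 0}) = 0 := by
  refine addHaar_image_eq_zero_of_det_fderivWithin_eq_zero volume
    (f' := fun t => ContinuousLinearMap.toSpanSingleton ℝ (deriv f t)) (fun t ht =>
      (hd t ht.1).hasDerivAt.hasFDerivAt.hasFDerivWithinAt) fun t ht => ?_
  rw [ContinuousLinearMap.det_toSpanSingleton]
  exact ht.2

/-- There are arbitrarily small regular levels `r` such that `r` times the number of times at which
the level is attained is at most the total variation below the level. -/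
lemma exists_good_level {J : Type*} [Fintype J] {f : J → ℝ → ℝ} {v : J → ℝ → ℝ≥0∞} {O : J → Set ℝ}
    (hO : ∀ j, MeasurableSet (O j)) (hO1 : ∀ j, O j ⊆ Ico 0 1)
    (hd : ∀ j, ∀ t ∈ O j, DifferentiableAt ℝ (f j) t ∧
      ENNReal.ofReal |deriv (f j) t| ≤ v j t)
    (hfin : ∀ j, ∫⁻ t in O j, v j t < ⊤) {bad : Set ℝ} (hbad : volume bad = 0) {ε : ℝ}
    (hε : 0 < ε) :
    ∃ r ∈ Ioo 0 ε, r ∉ bad ∧ ∃ K : J → Finset ℝ,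
      (∀ j t, t ∈ K j ↔ t ∈ O j ∧ f j t = r) ∧ (∀ j, ∀ t ∈ K j, deriv (f j) t ≠ 0) ∧
      ENNReal.ofReal r * (∑ j, (K j).card : ℕ) ≤
        ∑ j, ∫⁻ t in O j ∩ {t | f j t < r}, v j t := by
  choose G hGm hGc hGi using fun j => exists_indicatrix (hO j) (hO1 j) (hd j)
  have hfinG : ∀ j, ∀ᵐ s ∂(volume.restrict (Ioo 0 ε)), G j s < ⊤ := by
    intro j
    refine ae_lt_top (hGm j) (ne_of_lt ?_)
    refine lt_of_le_of_lt ((lintegral_mono_set Ioo_subset_Iio_self).trans (hGi j ε)) ?_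
    exact (lintegral_mono_set inter_subset_left).trans_lt (hfin j)
  have hfinite : ∀ j s, G j s < ⊤ → {t | t ∈ O j ∧ f j t = s}.Finite := by
    intro j s hs
    by_contra hinf
    obtain ⟨n, hn⟩ := ENNReal.exists_nat_gt hs.ne
    obtain ⟨A, hA, hAn⟩ := Set.Infinite.exists_subset_card_eq hinf n
    have := hGc j s A fun t ht => hA ht
    rw [hAn] at this
    exact absurd this (not_le.2 hn)
  set good : Set ℝ := {s | s ∈ Ioo 0 ε ∧ s ∉ bad ∧ (∀ j, G j s < ⊤) ∧
    ∀ j, s ∉ f j '' {t ∈ O j | deriv (f j) t = 0}} with hgood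
  have hae : ∀ᵐ s ∂(volume.restrict (Ioo 0 ε)), s ∈ good := by
    have h1 : ∀ᵐ s ∂(volume.restrict (Ioo 0 ε)), s ∈ Ioo 0 ε := ae_restrict_mem measurableSet_Ioo
    have h2 : ∀ᵐ s ∂(volume.restrict (Ioo 0 ε)), s ∉ bad :=
      ae_restrict_of_ae (measure_eq_zero_iff_ae_notMem.1 hbad)
    have h3 : ∀ᵐ s ∂(volume.restrict (Ioo 0 ε)), ∀ j, G j s < ⊤ := ae_all_iff.2 hfinG
    have h4 : ∀ᵐ s ∂(volume.restrict (Ioo 0 ε)),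
        ∀ j, s ∉ f j '' {t ∈ O j | deriv (f j) t = 0} := ae_all_iff.2 fun j =>
      ae_restrict_of_ae (measure_eq_zero_iff_ae_notMem.1
        (volume_criticalValues fun t ht => (hd j t ht).1))
    filter_upwards [h1, h2, h3, h4] with s a b c d using ⟨a, b, c, d⟩
  let num : ℝ → ℕ := fun s => ∑ j, {t | t ∈ O j ∧ f j t = s}.ncard
  have hne : good.Nonempty := by
    by_contra hemp
    rw [not_nonempty_iff_eq_empty] at hemp
    rw [hemp] at hae
    have h0 : volume (Ioo 0 ε) = 0 := by
      have h1 := ae_iff.1 hae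
      simpa using h1
    rw [Real.volume_Ioo] at h0
    simp at h0
    linarith
  -- A good level with the least number of preimages. Almost all smaller levels are good and have at
  -- least as many, so `r · num r` is at most the integral of the count over `(0, r)`.
  obtain ⟨r, hr, hrmin⟩ : ∃ r ∈ good, ∀ s ∈ good, num r ≤ num s := by
    have hw := (wellFounded_lt (α := ℕ)).has_min (num '' good) (hne.image _)
    obtain ⟨_, ⟨r, hr, rfl⟩, hmin⟩ := hw
    exact ⟨r, hr, fun s hs => not_lt.1 (hmin _ ⟨s, hs, rfl⟩)⟩
  have hKfin := fun j => hfinite j r (hr.2.2.1 j)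
  refine ⟨r, hr.1, hr.2.1, fun j => (hKfin j).toFinset, fun j t => by simp, ?_, ?_⟩
  · intro j t ht hdt
    rw [Set.Finite.mem_toFinset] at ht
    exact hr.2.2.2 j ⟨t, ⟨ht.1, hdt⟩, ht.2⟩
  · have hnum : (∑ j, (hKfin j).toFinset.card : ℕ) = num r := by
      refine Finset.sum_congr rfl fun j _ => ?_
      rw [Set.ncard_eq_toFinset_card _ (hKfin j)]
    rw [hnum]
    have hsub : Ioo 0 r ⊆ Ioo 0 ε := Ioo_subset_Ioo_right hr.1.2.le
    have hae' : ∀ᵐ s ∂(volume.restrict (Ioo 0 r)), s ∈ good :=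
      ae_mono (Measure.restrict_mono hsub le_rfl) hae
    calc ENNReal.ofReal r * (num r : ℝ≥0∞) = ∫⁻ s in Ioo 0 r, (num r : ℝ≥0∞) := by
          rw [setLIntegral_const, Real.volume_Ioo, sub_zero, mul_comm]
      _ ≤ ∫⁻ s in Ioo 0 r, ∑ j, G j s := by
          refine lintegral_mono_ae ?_
          filter_upwards [hae'] with s hs
          have h1 : (num r : ℝ≥0∞) ≤ num s := by exact_mod_cast hrmin s hs
          refine h1.trans ?_
          simp only [num]
          push_cast
          refine Finset.sum_le_sum fun j _ => ?_
          have hfs := hfinite j s (hs.2.2.1 j)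
          rw [Set.ncard_eq_toFinset_card _ hfs]
          exact hGc j s hfs.toFinset fun t ht => by simpa using ht
      _ = ∑ j, ∫⁻ s in Ioo 0 r, G j s := lintegral_finsetSum _ fun j _ => hGm j
      _ ≤ _ := Finset.sum_le_sum fun j _ =>
          (lintegral_mono_set Ioo_subset_Iio_self).trans (hGi j r)

end ConicalSurface
end

/-! ### Curves in a cone meet almost every circle finitely often and have area zero. -/

noncomputable section
namespace ConicalSurface

variable {M : Type*} [TopologicalSpace M]
  [ChartedSpace (EuclideanHalfSpace 2) M] [IsManifold (𝓡∂ 2) ∞ M]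
  [RiemannianBundle (fun x : M => TangentSpace (𝓡∂ 2) x)] {ι : Type*}

/-- The speed of a curve. -/
def speed [Nonempty M] (S : ConicalSurface M ι) (c : ℝ → S.Completion) (t : ℝ) : ℝ≥0∞ :=
  ‖mfderiv 𝓘(ℝ, ℝ) (𝓡∂ 2) (S.toReg ∘ c) t 1‖ₑ

lemma curveLength_eq [Nonempty M] (S : ConicalSurface M ι) (c : ℝ → S.Completion) :
    S.curveLength c = ∫⁻ t in Ioo 0 1, S.speed c t := by
  rw [curveLength, pathELength_eq_lintegral_mfderiv_Ioo]
  rfl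

lemma speed_congr [Nonempty M] (S : ConicalSurface M ι) {c c' : ℝ → S.Completion} {t : ℝ}
    (h : c =ᶠ[𝓝 t] c') : S.speed c t = S.speed c' t :=
  enorm_mfderiv_congr (by filter_upwards [h] with s hs; simp [hs])

/-- The parameters at which a curve is inside the `i`-th cone. -/
def coneTimes (S : ConicalSurface M ι) (i : ι) (c : ℝ → S.Completion) (F : Set ℝ) : Set ℝ :=
  {t | t ∈ Ioo (0 : ℝ) 1 \ F ∧ S.radius i (c t) ∈ Ioo (0 : ℝ) 1}

lemma continuousAt_toReg [Nonempty M] (S : ConicalSurface M ι) (x : M) :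
    ContinuousAt S.toReg (S.reg x) := by
  rw [ContinuousAt, ← S.map_reg_nhds, tendsto_map'_iff]
  exact tendsto_id

namespace PolarChart

variable {S : ConicalSurface M ι} {i : ι} {p : ℝ × ℝ → M} {H : ℝ × ℝ → ℝ} {α : ℝ}

lemma isOpen_coneTimes (h : PolarChart S i p H α) {c : ℝ → S.Completion} {F : Set ℝ}
    (hF : F.Finite) (hc : ContinuousOn c (Icc 0 1)) : IsOpen (S.coneTimes i c F) := by
  have h1 : ContinuousOn (fun t => S.radius i (c t)) (Ioo (0 : ℝ) 1 \ F) :=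
    h.continuous_radius.comp_continuousOn
      (hc.mono (sdiff_subset.trans Ioo_subset_Icc_self))
  exact h1.isOpen_inter_preimage (isOpen_Ioo.sdiff hF.isClosed) isOpen_Ioo

lemma countable_setOf_eq (h : PolarChart S i p H α) {s : ℝ} (hs : s ∈ Ioo (0 : ℝ) 1)
    {A : Set M} (hA : A.Countable) : {φ | p (s, φ) ∈ A}.Countable := by
  have : {φ | p (s, φ) ∈ A} = ⋃ x ∈ A, {φ | p (s, φ) = x} := by
    ext φ; simp
  rw [this]
  refine hA.biUnion fun x _ => ?_
  by_cases hx : ∃ φ₀, p (s, φ₀) = x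
  · obtain ⟨φ₀, rfl⟩ := hx
    refine (countable_range fun k : ℤ => φ₀ + k * α).mono fun φ hφ => ?_
    obtain ⟨-, k, hk⟩ := (h.eq_iff s hs s hs φ₀ φ).1 (Eq.symm hφ)
    exact ⟨k, hk.symm⟩
  · push Not at hx
    convert countable_empty
    ext φ
    simpa using hx φ

variable [Nonempty M]

/-- The curve meets almost every circle of the cone finitely often. -/
lemma ae_finite_times (h : PolarChart S i p H α) {c : ℝ → S.Completion}
    (hc : S.IsCurve c) :
    ∀ᵐ s ∂(volume : Measure ℝ), s ∈ Ioo (0 : ℝ) 1 →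
      {t | t ∈ Icc (0 : ℝ) 1 ∧ S.radius i (c t) = s}.Finite := by
  obtain ⟨F, hF, hFc⟩ := hc.piecewise_contMDiff
  obtain ⟨G, hGm, hGc, hGi⟩ := exists_indicatrix (f := fun t => S.radius i (c t))
    (v := S.speed c) (O := S.coneTimes i c F) (h.isOpen_coneTimes hF hc.continuousOn).measurableSet
    (fun t ht => Ioo_subset_Ico_self ht.1.1)
    (fun t ht => h.hasDerivAt_radius_curve hF hFc ht.1 ht.2)
  have h1 : ∀ᵐ s ∂(volume.restrict (Iio (1 : ℝ))), G s < ⊤ := by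
    refine ae_lt_top hGm (ne_of_lt ((hGi 1).trans_lt ?_))
    refine (lintegral_mono_set (inter_subset_left.trans ?_)).trans_lt
      ((S.curveLength_eq c).symm.trans_lt hc.length_lt_top)
    exact fun t ht => ht.1.1
  have h2 := (ae_restrict_iff' measurableSet_Iio).1 h1
  filter_upwards [h2] with s hs hs01
  have hfin : {t | t ∈ S.coneTimes i c F ∧ S.radius i (c t) = s}.Finite := by
    by_contra hinf
    obtain ⟨n, hn⟩ := ENNReal.exists_nat_gt (hs hs01.2).ne
    obtain ⟨A, hA, hAn⟩ := Set.Infinite.exists_subset_card_eq hinf n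
    have := hGc s A fun t ht => hA ht
    rw [hAn] at this
    exact absurd this (not_le.2 hn)
  refine ((hfin.union hF).union (Set.toFinite {(0 : ℝ), 1})).subset ?_
  rintro t ⟨ht, hts⟩
  by_cases h0 : t = 0
  · right; simp [h0]
  by_cases h1 : t = 1
  · right; simp [h1]
  left
  by_cases hFt : t ∈ F
  · exact Or.inr hFt
  · exact Or.inl ⟨⟨⟨⟨lt_of_le_of_ne ht.1 (Ne.symm h0), lt_of_le_of_ne ht.2 h1⟩, hFt⟩,
      by rw [hts]; exact hs01⟩, hts⟩

variable [MeasurableSpace M] [BorelSpace M] [T2Space M]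

/-- The parameters at which the radius lies in `[1/(n+1), 1 - 1/(n+1)]` form a compact set with
compact, hence closed, image in `M`. These images exhaust the part of the trace in the cone. -/
lemma measurableSet_trace (h : PolarChart S i p H α) {c : ℝ → S.Completion}
    (hc : ContinuousOn c (Icc 0 1)) :
    MeasurableSet ({x | S.reg x ∈ c '' Icc 0 1} ∩ p '' strip) := by
  have hf : ContinuousOn (fun t => S.radius i (c t)) (Icc 0 1) :=
    h.continuous_radius.comp_continuousOn hc
  let T : ℕ → Set ℝ := fun n =>
    Icc 0 1 ∩ (fun t => S.radius i (c t)) ⁻¹' (Icc (1 / (n + 1)) (1 - 1 / (n + 1)))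
  have hTc : ∀ n, IsCompact (T n) := fun n =>
    isCompact_Icc.of_isClosed_subset (hf.preimage_isClosed_of_isClosed isClosed_Icc isClosed_Icc)
      inter_subset_left
  have hTr : ∀ n, ∀ t ∈ T n, ∃ y ∈ strip, c t = S.reg (p y) := by
    intro n t ht
    have hn : (0 : ℝ) < 1 / (n + 1) := by positivity
    exact h.exists_of_radius_mem ⟨hn.trans_le ht.2.1, by linarith [ht.2.2]⟩
  have hcont : ∀ n, ContinuousOn (S.toReg ∘ c) (T n) := by
    intro n t ht
    obtain ⟨y, hy, hty⟩ := hTr n t ht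
    have h1 : ContinuousWithinAt c (T n) t := (hc t ht.1).mono inter_subset_left
    have h2 : ContinuousAt S.toReg (c t) := by rw [hty]; exact S.continuousAt_toReg _
    exact h2.comp_continuousWithinAt h1
  have hcl : ∀ n, MeasurableSet ((S.toReg ∘ c) '' T n) := fun n =>
    ((hTc n).image_of_continuousOn (hcont n)).isClosed.measurableSet
  convert MeasurableSet.iUnion hcl using 1
  ext x
  simp only [mem_inter_iff, mem_iUnion]
  constructor
  · rintro ⟨⟨t, ht, htx⟩, y, hy, rfl⟩
    have hr : S.radius i (c t) = y.1 := by rw [htx, h.radius_apply hy]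
    obtain ⟨n, hn⟩ := exists_nat_one_div_lt
      (lt_min (mem_strip.1 hy).1 (sub_pos.2 (mem_strip.1 hy).2))
    refine ⟨n, t, ⟨ht, ?_⟩, by rw [Function.comp_apply, htx, S.toReg_reg]⟩
    rw [mem_preimage, hr]
    have h1 := hn.le.trans (min_le_left _ _)
    have h2 := hn.le.trans (min_le_right _ _)
    exact ⟨h1, by linarith⟩
  · rintro ⟨n, t, ht, rfl⟩
    obtain ⟨y, hy, hty⟩ := hTr n t ht
    refine ⟨⟨t, ht.1, ?_⟩, y, hy, ?_⟩
    · rw [Function.comp_apply, hty, S.toReg_reg]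
    · rw [Function.comp_apply, hty, S.toReg_reg]

/-- The part of a curve inside a cone has no area. -/
lemma area_trace_eq_zero (h : PolarChart S i p H α) {c : ℝ → S.Completion} (hc : S.IsCurve c) :
    riemannianArea M ({x | S.reg x ∈ c '' Icc 0 1} ∩ p '' strip) = 0 := by
  have hX := h.measurableSet_trace hc.continuousOn
  rw [h.riemannianArea_eq 0 hX inter_subset_right]
  refine setLIntegral_measure_zero _ _ ?_
  have hE := h.measurableSet_preimage 0 hX
  -- By Fubini it suffices that almost every circle meets the trace in a countable set of angles.
  rw [Measure.volume_eq_prod, Measure.measure_prod_null hE]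
  filter_upwards [h.ae_finite_times hc] with s hs
  by_cases hs01 : s ∈ Ioo (0 : ℝ) 1
  · refine Set.Countable.measure_zero (μ := volume) ?_
    have hA : ((fun t => S.toReg (c t)) '' {t | t ∈ Icc (0 : ℝ) 1 ∧ S.radius i (c t) = s}).Countable :=
      ((hs hs01).image _).countable
    refine (h.countable_setOf_eq hs01 hA).mono ?_
    rintro φ ⟨-, ⟨⟨t, ht, hct⟩, -⟩⟩
    refine ⟨t, ⟨ht, ?_⟩, ?_⟩
    · rw [hct, h.radius_apply (y := (s, φ)) (mem_strip.2 hs01)]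
    · simp only [hct, S.toReg_reg]
  · have : Prod.mk s ⁻¹' (window 0 α ∩ p ⁻¹' ({x | S.reg x ∈ c '' Icc 0 1} ∩ p '' strip)) = ∅ := by
      ext φ
      simp only [mem_preimage, mem_empty_iff_false, iff_false]
      intro hφ
      exact hs01 hφ.1.1
    rw [this]
    simp

end PolarChart
end ConicalSurface
end

/-! ### Projection of the half disc from an interior point of its diameter to the circle. -/

noncomputable section
namespace ConicalSurface

/-- The cosine of the angle at which the ray from `δ` in the direction of `x = cos ξ` leaves the
unit disc. -/
def exitCos (δ x : ℝ) : ℝ := δ + x * (-(δ * x) + Real.sqrt (1 - δ ^ 2 + δ ^ 2 * x ^ 2))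

/-- The angle at which the ray from `(δ, 0)` through `(a, b)` leaves the unit disc. -/
def exitAngle (δ a b : ℝ) : ℝ :=
  Real.arccos (exitCos δ ((a - δ) / Real.sqrt ((a - δ) ^ 2 + b ^ 2)))

lemma continuous_exitCos (δ : ℝ) : Continuous (exitCos δ) := by
  unfold exitCos; fun_prop

lemma exitAngle_nonneg (δ a b : ℝ) : 0 ≤ exitAngle δ a b := Real.arccos_nonneg _

lemma exitAngle_le_pi (δ a b : ℝ) : exitAngle δ a b ≤ Real.pi := Real.arccos_le_pi _

lemma sq_add_sq_pos {a b δ : ℝ} (h : a ≠ δ ∨ b ≠ 0) : 0 < (a - δ) ^ 2 + b ^ 2 := by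
  rcases h with h | h
  · have := sub_ne_zero.2 h; positivity
  · positivity

lemma continuousAt_exitAngle {δ : ℝ} {q : ℝ × ℝ} (h : q.1 ≠ δ ∨ q.2 ≠ 0) :
    ContinuousAt (fun q : ℝ × ℝ => exitAngle δ q.1 q.2) q := by
  have hpos := sq_add_sq_pos h
  have h1 : ContinuousAt (fun q : ℝ × ℝ => (q.1 - δ) / Real.sqrt ((q.1 - δ) ^ 2 + q.2 ^ 2)) q := by
    refine ContinuousAt.div (by fun_prop) (by fun_prop) (Real.sqrt_pos.2 hpos).ne'
  exact (Real.continuous_arccos.comp (continuous_exitCos δ)).continuousAt.comp h1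

/-- Points of the segment from `e^{iβ}` to `δ` have exit angle `β`. -/
lemma exitAngle_segment {δ β u : ℝ} (hδ : δ ∈ Ioo (0 : ℝ) 1) (hβ : β ∈ Icc 0 Real.pi) (hu : u < 1) :
    exitAngle δ ((1 - u) * Real.cos β + u * δ) ((1 - u) * Real.sin β) = β := by
  set c := Real.cos β with hc
  set s := Real.sin β with hs
  have hcs : s ^ 2 + c ^ 2 = 1 := Real.sin_sq_add_cos_sq β
  have hc1 : c ≤ 1 := Real.cos_le_one β
  have hu' : 0 < 1 - u := sub_pos.2 hu
  have hn2 : 0 < 1 - 2 * δ * c + δ ^ 2 := by nlinarith [hδ.1, hδ.2]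
  -- The distance from `e^{iβ}` to `δ`, by the law of cosines.
  set n := Real.sqrt (1 - 2 * δ * c + δ ^ 2) with hn
  have hnpos : 0 < n := Real.sqrt_pos.2 hn2
  have hnsq : n ^ 2 = 1 - 2 * δ * c + δ ^ 2 := Real.sq_sqrt hn2.le
  have h1 : Real.sqrt (((1 - u) * c + u * δ - δ) ^ 2 + ((1 - u) * s) ^ 2) = (1 - u) * n := by
    rw [Real.sqrt_eq_iff_mul_self_eq (by positivity) (by positivity)]
    linear_combination (1 - u) ^ 2 * hcs - (1 - u) ^ 2 * hnsq
  have h2 : ((1 - u) * c + u * δ - δ) / Real.sqrt (((1 - u) * c + u * δ - δ) ^ 2 +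
      ((1 - u) * s) ^ 2) = (c - δ) / n := by
    rw [h1]
    have : (1 - u) * c + u * δ - δ = (1 - u) * (c - δ) := by ring
    rw [this, mul_div_mul_left _ _ hu'.ne']
  have hdc : 0 ≤ 1 - δ * c := by nlinarith [hδ.1, hδ.2]
  have h3 : Real.sqrt (1 - δ ^ 2 + δ ^ 2 * ((c - δ) / n) ^ 2) = (1 - δ * c) / n := by
    have e : 1 - δ ^ 2 + δ ^ 2 * ((c - δ) / n) ^ 2 = ((1 - δ * c) / n) ^ 2 := by
      field_simp
      rw [hnsq]; ring
    rw [e, Real.sqrt_sq (div_nonneg hdc hnpos.le)]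
  have h4 : exitCos δ ((c - δ) / n) = c := by
    unfold exitCos
    rw [h3]
    field_simp
    rw [hnsq]; ring
  rw [exitAngle, h2, h4]
  exact Real.arccos_cos hβ.1 hβ.2

/-- A point of the upper half disc lies on the segment from `δ` to its exit point. -/
lemma exists_segment {δ a b : ℝ} (hδ : δ ∈ Ioo (0 : ℝ) 1) (hb : 0 ≤ b) (hab : a ^ 2 + b ^ 2 ≤ 1)
    (hne : a ≠ δ ∨ b ≠ 0) :
    ∃ u ∈ Ico (0 : ℝ) 1, a = (1 - u) * Real.cos (exitAngle δ a b) + u * δ ∧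
      b = (1 - u) * Real.sin (exitAngle δ a b) := by
  have hpos := sq_add_sq_pos hne
  set m := Real.sqrt ((a - δ) ^ 2 + b ^ 2) with hm
  have hmpos : 0 < m := Real.sqrt_pos.2 hpos
  have hmsq : m ^ 2 = (a - δ) ^ 2 + b ^ 2 := Real.sq_sqrt hpos.le
  set x := (a - δ) / m with hx
  set y := b / m with hy
  have hax : a = δ + m * x := by rw [hx]; field_simp; ring
  have hby : b = m * y := by rw [hy]; field_simp
  have hy0 : 0 ≤ y := div_nonneg hb hmpos.le
  have hxy : x ^ 2 + y ^ 2 = 1 := by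
    rw [hx, hy, div_pow, div_pow, ← add_div, ← hmsq, div_self (by positivity)]
  set R := Real.sqrt (1 - δ ^ 2 + δ ^ 2 * x ^ 2) with hR
  have hRin : 0 < 1 - δ ^ 2 + δ ^ 2 * x ^ 2 := by nlinarith [hδ.1, hδ.2, sq_nonneg (δ * x)]
  have hRsq : R ^ 2 = 1 - δ ^ 2 + δ ^ 2 * x ^ 2 := Real.sq_sqrt hRin.le
  have hR0 : 0 < R := Real.sqrt_pos.2 hRin
  have hRx : |δ * x| < R := by
    refine abs_lt_of_sq_lt_sq ?_ hR0.le
    rw [hRsq]; nlinarith [hδ.1, hδ.2]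
  have hRx' := abs_lt.1 hRx
  -- The distance from `δ` to the circle in the direction `(x, y)`, that is the positive root of `τ²
  -- + 2δxτ + δ² = 1`.
  set τ := -(δ * x) + R with hτ
  have hτ0 : 0 < τ := by linarith
  have hτsq : δ ^ 2 + 2 * δ * τ * x + τ ^ 2 = 1 := by
    rw [hτ]; nlinarith
  -- A point on the ray beyond the exit point would be outside the disc.
  have hmτ : m ≤ τ := by
    by_contra hcon
    push Not at hcon
    have h1 : δ ^ 2 + 2 * δ * m * x + m ^ 2 ≤ 1 := by
      have : a ^ 2 + b ^ 2 = δ ^ 2 + 2 * δ * m * x + m ^ 2 * (x ^ 2 + y ^ 2) := by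
        rw [hax, hby]; ring
      rw [hxy] at this; linarith
    have h2 : 0 < (m - τ) * (m + τ + 2 * δ * x) :=
      mul_pos (by linarith) (by linarith)
    nlinarith
  have hex : exitCos δ x = δ + τ * x := by rw [exitCos, hτ]; ring
  have hone : (δ + τ * x) ^ 2 + (τ * y) ^ 2 = 1 := by
    have : (δ + τ * x) ^ 2 + (τ * y) ^ 2 = δ ^ 2 + 2 * δ * τ * x + τ ^ 2 * (x ^ 2 + y ^ 2) := by
      ring
    rw [this, hxy, mul_one, hτsq]
  have hcos : Real.cos (exitAngle δ a b) = δ + τ * x := by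
    rw [exitAngle, ← hm, ← hx, hex, Real.cos_arccos]
    · nlinarith [sq_nonneg (τ * y)]
    · nlinarith [sq_nonneg (τ * y)]
  have hsin : Real.sin (exitAngle δ a b) = τ * y := by
    rw [exitAngle, ← hm, ← hx, hex, Real.sin_arccos]
    have : 1 - (δ + τ * x) ^ 2 = (τ * y) ^ 2 := by linarith
    rw [this, Real.sqrt_sq (by positivity)]
  refine ⟨1 - m / τ, ⟨?_, ?_⟩, ?_, ?_⟩
  · rw [sub_nonneg, div_le_one hτ0]; exact hmτ
  · have := div_pos hmpos hτ0; linarith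
  · rw [hcos, hax]; field_simp; ring
  · rw [hsin, hby]; field_simp; ring

/-- The exit angle of a point is at least its polar angle. -/
lemma le_exitAngle {δ ρ d : ℝ} (hδ : δ ∈ Ioo (0 : ℝ) 1) (hρ : ρ ∈ Ioc (0 : ℝ) 1)
    (hd : d ∈ Ico 0 Real.pi) (hne : ρ * Real.cos d ≠ δ ∨ ρ * Real.sin d ≠ 0) :
    d ≤ exitAngle δ (ρ * Real.cos d) (ρ * Real.sin d) := by
  have hsind := Real.sin_nonneg_of_nonneg_of_le_pi hd.1 hd.2.le
  have hρ0 := hρ.1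
  obtain ⟨u, hu, h1, h2⟩ := exists_segment hδ (b := ρ * Real.sin d) (a := ρ * Real.cos d)
    (by positivity) (by
      have : (ρ * Real.cos d) ^ 2 + (ρ * Real.sin d) ^ 2 = ρ ^ 2 := by
        have := Real.sin_sq_add_cos_sq d
        linear_combination ρ ^ 2 * this
      rw [this]; nlinarith [hρ.2]) hne
  set β := exitAngle δ (ρ * Real.cos d) (ρ * Real.sin d) with hβ
  by_contra hcon
  push Not at hcon
  have hβ0 : 0 ≤ β := exitAngle_nonneg _ _ _
  have hβπ : β ≤ Real.pi := exitAngle_le_pi _ _ _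
  -- Cross product of the point with `e^{iβ}`: only the component `u δ` along the axis contributes,
  -- and it gives a nonnegative value. If `β < d`, the left side would be negative.
  have h3 : ρ * Real.sin (β - d) = u * δ * Real.sin β := by
    rw [Real.sin_sub]
    linear_combination Real.sin β * h1 - Real.cos β * h2
  have h4 : 0 ≤ ρ * Real.sin (β - d) := by
    rw [h3]
    have := Real.sin_nonneg_of_nonneg_of_le_pi hβ0 hβπ
    have := hu.1
    have := hδ.1
    positivity
  have h5 : Real.sin (β - d) < 0 :=
    Real.sin_neg_of_neg_of_neg_pi_lt (by linarith) (by linarith [hd.2])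
  nlinarith

lemma exitAngle_of_lt {δ a : ℝ} (ha : δ < a) :
    exitAngle δ a 0 = 0 := by
  have h0 : 0 < a - δ := sub_pos.2 ha
  have : (a - δ) / Real.sqrt ((a - δ) ^ 2 + 0 ^ 2) = 1 := by
    rw [zero_pow two_ne_zero, add_zero, Real.sqrt_sq h0.le, div_self h0.ne']
  rw [exitAngle, this, exitCos]
  norm_num

lemma exitAngle_of_gt {δ a : ℝ} (ha : a < δ) :
    exitAngle δ a 0 = Real.pi := by
  have h0 : 0 < δ - a := sub_pos.2 ha
  have : (a - δ) / Real.sqrt ((a - δ) ^ 2 + 0 ^ 2) = -1 := by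
    have : (a - δ) ^ 2 + 0 ^ 2 = (δ - a) ^ 2 := by ring
    rw [this, Real.sqrt_sq h0.le, ← neg_sub, neg_div, div_self h0.ne']
  rw [exitAngle, this, exitCos]
  norm_num

lemma exitAngle_of_unit {δ d : ℝ} (hδ : δ ∈ Ioo (0 : ℝ) 1) (hd : d ∈ Icc 0 Real.pi) :
    exitAngle δ (Real.cos d) (Real.sin d) = d := by
  simpa using exitAngle_segment hδ hd (u := 0) one_pos

/-- Near the centre of the disc, the exit angle is near `π`. -/
lemma exists_lt_exitAngle {δ A : ℝ} (hδ : δ ∈ Ioo (0 : ℝ) 1) (hA : A < Real.pi) :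
    ∃ ρ₀ > 0, ∀ a b : ℝ, |a| < ρ₀ → |b| < ρ₀ → A < exitAngle δ a b := by
  have h1 := continuousAt_exitAngle (δ := δ) (q := (0, 0)) (Or.inl hδ.1.ne)
  have h2 : ∀ᶠ q : ℝ × ℝ in 𝓝 (0, 0), A < exitAngle δ q.1 q.2 := by
    refine h1.eventually (lt_mem_nhds ?_)
    simp only
    rwa [exitAngle_of_gt hδ.1]
  obtain ⟨ρ₀, hρ, h⟩ := Metric.eventually_nhds_iff.1 h2
  refine ⟨ρ₀, hρ, fun a b ha hb => h (y := (a, b)) ?_⟩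
  rw [Prod.dist_eq]
  simp [ha, hb]

end ConicalSurface
end

/-! ### Folding the cone along an axis, the truncated exit angle, and the arms of a star. -/

noncomputable section
namespace ConicalSurface

/-- The distance of `φ` to `αℤ`. -/
def circDist (α φ : ℝ) : ℝ := ‖(φ : AddCircle α)‖

/-- The side of `αℤ` on which `φ` lies. -/
def circSign (α φ : ℝ) : ℝ := if 0 ≤ Real.sin (2 * Real.pi * φ / α) then 1 else -1

lemma continuous_circDist (α : ℝ) : Continuous (circDist α) :=
  continuous_norm.comp (AddCircle.continuous_mk' α)

lemma circDist_nonneg (α φ : ℝ) : 0 ≤ circDist α φ := norm_nonneg _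

lemma circDist_add_int_mul (α φ : ℝ) (k : ℤ) : circDist α (φ + k * α) = circDist α φ := by
  unfold circDist
  congr 1
  rw [← zsmul_eq_mul]
  simp

lemma circDist_of_abs_le {α ψ : ℝ} (hα : 0 < α) (h : |ψ| ≤ α / 2) : circDist α ψ = |ψ| := by
  unfold circDist
  rw [AddCircle.norm_coe_eq_abs_iff α hα.ne', abs_of_pos hα]
  exact h

lemma circDist_le {α : ℝ} (hα : 0 < α) (φ : ℝ) : circDist α φ ≤ α / 2 := by
  have := AddCircle.norm_le_half_period α (x := (φ : AddCircle α)) hα.ne'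
  rwa [abs_of_pos hα] at this

lemma exists_circ_rep {α : ℝ} (hα : 0 < α) (φ : ℝ) :
    ∃ (ψ : ℝ) (k : ℤ), φ = ψ + k * α ∧ |ψ| ≤ α / 2 := by
  refine ⟨φ - round (α⁻¹ * φ) * α, round (α⁻¹ * φ), by ring, ?_⟩
  have h1 := AddCircle.norm_eq (p := α) (x := φ)
  rw [← h1]
  exact circDist_le hα φ

lemma circSign_add_int_mul {α : ℝ} (hα : 0 < α) (φ : ℝ) (k : ℤ) :
    circSign α (φ + k * α) = circSign α φ := by
  unfold circSign
  have : 2 * Real.pi * (φ + k * α) / α = 2 * Real.pi * φ / α + k * (2 * Real.pi) := by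
    field_simp
  rw [this, Real.sin_add_int_mul_two_pi]

lemma circSign_of_nonneg {α ψ : ℝ} (hα : 0 < α) (h0 : 0 ≤ ψ) (h : ψ ≤ α / 2) :
    circSign α ψ = 1 := by
  refine if_pos (Real.sin_nonneg_of_nonneg_of_le_pi (by positivity) ?_)
  rw [div_le_iff₀ hα]
  nlinarith [Real.pi_pos]

lemma circSign_of_neg {α ψ : ℝ} (hα : 0 < α) (h0 : ψ < 0) (h : -(α / 2) < ψ) :
    circSign α ψ = -1 := by
  refine if_neg (not_le.2 (Real.sin_neg_of_neg_of_neg_pi_lt ?_ ?_))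
  · refine div_neg_of_neg_of_pos ?_ hα
    nlinarith [Real.pi_pos]
  · rw [lt_div_iff₀ hα]
    nlinarith [Real.pi_pos]

lemma circSign_eq (α φ : ℝ) : circSign α φ = 1 ∨ circSign α φ = -1 := by
  unfold circSign; split_ifs <;> simp

lemma exists_eq_sign_mul_dist {α : ℝ} (hα : 0 < α) (φ : ℝ) :
    ∃ k : ℤ, φ = circSign α φ * circDist α φ + k * α := by
  obtain ⟨ψ, k, rfl, hψ⟩ := exists_circ_rep hα φ
  rw [circSign_add_int_mul hα, circDist_add_int_mul, circDist_of_abs_le hα hψ]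
  have h2 := abs_le.1 hψ
  rcases le_or_gt 0 ψ with h0 | h0
  · exact ⟨k, by rw [circSign_of_nonneg hα h0 h2.2, abs_of_nonneg h0]; ring⟩
  -- `ψ = -α/2` is congruent to `α/2`, where the sign is `1`, so the multiple of `α` shifts by one.
  rcases h2.1.eq_or_lt with h3 | h3
  · refine ⟨k - 1, ?_⟩
    have hs : circSign α ψ = 1 := by
      rw [← circSign_add_int_mul hα ψ 1]
      exact circSign_of_nonneg hα (by push_cast; linarith) (by push_cast; linarith)
    rw [hs, abs_of_neg h0]; push_cast; linarith
  · exact ⟨k, by rw [circSign_of_neg hα h0 h3, abs_of_neg h0]; ring⟩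

/-- If `sin (2πφ/α) = 0` then `φ` is a multiple of `α / 2`. -/
lemma circDist_of_sin_eq_zero {α φ : ℝ} (hα : 0 < α)
    (h : Real.sin (2 * Real.pi * φ / α) = 0) : circDist α φ = 0 ∨ circDist α φ = α / 2 := by
  obtain ⟨n, hn⟩ := Real.sin_eq_zero_iff.1 h
  have hφ : φ = n * (α / 2) := by
    have hpi := Real.pi_pos.ne'
    field_simp at hn
    linarith
  rcases Int.even_or_odd' n with ⟨k, rfl | rfl⟩
  · left
    have : φ = 0 + k * α := by rw [hφ]; push_cast; ring
    rw [this, circDist_add_int_mul, circDist_of_abs_le hα (by simp; positivity), abs_zero]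
  · right
    have : φ = α / 2 + k * α := by rw [hφ]; push_cast; ring
    rw [this, circDist_add_int_mul, circDist_of_abs_le hα (by rw [abs_of_pos (by positivity)]),
      abs_of_pos (by positivity)]

/-- The truncated exit angle of the point with polar coordinates `(ρ, φ)`. -/
def starAngle (α δ ρ φ : ℝ) : ℝ :=
  min (α / 2) (exitAngle δ (ρ * Real.cos (circDist α φ)) (ρ * Real.sin (circDist α φ)))

/-- The vertex of the star. -/
def IsVertex (α δ ρ φ : ℝ) : Prop :=
  ρ * Real.cos (circDist α φ) = δ ∧ ρ * Real.sin (circDist α φ) = 0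

section star

variable {α δ : ℝ}

lemma starAngle_nonneg (hα : 0 < α) (ρ φ : ℝ) : 0 ≤ starAngle α δ ρ φ :=
  le_min (by positivity) (exitAngle_nonneg _ _ _)

lemma starAngle_le (ρ φ : ℝ) : starAngle α δ ρ φ ≤ α / 2 := min_le_left _ _

lemma ne_of_not_isVertex {ρ φ : ℝ} (h : ¬ IsVertex α δ ρ φ) :
    ρ * Real.cos (circDist α φ) ≠ δ ∨ ρ * Real.sin (circDist α φ) ≠ 0 := by
  by_contra hcon
  push Not at hcon
  exact h hcon

lemma circDist_lt_pi (hα : 0 < α) (hα2 : α < 2 * Real.pi) (φ : ℝ) : circDist α φ < Real.pi :=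
  (circDist_le hα φ).trans_lt (by linarith)

lemma circDist_mem (hα : 0 < α) (hα2 : α < 2 * Real.pi) (φ : ℝ) :
    circDist α φ ∈ Ico 0 Real.pi := ⟨circDist_nonneg _ _, circDist_lt_pi hα hα2 φ⟩

lemma isVertex_iff (hα : 0 < α) (hα2 : α < 2 * Real.pi) {ρ φ : ℝ} (hρ : 0 < ρ) :
    IsVertex α δ ρ φ ↔ ρ = δ ∧ circDist α φ = 0 := by
  constructor
  · rintro ⟨h1, h2⟩
    have h3 : Real.sin (circDist α φ) = 0 := by simpa [hρ.ne'] using h2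
    have h4 : circDist α φ = 0 := by
      have hm := circDist_mem hα hα2 φ
      by_contra hne
      exact (Real.sin_pos_of_pos_of_lt_pi (lt_of_le_of_ne hm.1 (Ne.symm hne)) hm.2).ne' h3
    rw [h4] at h1
    exact ⟨by simpa using h1, h4⟩
  · rintro ⟨rfl, h⟩
    simp [IsVertex, h]

lemma continuousAt_starAngle {y : ℝ × ℝ} {r : ℝ} (h : ¬ IsVertex α δ (y.1 / r) y.2) :
    ContinuousAt (fun y : ℝ × ℝ => starAngle α δ (y.1 / r) y.2) y := by
  have h1 : ContinuousAt (fun y : ℝ × ℝ => ((y.1 / r) * Real.cos (circDist α y.2),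
      (y.1 / r) * Real.sin (circDist α y.2))) y := by
    have := continuous_circDist α
    fun_prop
  have h2 := ContinuousAt.comp (f := fun y : ℝ × ℝ => ((y.1 / r) * Real.cos (circDist α y.2),
      (y.1 / r) * Real.sin (circDist α y.2))) (x := y)
      (continuousAt_exitAngle (δ := δ) (ne_of_not_isVertex h)) h1
  exact continuousAt_const.min h2

/-- On the ray opposite to the vertex this forces the truncated angle to be exactly `α/2`, so that
the retractions of the two halves of the cone agree there. -/
lemma circDist_le_starAngle (hα : 0 < α) (hα2 : α < 2 * Real.pi) (hδ : δ ∈ Ioo (0 : ℝ) 1)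
    {ρ φ : ℝ} (hρ : ρ ∈ Ioc (0 : ℝ) 1) (h : ¬ IsVertex α δ ρ φ) :
    circDist α φ ≤ starAngle α δ ρ φ :=
  le_min (circDist_le hα φ) (le_exitAngle hδ hρ (circDist_mem hα hα2 φ) (ne_of_not_isVertex h))

/-- The projection fixes the points of the circle, which lets it be glued to the identity outside.
-/
lemma starAngle_one (hα : 0 < α) (hα2 : α < 2 * Real.pi) (hδ : δ ∈ Ioo (0 : ℝ) 1) (φ : ℝ) :
    starAngle α δ 1 φ = circDist α φ := by
  rw [starAngle, one_mul, one_mul, exitAngle_of_unit hδ (Ico_subset_Icc_self (circDist_mem hα hα2 φ)),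
    min_eq_right (circDist_le hα φ)]

end star

section arm

/-- The segment from `e^{ib}` to `δ`. -/
def armVec (δ b u : ℝ) : ℂ := (1 - u) * Complex.exp (b * Complex.I) + u * δ

/-- The segment from `(r, φ)` to `(δ r, 0)` in polar coordinates. -/
def armCoord (α δ r φ u : ℝ) : ℝ × ℝ :=
  (r * ‖armVec δ (circDist α φ) u‖, circSign α φ * (armVec δ (circDist α φ) u).arg)

variable {α δ : ℝ}

lemma armVec_re (δ b u : ℝ) : (armVec δ b u).re = (1 - u) * Real.cos b + u * δ := by
  simp [armVec, Complex.exp_ofReal_mul_I_re, Complex.exp_ofReal_mul_I_im]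

lemma armVec_im (δ b u : ℝ) : (armVec δ b u).im = (1 - u) * Real.sin b := by
  simp [armVec, Complex.exp_ofReal_mul_I_re, Complex.exp_ofReal_mul_I_im]

/-- Since `b < π` and `δ > 0`, the segment avoids the closed negative real axis. Thus modulus and
argument are smooth along it, and the segment stays away from the tip. -/
lemma armVec_mem_slitPlane (hδ : 0 < δ) {b : ℝ} (hb : b ∈ Ico 0 Real.pi) {u : ℝ}
    (hu : u ∈ Icc (0 : ℝ) 1) : armVec δ b u ∈ Complex.slitPlane := by
  rw [Complex.mem_slitPlane_iff, armVec_re, armVec_im]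
  rcases hb.1.eq_or_lt with rfl | hb0
  · left
    simp only [Real.cos_zero, mul_one]
    rcases hu.2.eq_or_lt with rfl | h1
    · simpa using hδ
    · nlinarith [hu.1]
  · rcases hu.2.eq_or_lt with rfl | h1
    · left; simpa using hδ
    · right
      have := Real.sin_pos_of_pos_of_lt_pi hb0 hb.2
      have : 0 < 1 - u := by linarith
      positivity

lemma norm_armVec_pos (hδ : 0 < δ) {b : ℝ} (hb : b ∈ Ico 0 Real.pi) {u : ℝ}
    (hu : u ∈ Icc (0 : ℝ) 1) : 0 < ‖armVec δ b u‖ :=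
  norm_pos_iff.2 (Complex.slitPlane_ne_zero (armVec_mem_slitPlane hδ hb hu))

lemma norm_armVec_le (hδ : δ ∈ Ioo (0 : ℝ) 1) {b u : ℝ} (hu : u ∈ Icc (0 : ℝ) 1) :
    ‖armVec δ b u‖ ≤ 1 - u + u * δ := by
  refine (norm_add_le _ _).trans ?_
  rw [norm_mul, norm_mul, Complex.norm_exp_ofReal_mul_I, mul_one]
  have h1 : ‖(1 - u : ℂ)‖ = 1 - u := by
    rw [← Complex.ofReal_one, ← Complex.ofReal_sub, Complex.norm_real, Real.norm_of_nonneg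
      (by linarith [hu.2])]
  rw [h1, Complex.norm_real, Complex.norm_real, Real.norm_of_nonneg hu.1,
    Real.norm_of_nonneg hδ.1.le]

lemma norm_armVec_lt_one (hδ : δ ∈ Ioo (0 : ℝ) 1) {b u : ℝ} (hu : u ∈ Ioc (0 : ℝ) 1) :
    ‖armVec δ b u‖ < 1 :=
  (norm_armVec_le hδ ⟨hu.1.le, hu.2⟩).trans_lt (by nlinarith [hδ.1, hδ.2, hu.1])

@[simp] lemma armVec_zero (δ b : ℝ) : armVec δ b 0 = Complex.exp (b * Complex.I) := by
  simp [armVec]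

@[simp] lemma armVec_one (δ b : ℝ) : armVec δ b 1 = δ := by
  simp [armVec]

lemma armCoord_one (hδ : 0 < δ) (r φ : ℝ) : armCoord α δ r φ 1 = (r * δ, 0) := by
  simp [armCoord, Complex.arg_ofReal_of_nonneg hδ.le, abs_of_pos hδ]

lemma armCoord_zero (hα : 0 < α) (hα2 : α < 2 * Real.pi) (r φ : ℝ) :
    armCoord α δ r φ 0 = (r, circSign α φ * circDist α φ) := by
  have hm := circDist_mem hα hα2 φ
  rw [armCoord, armVec_zero, Complex.norm_exp_ofReal_mul_I, mul_one, Complex.arg_exp_mul_I,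
    toIocMod_eq_self Real.two_pi_pos |>.2]
  constructor <;> linarith [hm.1, hm.2, Real.pi_pos]

lemma armCoord_mem_strip (hα : 0 < α) (hα2 : α < 2 * Real.pi) (hδ : δ ∈ Ioo (0 : ℝ) 1) {r : ℝ}
    (hr : r ∈ Ioo (0 : ℝ) 1) (φ : ℝ) {u : ℝ} (hu : u ∈ Icc (0 : ℝ) 1) :
    armCoord α δ r φ u ∈ strip := by
  rw [mem_strip]
  refine ⟨mul_pos hr.1 (norm_armVec_pos hδ.1 (circDist_mem hα hα2 φ) hu), ?_⟩
  have h1 := norm_armVec_le hδ (b := circDist α φ) hu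
  have h2 : ‖armVec δ (circDist α φ) u‖ ≤ 1 := by nlinarith [hu.1, hu.2, hδ.1, hδ.2]
  have : r * ‖armVec δ (circDist α φ) u‖ ≤ r * 1 := mul_le_mul_of_nonneg_left h2 hr.1.le
  change r * ‖armVec δ (circDist α φ) u‖ < 1
  linarith [hr.2]

lemma armCoord_fst_lt (hδ : δ ∈ Ioo (0 : ℝ) 1) {r : ℝ} (hr : 0 < r) (φ : ℝ) {u : ℝ}
    (hu : u ∈ Ioc (0 : ℝ) 1) : (armCoord α δ r φ u).1 < r := by
  have := norm_armVec_lt_one hδ (b := circDist α φ) hu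
  simp only [armCoord]
  nlinarith

lemma hasDerivAt_armVec (δ b u : ℝ) :
    HasDerivAt (armVec δ b) (δ - Complex.exp (b * Complex.I)) u := by
  have h1 : HasDerivAt (fun u : ℝ => (u : ℂ)) 1 u := Complex.ofRealCLM.hasDerivAt
  have h2 := (((hasDerivAt_const u (1 : ℂ)).sub h1).mul_const
    (Complex.exp (b * Complex.I))).add (h1.mul_const (δ : ℂ))
  refine h2.congr_deriv ?_
  ring

lemma norm_sub_exp (δ b : ℝ) :
    ‖(δ : ℂ) - Complex.exp (b * Complex.I)‖ = Real.sqrt (1 - 2 * δ * Real.cos b + δ ^ 2) := by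
  rw [Complex.norm_def, Complex.normSq_apply]
  congr 1
  simp only [Complex.sub_re, Complex.sub_im, Complex.ofReal_re, Complex.ofReal_im,
    Complex.exp_ofReal_mul_I_re, Complex.exp_ofReal_mul_I_im]
  nlinarith [Real.sin_sq_add_cos_sq b]

lemma contDiff_armVec (δ b : ℝ) : ContDiff ℝ 1 (armVec δ b) := by
  have h1 : ContDiff ℝ 1 (fun u : ℝ => (u : ℂ)) := Complex.ofRealCLM.contDiff
  unfold armVec
  fun_prop

/-- The velocity of an arm. -/
lemma exists_hasDerivAt_armCoord (hα : 0 < α) (hα2 : α < 2 * Real.pi) (hδ : δ ∈ Ioo (0 : ℝ) 1)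
    {r : ℝ} (φ : ℝ) {u : ℝ} (hu : u ∈ Icc (0 : ℝ) 1) :
    ContDiffAt ℝ 1 (armCoord α δ r φ) u ∧
    ∃ v : ℝ × ℝ, HasDerivAt (armCoord α δ r φ) v u ∧
      v.1 ^ 2 + (armCoord α δ r φ u).1 ^ 2 * v.2 ^ 2 =
        r ^ 2 * (1 - 2 * δ * Real.cos (circDist α φ) + δ ^ 2) := by
  set b := circDist α φ with hb
  set w := armVec δ b with hw
  have hbm : b ∈ Ico 0 Real.pi := circDist_mem hα hα2 φ
  have hslit : w u ∈ Complex.slitPlane := armVec_mem_slitPlane hδ.1 hbm hu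
  have hwd := hasDerivAt_armVec δ b u
  have hlog : HasDerivAt (fun u => Complex.log (w u))
      ((δ - Complex.exp (b * Complex.I)) / w u) u := hwd.clog_real hslit
  have hlogC : ContDiffAt ℝ 1 (fun u => Complex.log (w u)) u := by
    have h1 : ContDiffAt ℝ 1 Complex.log (w u) :=
      (Complex.contDiffAt_log hslit).restrict_scalars ℝ
    exact h1.comp u (contDiff_armVec δ b).contDiffAt
  have hwcont : ContinuousAt w u := hwd.continuousAt
  -- Polar coordinates are the real and imaginary parts of the complex logarithm, so they can be
  -- differentiated by one formula.
  have hev : armCoord α δ r φ =ᶠ[𝓝 u] fun u => (r * Real.exp (Complex.log (w u)).re,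
      circSign α φ * (Complex.log (w u)).im) := by
    filter_upwards [hwcont.eventually (Complex.isOpen_slitPlane.mem_nhds hslit)] with u' hu'
    rw [Complex.log_re, Complex.log_im, Real.exp_log (norm_pos_iff.2 (Complex.slitPlane_ne_zero hu'))]
    rfl
  have hre : ContDiffAt ℝ 1 (fun u => (Complex.log (w u)).re) u :=
    Complex.reCLM.contDiff.contDiffAt.comp u hlogC
  have him : ContDiffAt ℝ 1 (fun u => (Complex.log (w u)).im) u :=
    Complex.imCLM.contDiff.contDiffAt.comp u hlogC
  refine ⟨ContDiffAt.congr_of_eventuallyEq ?_ hev, ?_⟩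
  · exact (contDiffAt_const.mul (Real.contDiff_exp.contDiffAt.comp u hre)).prodMk
      (contDiffAt_const.mul him)
  set L := (δ - Complex.exp (b * Complex.I)) / w u with hL
  have hred : HasDerivAt (fun u => (Complex.log (w u)).re) L.re u :=
    Complex.reCLM.hasFDerivAt.comp_hasDerivAt u hlog
  have himd : HasDerivAt (fun u => (Complex.log (w u)).im) L.im u :=
    Complex.imCLM.hasFDerivAt.comp_hasDerivAt u hlog
  have hnpos : 0 < ‖w u‖ := norm_pos_iff.2 (Complex.slitPlane_ne_zero hslit)
  have hexp : Real.exp (Complex.log (w u)).re = ‖w u‖ := by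
    rw [Complex.log_re, Real.exp_log hnpos]
  refine ⟨_, (((hred.exp.const_mul r).prodMk (himd.const_mul (circSign α φ))).congr_of_eventuallyEq
    hev), ?_⟩
  simp only [hexp]
  have h1 : (armCoord α δ r φ u).1 = r * ‖w u‖ := rfl
  have hs2 : circSign α φ ^ 2 = 1 := by
    rcases circSign_eq α φ with h | h <;> rw [h] <;> norm_num
  -- `L` is the logarithmic derivative of `w`, hence `‖w‖ ‖L‖` is the constant speed of the segment,
  -- its length.
  have hLn : ‖w u‖ ^ 2 * (L.re ^ 2 + L.im ^ 2) = 1 - 2 * δ * Real.cos b + δ ^ 2 := by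
    have h2 : L.re ^ 2 + L.im ^ 2 = ‖L‖ ^ 2 := by
      rw [← Complex.normSq_eq_norm_sq, Complex.normSq_apply]; ring
    rw [h2, ← mul_pow, hL, norm_div, mul_div_cancel₀ _ hnpos.ne', norm_sub_exp,
      Real.sq_sqrt]
    nlinarith [Real.cos_le_one b, hδ.1, sq_nonneg (1 - δ)]
  rw [h1]
  calc _ = r ^ 2 * (‖w u‖ ^ 2 * (L.re ^ 2 + circSign α φ ^ 2 * L.im ^ 2)) := by ring
    _ = _ := by rw [hs2, one_mul, hLn]

end arm

end ConicalSurface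
end

/-! ### The retraction in polar coordinates: continuity and fibres. -/

noncomputable section
namespace ConicalSurface

lemma continuousAt_ite {X Y : Type*} [TopologicalSpace X] [TopologicalSpace Y] {C : X → Prop}
    [DecidablePred C] {f g : X → Y} {x : X} (hf : ContinuousAt f x) (hg : ContinuousAt g x)
    (h : f x = g x ∨ (∀ᶠ y in 𝓝 x, C y) ∨ ∀ᶠ y in 𝓝 x, ¬ C y) :
    ContinuousAt (fun y => if C y then f y else g y) x := by
  rcases h with h | h | h
  · have hx : (if C x then f x else g x) = f x := by split_ifs <;> simp [h]
    rw [ContinuousAt, hx]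
    have hg' : Tendsto g (𝓝 x) (𝓝 (f x)) := by rw [h]; exact hg
    exact Tendsto.if' hf hg'
  · exact hf.congr (by filter_upwards [h] with y hy; rw [if_pos hy])
  · exact hg.congr (by filter_upwards [h] with y hy; rw [if_neg hy])

variable {M : Type*} [TopologicalSpace M]
  [ChartedSpace (EuclideanHalfSpace 2) M] [IsManifold (𝓡∂ 2) ∞ M]
  [RiemannianBundle (fun x : M => TangentSpace (𝓡∂ 2) x)] {ι : Type*}

namespace PolarChart

variable {S : ConicalSurface M ι} {i : ι} {p : ℝ × ℝ → M} {H : ℝ × ℝ → ℝ} {α δ r : ℝ}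

lemma apply_add_int_mul (h : PolarChart S i p H α) {s : ℝ} (hs : s ∈ Ioo (0 : ℝ) 1) (φ : ℝ)
    (k : ℤ) : p (s, φ + k * α) = p (s, φ) :=
  ((h.eq_iff s hs s hs _ _).2 ⟨rfl, k, rfl⟩).symm

lemma apply_sign_mul_dist (h : PolarChart S i p H α) {s : ℝ} (hs : s ∈ Ioo (0 : ℝ) 1) (φ : ℝ) :
    p (s, circSign α φ * circDist α φ) = p (s, φ) := by
  obtain ⟨k, hk⟩ := exists_eq_sign_mul_dist h.pos φ
  conv_rhs => rw [hk]
  rw [h.apply_add_int_mul hs]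

/-- The retraction of the complement of the vertex of a star in `{ρ < r}` onto `{ρ ≥ r}`, in polar
coordinates. -/
def starMap (p : ℝ × ℝ → M) (α δ r : ℝ) (y : ℝ × ℝ) : M :=
  if r ≤ y.1 then p y else
    if 0 ≤ Real.sin (2 * Real.pi * y.2 / α) then p (r, starAngle α δ (y.1 / r) y.2)
    else p (r, -starAngle α δ (y.1 / r) y.2)

lemma starMap_of_le {y : ℝ × ℝ} (h : r ≤ y.1) : starMap p α δ r y = p y := if_pos h

lemma starMap_of_lt {y : ℝ × ℝ} (h : y.1 < r) :
    starMap p α δ r y = p (r, circSign α y.2 * starAngle α δ (y.1 / r) y.2) := by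
  rw [starMap, if_neg (not_le.2 h), circSign]
  split_ifs <;> simp

/-- Only the seams need an argument. On the circle of radius `r` the projection is the identity. On
the axis beyond the vertex both halves have angle `0`. On the axis between tip and vertex, and on
the opposite ray, both have the truncated angle `α/2`, and `α/2` and `-α/2` describe the same point.
-/
lemma continuousAt_starMap (h : PolarChart S i p H α) (hα : α < 2 * Real.pi)
    (hδ : δ ∈ Ioo (0 : ℝ) 1) (hr : r ∈ Ioo (0 : ℝ) 1) {y : ℝ × ℝ} (hy : y ∈ strip)
    (hv : ¬ IsVertex α δ (y.1 / r) y.2) : ContinuousAt (starMap p α δ r) y := by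
  rcases lt_or_ge r y.1 with hlt | hle
  · refine (h.continuousAt hy).congr ?_
    filter_upwards [continuous_fst.continuousAt.eventually (lt_mem_nhds hlt)] with z hz
    exact (starMap_of_le hz.le).symm
  have hα0 := h.pos
  have hρ : y.1 / r ∈ Ioc (0 : ℝ) 1 :=
    ⟨div_pos (mem_strip.1 hy).1 hr.1, (div_le_one hr.1).2 hle⟩
  have hB := continuousAt_starAngle (r := r) hv
  have hstrip : ∀ φ : ℝ, ((r, φ) : ℝ × ℝ) ∈ strip := fun φ => mem_strip.2 hr
  have hplus : ContinuousAt (fun y : ℝ × ℝ => p (r, starAngle α δ (y.1 / r) y.2)) y :=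
    ContinuousAt.comp (g := p) (h.continuousAt (hstrip _)) (continuousAt_const.prodMk hB)
  have hminus : ContinuousAt (fun y : ℝ × ℝ => p (r, -starAngle α δ (y.1 / r) y.2)) y :=
    ContinuousAt.comp (g := p) (h.continuousAt (hstrip _)) (continuousAt_const.prodMk hB.neg)
  have hsin : ContinuousAt (fun y : ℝ × ℝ => Real.sin (2 * Real.pi * y.2 / α)) y := by fun_prop
  have hd := circDist_le_starAngle hα0 hα hδ hρ hv
  have hinner : ContinuousAt (fun y : ℝ × ℝ => if 0 ≤ Real.sin (2 * Real.pi * y.2 / α) then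
      p (r, starAngle α δ (y.1 / r) y.2) else p (r, -starAngle α δ (y.1 / r) y.2)) y := by
    refine continuousAt_ite hplus hminus ?_
    rcases lt_trichotomy (Real.sin (2 * Real.pi * y.2 / α)) 0 with h0 | h0 | h0
    · right; right
      filter_upwards [hsin.eventually (gt_mem_nhds h0)] with z hz using not_le.2 hz
    · left
      have hhalf : p (r, α / 2) = p (r, -(α / 2)) := by
        rw [← h.apply_add_int_mul hr (-(α / 2)) 1]
        congr 2
        push_cast; ring
      rcases circDist_of_sin_eq_zero hα0 h0 with h1 | h1
      · by_cases hρδ : y.1 / r < δ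
        · have : starAngle α δ (y.1 / r) y.2 = α / 2 := by
            rw [starAngle, h1, Real.cos_zero, Real.sin_zero, mul_one, mul_zero,
              exitAngle_of_gt hρδ, min_eq_left (by linarith)]
          simp only [this, hhalf]
        · have hne : y.1 / r ≠ δ := fun he => hv ((isVertex_iff hα0 hα hρ.1).2 ⟨he, h1⟩)
          have : starAngle α δ (y.1 / r) y.2 = 0 := by
            rw [starAngle, h1, Real.cos_zero, Real.sin_zero, mul_one, mul_zero,
              exitAngle_of_lt (lt_of_le_of_ne (not_lt.1 hρδ) hne.symm),
              min_eq_right (by positivity)]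
          simp only [this, neg_zero]
      · have : starAngle α δ (y.1 / r) y.2 = α / 2 :=
          le_antisymm (starAngle_le _ _) (h1 ▸ hd)
        simp only [this, hhalf]
    · right; left
      filter_upwards [hsin.eventually (lt_mem_nhds h0)] with z hz using hz.le
  refine continuousAt_ite (h.continuousAt hy) hinner ?_
  rcases hle.eq_or_lt with he | hlt
  · left
    have h1 : y.1 / r = 1 := by rw [he, div_self hr.1.ne']
    have h2 := h.apply_sign_mul_dist hr y.2
    have h3 : y = (r, y.2) := by ext <;> simp [he]
    rw [h1, starAngle_one hα0 hα hδ]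
    conv_lhs => rw [h3, ← h2, circSign]
    split_ifs <;> simp
  · right; right
    filter_upwards [continuous_fst.continuousAt.eventually (gt_mem_nhds hlt)] with z hz
    exact not_le.2 hz

lemma isVertex_congr (h : PolarChart S i p H α) {y y' : ℝ × ℝ} (hy : y ∈ strip) (hy' : y' ∈ strip)
    (he : p y = p y') : IsVertex α δ (y.1 / r) y.2 ↔ IsVertex α δ (y'.1 / r) y'.2 := by
  obtain ⟨h1, k, h2⟩ := (h.eq_iff y.1 (mem_strip.1 hy) y'.1 (mem_strip.1 hy') y.2 y'.2).1 he
  rw [IsVertex, IsVertex, h2, h1, circDist_add_int_mul]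

lemma starMap_congr (h : PolarChart S i p H α) {y y' : ℝ × ℝ} (hy : y ∈ strip) (hy' : y' ∈ strip)
    (he : p y = p y') : starMap p α δ r y = starMap p α δ r y' := by
  obtain ⟨h1, k, h2⟩ := (h.eq_iff y.1 (mem_strip.1 hy) y'.1 (mem_strip.1 hy') y.2 y'.2).1 he
  rcases le_or_gt r y.1 with hle | hlt
  · rw [starMap_of_le hle, starMap_of_le (h1 ▸ hle), he]
  · rw [starMap_of_lt hlt, starMap_of_lt (h1 ▸ hlt), h1, h2, circSign_add_int_mul h.pos]
    simp only [starAngle, circDist_add_int_mul]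

/-- Near the tip, the retraction is constant. -/
lemma exists_starMap_const (h : PolarChart S i p H α) (hα : α < 2 * Real.pi)
    (hδ : δ ∈ Ioo (0 : ℝ) 1) (hr : r ∈ Ioo (0 : ℝ) 1) :
    ∃ s ∈ Ioo 0 r, ∀ y ∈ strip, y.1 < s → ¬ IsVertex α δ (y.1 / r) y.2 ∧
      starMap p α δ r y = p (r, α / 2) := by
  have hα0 := h.pos
  -- Here `α < 2π` is essential: near the tip the exit angle is close to `π > α/2`, so the
  -- truncation takes effect and the map is constant.
  obtain ⟨ρ₀, hρ₀, hA⟩ := exists_lt_exitAngle hδ (A := α / 2) (by linarith)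
  set σ := min ρ₀ (min δ 1) with hσ
  have hσ0 : 0 < σ := lt_min hρ₀ (lt_min hδ.1 one_pos)
  refine ⟨r * σ / 2, ⟨by have := hr.1; positivity, ?_⟩, fun y hy hys => ?_⟩
  · have : σ ≤ 1 := (min_le_right _ _).trans (min_le_right _ _)
    nlinarith [hr.1]
  have hr0 := hr.1
  have hρ0 : 0 < y.1 / r := div_pos (mem_strip.1 hy).1 hr0
  have hρ : y.1 / r < σ := by
    rw [div_lt_iff₀ hr0]; nlinarith
  have hρδ : y.1 / r < δ := hρ.trans_le ((min_le_right _ _).trans (min_le_left _ _))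
  have hyr : y.1 < r := by
    have : σ ≤ 1 := (min_le_right _ _).trans (min_le_right _ _)
    rw [div_lt_iff₀ hr0] at hρ
    nlinarith
  refine ⟨fun hv => hρδ.ne ((isVertex_iff hα0 hα hρ0).1 hv).1, ?_⟩
  have hB : starAngle α δ (y.1 / r) y.2 = α / 2 := by
    rw [starAngle, min_eq_left]
    refine (hA _ _ ?_ ?_).le
    · rw [abs_mul, abs_of_pos hρ0]
      have := Real.abs_cos_le_one (circDist α y.2)
      have h2 := hρ.trans_le (min_le_left _ _)
      nlinarith [abs_nonneg (Real.cos (circDist α y.2))]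
    · rw [abs_mul, abs_of_pos hρ0]
      have := Real.abs_sin_le_one (circDist α y.2)
      have h2 := hρ.trans_le (min_le_left _ _)
      nlinarith [abs_nonneg (Real.sin (circDist α y.2))]
  rw [starMap_of_lt hyr, hB]
  rcases circSign_eq α y.2 with hs | hs
  · rw [hs, one_mul]
  · rw [hs, ← h.apply_add_int_mul hr _ 1]
    congr 2
    push_cast; ring

/-- The fibres of the retraction are the arms. -/
lemma starMap_eq_iff (h : PolarChart S i p H α) (hα : α < 2 * Real.pi)
    (hδ : δ ∈ Ioo (0 : ℝ) 1) (hr : r ∈ Ioo (0 : ℝ) 1) {y : ℝ × ℝ} (hy : y ∈ strip) (hyr : y.1 < r)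
    (hv : ¬ IsVertex α δ (y.1 / r) y.2) {φ : ℝ} (hφ : circDist α φ < α / 2) :
    starMap p α δ r y = p (r, φ) ↔ ∃ u ∈ Ioo (0 : ℝ) 1, p y = p (armCoord α δ r φ u) := by
  have hα0 := h.pos
  have hr0 := hr.1
  have hb0 := circDist_nonneg α φ
  have hbπ := circDist_lt_pi hα0 hα φ
  constructor
  · intro he
    have hρ : y.1 / r ∈ Ioc (0 : ℝ) 1 :=
      ⟨div_pos (mem_strip.1 hy).1 hr.1, ((div_lt_one hr.1).2 hyr).le⟩
    set ρ := y.1 / r with hρdef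
    set d := circDist α y.2 with hd
    have hdm := circDist_mem hα0 hα y.2
    have hd0 : 0 ≤ d := hdm.1
    rw [starMap_of_lt hyr, ← h.apply_sign_mul_dist hr φ, h.eq_iff r hr r hr] at he
    obtain ⟨-, k, hk⟩ := he
    set B := starAngle α δ ρ y.2 with hB
    have hB0 : 0 ≤ B := starAngle_nonneg hα0 _ _
    have hB1 : B ≤ α / 2 := starAngle_le _ _
    -- Both angles have modulus at most `α/2`, that of `φ` strictly less, so they cannot differ by a
    -- nonzero period.
    have hkabs : -1 < (k : ℝ) ∧ (k : ℝ) < 1 := by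
      rcases circSign_eq α y.2 with h1 | h1 <;> rcases circSign_eq α φ with h2 | h2 <;>
        rw [h1, h2] at hk <;> constructor <;> by_contra hcon <;> push Not at hcon <;> nlinarith
    have hk0 : k = 0 := by
      have a : -1 < k := by exact_mod_cast hkabs.1
      have b : k < 1 := by exact_mod_cast hkabs.2
      omega
    rw [hk0] at hk
    simp only [Int.cast_zero, zero_mul, add_zero] at hk
    have hBb : B = circDist α φ ∧ (circSign α y.2 = circSign α φ ∨ B = 0) := by
      rcases circSign_eq α y.2 with h1 | h1 <;> rcases circSign_eq α φ with h2 | h2 <;>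
        rw [h1, h2] at hk ⊢
      · exact ⟨by linarith, Or.inl rfl⟩
      · exact ⟨by linarith, Or.inr (by linarith)⟩
      · exact ⟨by linarith, Or.inr (by linarith)⟩
      · exact ⟨by linarith, Or.inl rfl⟩
    -- The truncation is not active because `circDist α φ < α / 2`.
    have hex : exitAngle δ (ρ * Real.cos d) (ρ * Real.sin d) = circDist α φ := by
      have h1 : min (α / 2) (exitAngle δ (ρ * Real.cos d) (ρ * Real.sin d)) = circDist α φ := hBb.1
      rcases min_choice (α / 2) (exitAngle δ (ρ * Real.cos d) (ρ * Real.sin d)) with h2 | h2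
      · rw [h2] at h1; exact absurd h1.symm hφ.ne
      · rw [← h2, h1]
    have hsind := Real.sin_nonneg_of_nonneg_of_le_pi hdm.1 hdm.2.le
    obtain ⟨u, hu, h1, h2⟩ := exists_segment hδ (b := ρ * Real.sin d) (a := ρ * Real.cos d)
      (mul_nonneg hρ.1.le hsind) (by
        have h3 : (ρ * Real.cos d) ^ 2 + (ρ * Real.sin d) ^ 2 = ρ ^ 2 := by
          have := Real.sin_sq_add_cos_sq d
          linear_combination ρ ^ 2 * this
        rw [h3]; nlinarith [hρ.1, hρ.2]) (ne_of_not_isVertex hv)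
    rw [hex] at h1 h2
    have hw : armVec δ (circDist α φ) u = ρ * (Complex.cos d + Complex.sin d * Complex.I) := by
      apply Complex.ext
      · rw [armVec_re, ← h1]
        simp [Complex.cos_ofReal_re, Complex.sin_ofReal_im, Complex.cos_ofReal_im]
      · rw [armVec_im, ← h2]
        simp [Complex.cos_ofReal_re, Complex.sin_ofReal_im, Complex.cos_ofReal_im,
          Complex.sin_ofReal_re]
    have hdIoc : d ∈ Ioc (-Real.pi) Real.pi := ⟨by linarith [Real.pi_pos], hdm.2.le⟩
    have hnorm : ‖armVec δ (circDist α φ) u‖ = ρ := by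
      rw [hw, Complex.norm_mul, Complex.norm_cos_add_sin_mul_I, mul_one, Complex.norm_real,
        Real.norm_of_nonneg hρ.1.le]
    have harg : (armVec δ (circDist α φ) u).arg = d := by
      rw [hw, Complex.arg_mul_cos_add_sin_mul_I hρ.1 hdIoc]
    have hρ1 : ρ < 1 := (div_lt_one hr.1).2 hyr
    have hu0 : u ≠ 0 := by
      rintro rfl
      rw [armVec_zero, Complex.norm_exp_ofReal_mul_I] at hnorm
      exact hρ1.ne hnorm.symm
    refine ⟨u, ⟨lt_of_le_of_ne hu.1 (Ne.symm hu0), hu.2⟩, ?_⟩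
    have harm : armCoord α δ r φ u = (y.1, circSign α φ * d) := by
      rw [armCoord, hnorm, harg, hρdef, mul_div_cancel₀ _ hr0.ne']
    rw [harm, ← h.apply_sign_mul_dist (mem_strip.1 hy) y.2]
    rcases hBb.2 with h3 | h3
    · rw [h3]
    · have h4 : d = 0 := by
        have := circDist_le_starAngle hα0 hα hδ hρ hv
        exact le_antisymm (this.trans h3.le) hd0
      rw [← hd, h4, mul_zero, mul_zero]
  · rintro ⟨u, hu, he⟩
    have huIcc : u ∈ Icc (0 : ℝ) 1 := Ioo_subset_Icc_self hu
    have hmem := armCoord_mem_strip hα0 hα hδ hr φ huIcc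
    have hlt := armCoord_fst_lt (α := α) hδ hr0 φ (Ioo_subset_Ioc_self hu)
    rw [h.starMap_congr hy hmem he, starMap_of_lt hlt]
    have hv' : ¬ IsVertex α δ ((armCoord α δ r φ u).1 / r) (armCoord α δ r φ u).2 := fun h' =>
      hv ((h.isVertex_congr hy hmem he).2 h')
    set b := circDist α φ with hb
    set w := armVec δ b u with hw
    have hslit := armVec_mem_slitPlane hδ.1 (circDist_mem hα0 hα φ) huIcc
    have hwne : w ≠ 0 := Complex.slitPlane_ne_zero hslit
    have h1 : (armCoord α δ r φ u).1 / r = ‖w‖ := by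
      change r * ‖w‖ / r = ‖w‖
      rw [mul_div_cancel_left₀ _ hr0.ne']
    have h2 : (armCoord α δ r φ u).2 = circSign α φ * w.arg := rfl
    have him : 0 ≤ w.im := by
      rw [hw, armVec_im]
      exact mul_nonneg (by linarith [hu.2]) (Real.sin_nonneg_of_nonneg_of_le_pi hb0 hbπ.le)
    have harg0 : 0 ≤ w.arg := Complex.arg_nonneg_iff.2 him
    have hcos : ‖w‖ * Real.cos w.arg = (1 - u) * Real.cos b + u * δ := by
      rw [Complex.norm_mul_cos_arg, hw, armVec_re]
    have hsin : ‖w‖ * Real.sin w.arg = (1 - u) * Real.sin b := by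
      rw [Complex.norm_mul_sin_arg, hw, armVec_im]
    have hex : exitAngle δ (‖w‖ * Real.cos w.arg) (‖w‖ * Real.sin w.arg) = b := by
      rw [hcos, hsin, exitAngle_segment hδ ⟨hb0, hbπ.le⟩ hu.2]
    have hargπ : w.arg < Real.pi :=
      lt_of_le_of_ne (Complex.arg_le_pi w) (Complex.mem_slitPlane_iff_arg.1 hslit).1
    -- Along an arm the angle does not exceed that of its end point. In particular it stays below
    -- `α/2` and is its own distance to `αℤ`.
    have hargb : w.arg ≤ b := by
      by_cases hne : ‖w‖ * Real.cos w.arg ≠ δ ∨ ‖w‖ * Real.sin w.arg ≠ 0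
      · have := le_exitAngle hδ ⟨norm_pos_iff.2 hwne,
          (norm_armVec_lt_one hδ (Ioo_subset_Ioc_self hu)).le⟩ ⟨harg0, hargπ⟩ hne
        rwa [hex] at this
      · push Not at hne
        have h3 : Real.sin w.arg = 0 :=
          (mul_eq_zero.1 hne.2).resolve_left (norm_ne_zero_iff.2 hwne)
        have h4 : w.arg = 0 := by
          by_contra hne'
          exact (Real.sin_pos_of_pos_of_lt_pi (lt_of_le_of_ne harg0 (Ne.symm hne')) hargπ).ne' h3
        rw [h4]; exact hb0
    have habs : |circSign α φ * w.arg| = w.arg := by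
      rcases circSign_eq α φ with h3 | h3 <;> rw [h3] <;> simp [abs_of_nonneg harg0]
    have hdist : circDist α (circSign α φ * w.arg) = w.arg := by
      rw [circDist_of_abs_le hα0 (by rw [habs]; linarith), habs]
    have hBb : starAngle α δ ((armCoord α δ r φ u).1 / r) (armCoord α δ r φ u).2 = b := by
      rw [h1, h2, starAngle, hdist, hex, min_eq_right hφ.le]
    rw [hBb, ← h.apply_sign_mul_dist hr φ, h2]
    rcases harg0.eq_or_lt with h3 | h3
    · have h4 : b = 0 := by
        rw [← h3, Real.sin_zero, mul_zero] at hsin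
        have h5 : Real.sin b = 0 := by
          have : 1 - u ≠ 0 := by linarith [hu.2]
          simpa [this] using hsin.symm
        by_contra hne'
        exact (Real.sin_pos_of_pos_of_lt_pi (lt_of_le_of_ne hb0 (Ne.symm hne')) hbπ).ne' h5
      rw [← hb, h4, mul_zero, mul_zero]
    · have : circSign α (circSign α φ * w.arg) = circSign α φ := by
        rcases circSign_eq α φ with h4 | h4
        · rw [h4, one_mul, circSign_of_nonneg hα0 harg0 (by linarith)]
        · rw [h4, circSign_of_neg hα0 (by linarith) (by linarith)]
      rw [this]

end PolarChart
end ConicalSurface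
end

/-! ### The retraction on the surface and preimages of sets under it. -/

noncomputable section
namespace ConicalSurface

variable {M : Type*} [TopologicalSpace M] [ChartedSpace (EuclideanHalfSpace 2) M]
  [IsManifold (𝓡∂ 2) ∞ M]
  [RiemannianBundle (fun x : M => TangentSpace (𝓡∂ 2) x)] {ι : Type*}

open Classical in
/-- The retraction of the complement of the vertex of a star in `{radius < r}` onto
`{r ≤ radius}`. -/
def starRetract (S : ConicalSurface M ι) (i : ι) (p : ℝ × ℝ → M) (α δ r : ℝ)
    (z : S.Completion) : S.Completion :=
  if r ≤ S.radius i z then z else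
    if hz : ∃ y ∈ strip, z = S.reg (p y) then S.reg (PolarChart.starMap p α δ r hz.choose)
    else S.reg (p (r, α / 2))

namespace PolarChart

variable {S : ConicalSurface M ι} {i : ι} {p : ℝ × ℝ → M} {H : ℝ × ℝ → ℝ} {α δ r : ℝ}

lemma starRetract_of_le {z : S.Completion} (hz : r ≤ S.radius i z) :
    S.starRetract i p α δ r z = z := if_pos hz

lemma starRetract_tip (hr : 0 < r) :
    S.starRetract i p α δ r (S.tip i) = S.reg (p (r, α / 2)) := by
  rw [starRetract, if_neg (by simpa using hr), dif_neg]
  rintro ⟨y, -, hy⟩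
  exact S.reg_ne_tip _ _ hy.symm

lemma starRetract_reg (h : PolarChart S i p H α) {y : ℝ × ℝ} (hy : y ∈ strip) :
    S.starRetract i p α δ r (S.reg (p y)) = S.reg (starMap p α δ r y) := by
  rcases le_or_gt r y.1 with hle | hlt
  · rw [starRetract_of_le (by rwa [h.radius_apply hy]), starMap_of_le hle]
  have hz : ∃ y' ∈ strip, S.reg (p y) = S.reg (p y') := ⟨y, hy, rfl⟩
  rw [starRetract, if_neg (by rw [h.radius_apply hy]; exact not_le.2 hlt), dif_pos hz]
  congr 1
  exact (h.starMap_congr hy hz.choose_spec.1 (S.reg_injective hz.choose_spec.2)).symm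

lemma radius_starRetract_of_lt (h : PolarChart S i p H α) (hr : r ∈ Ioo (0 : ℝ) 1)
    {z : S.Completion} (hz : S.radius i z < r) : S.radius i (S.starRetract i p α δ r z) = r := by
  have hring : ∀ φ : ℝ, S.radius i (S.reg (p (r, φ))) = r := fun φ =>
    h.radius_apply (y := (r, φ)) (mem_strip.2 hr)
  rcases h.exists_of_radius_lt_one (hz.trans hr.2) with rfl | ⟨y, hy, rfl⟩
  · rw [starRetract_tip hr.1, hring]
  · rw [h.radius_apply hy] at hz
    rw [h.starRetract_reg hy, starMap_of_lt hz, hring]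

lemma vertex_mem_strip (hδ : δ ∈ Ioo (0 : ℝ) 1) (hr : r ∈ Ioo (0 : ℝ) 1) :
    ((r * δ, 0) : ℝ × ℝ) ∈ strip :=
  mem_strip.2 ⟨mul_pos hr.1 hδ.1, by nlinarith [hr.1, hr.2, hδ.1, hδ.2]⟩

lemma isVertex_iff_eq (h : PolarChart S i p H α) (hα : α < 2 * Real.pi)
    (hδ : δ ∈ Ioo (0 : ℝ) 1) (hr : r ∈ Ioo (0 : ℝ) 1) {y : ℝ × ℝ} (hy : y ∈ strip) :
    IsVertex α δ (y.1 / r) y.2 ↔ p y = p (r * δ, 0) := by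
  have hα0 := h.pos
  constructor
  · intro hv
    obtain ⟨h1, h2⟩ := (isVertex_iff hα0 hα (div_pos (mem_strip.1 hy).1 hr.1)).1 hv
    have h3 := h.apply_sign_mul_dist (mem_strip.1 hy) y.2
    rw [h2, mul_zero] at h3
    have h4 : y.1 = r * δ := by
      rw [div_eq_iff hr.1.ne'] at h1; linarith
    rw [← h4, h3]
  · intro he
    refine (h.isVertex_congr hy (vertex_mem_strip hδ hr) he).2 ?_
    refine (isVertex_iff hα0 hα (div_pos (mul_pos hr.1 hδ.1) hr.1)).2 ⟨?_, ?_⟩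
    · field_simp [hr.1.ne']
    · simp [circDist]

/-- At the tip the map is locally constant. At other points of the ball continuity descends from
`starMap`, because `p` carries neighbourhood filters to neighbourhood filters. -/
lemma continuousAt_starRetract (h : PolarChart S i p H α) (hα : α < 2 * Real.pi)
    (hδ : δ ∈ Ioo (0 : ℝ) 1) (hr : r ∈ Ioo (0 : ℝ) 1) {z : S.Completion}
    (hz : z ≠ S.reg (p (r * δ, 0))) : ContinuousAt (S.starRetract i p α δ r) z := by
  rcases lt_or_ge r (S.radius i z) with hlt | hle
  · refine continuousAt_id.congr ?_
    filter_upwards [(h.isOpen_lt_radius r).mem_nhds hlt] with w hw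
    exact (starRetract_of_le (le_of_lt hw)).symm
  rcases h.exists_of_radius_lt_one (hle.trans_lt hr.2) with rfl | ⟨y, hy, rfl⟩
  · obtain ⟨s, hs, hconst⟩ := h.exists_starMap_const hα hδ hr
    refine (continuousAt_const (y := S.reg (p (r, α / 2)))).congr ?_
    refine h.mem_nhds_tip (s := s) ⟨hs.1, hs.2.trans hr.2⟩ (starRetract_tip hr.1).symm ?_
    intro y hy hys
    rw [mem_ofPred_eq, h.starRetract_reg hy, (hconst y hy hys).2]
  · have hv : ¬ IsVertex α δ (y.1 / r) y.2 := fun hv =>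
      hz (by rw [(h.isVertex_iff_eq hα hδ hr hy).1 hv])
    have h1 : ContinuousAt (fun y => S.reg (starMap p α δ r y)) y :=
      ContinuousAt.comp (g := S.reg) S.isOpenEmbedding_reg.continuous.continuousAt
        (h.continuousAt_starMap hα hδ hr hy hv)
    rw [ContinuousAt, ← S.map_reg_nhds, ← h.map_nhds hy, tendsto_map'_iff, tendsto_map'_iff,
      h.starRetract_reg hy]
    refine h1.tendsto.congr' ?_
    filter_upwards [strip_mem_nhds hy] with w hw
    exact (h.starRetract_reg hw).symm

lemma isOpen_compl_singleton [T1Space M] (S : ConicalSurface M ι) (x : M) :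
    IsOpen ({S.reg x}ᶜ : Set S.Completion) := by
  refine S.isOpen_completion_iff.2 ⟨?_, ?_⟩
  · convert (_root_.isOpen_compl_singleton (x := x)) using 1
    ext w
    simp [S.reg_injective.eq_iff]
  · intro j _
    by_cases hx : ∃ y ∈ strip, S.polar j y = x
    · obtain ⟨y, hy, rfl⟩ := hx
      refine ⟨y.1, mem_strip.1 hy, fun s hs θ he => ?_⟩
      have := ((S.polar_eq_iff j s ⟨hs.1, hs.2.trans (mem_strip.1 hy).2⟩ y.1 (mem_strip.1 hy) θ
        y.2).1 (S.reg_injective he)).1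
      exact hs.2.ne this
    · refine ⟨1 / 2, by norm_num, fun s hs θ he => hx ⟨(s, θ), ?_, S.reg_injective he⟩⟩
      exact mem_strip.2 ⟨hs.1, by linarith [hs.2]⟩

/-- The preimage of an open set under the retraction. -/
lemma isOpen_starPart [T1Space M] (h : PolarChart S i p H α) (hα : α < 2 * Real.pi)
    (hδ : δ ∈ Ioo (0 : ℝ) 1) (hr : r ∈ Ioo (0 : ℝ) 1) {U : Set S.Completion} (hU : IsOpen U) :
    IsOpen ({S.reg (p (r * δ, 0))}ᶜ ∩ S.starRetract i p α δ r ⁻¹' U) :=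
  ContinuousOn.isOpen_inter_preimage
    (fun _ hz => (h.continuousAt_starRetract hα hδ hr hz).continuousWithinAt)
    (isOpen_compl_singleton S _) hU

/-- The retraction maps a point into the part of the curve outside `{radius < r}` iff the point is
on this part, on an arm of the star over an intersection of the curve with the circle. -/
lemma starRetract_mem_iff (h : PolarChart S i p H α) (hα : α < 2 * Real.pi)
    (hδ : δ ∈ Ioo (0 : ℝ) 1) (hr : r ∈ Ioo (0 : ℝ) 1) {A : Set S.Completion} {Φ : Set ℝ}
    (hΦ : ∀ φ ∈ Φ, circDist α φ < α / 2)
    (hA : ∀ z, S.radius i z = r → (z ∈ A ↔ ∃ φ ∈ Φ, z = S.reg (p (r, φ))))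
    {z : S.Completion} (hz : z ≠ S.reg (p (r * δ, 0))) :
    S.starRetract i p α δ r z ∈ A ↔ (r ≤ S.radius i z ∧ z ∈ A) ∨
      ∃ φ ∈ Φ, ∃ u ∈ Icc (0 : ℝ) 1, z = S.reg (p (armCoord α δ r φ u)) := by
  have hα0 := h.pos
  have harm : ∀ φ, ∀ u ∈ Ioc (0 : ℝ) 1, S.radius i (S.reg (p (armCoord α δ r φ u))) < r := by
    intro φ u hu
    rw [h.radius_apply (armCoord_mem_strip hα0 hα hδ hr φ ⟨hu.1.le, hu.2⟩)]
    exact armCoord_fst_lt hδ hr.1 φ hu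
  rcases le_or_gt r (S.radius i z) with hle | hlt
  · rw [starRetract_of_le hle]
    constructor
    · exact fun hzA => Or.inl ⟨hle, hzA⟩
    · rintro (⟨-, hzA⟩ | ⟨φ, hφ, u, hu, rfl⟩)
      · exact hzA
      · rcases hu.1.eq_or_lt with rfl | hu0
        · rw [armCoord_zero hα0 hα, h.apply_sign_mul_dist hr]
          exact (hA _ (h.radius_apply (y := (r, φ)) (mem_strip.2 hr))).2 ⟨φ, hφ, rfl⟩
        · exact absurd (harm φ u ⟨hu0, hu.2⟩) (not_lt.2 hle)
  have hring : ∀ φ : ℝ, S.radius i (S.reg (p (r, φ))) = r := fun φ =>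
    h.radius_apply (y := (r, φ)) (mem_strip.2 hr)
  rcases h.exists_of_radius_lt_one (hlt.trans hr.2) with rfl | ⟨y, hy, rfl⟩
  -- The tip is sent to the point at angle `α/2`, which is over no crossing since all of `Φ` is at
  -- distance less than `α/2`.
  · rw [starRetract_tip hr.1, hA _ (hring _)]
    constructor
    · rintro ⟨φ, hφ, he⟩
      obtain ⟨-, k, hk⟩ := (h.eq_iff r hr r hr _ _).1 (S.reg_injective he)
      have := hΦ φ hφ
      rw [hk, circDist_add_int_mul, circDist_of_abs_le hα0 (by rw [abs_of_pos (by positivity)]),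
        abs_of_pos (by positivity)] at this
      exact absurd this (lt_irrefl _)
    · rintro (⟨h1, -⟩ | ⟨φ, -, u, -, he⟩)
      · exact absurd hlt (not_lt.2 h1)
      · exact absurd he.symm (S.reg_ne_tip _ _)
  rw [h.radius_apply hy] at hlt
  have hv : ¬ IsVertex α δ (y.1 / r) y.2 := fun hv =>
    hz (by rw [(h.isVertex_iff_eq hα hδ hr hy).1 hv])
  have hrad : S.radius i (S.reg (starMap p α δ r y)) = r := by
    rw [starMap_of_lt hlt]; exact hring _
  rw [h.starRetract_reg hy, hA _ hrad, h.radius_apply hy]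
  constructor
  · rintro ⟨φ, hφ, he⟩
    obtain ⟨u, hu, hpu⟩ := (h.starMap_eq_iff hα hδ hr hy hlt hv (hΦ φ hφ)).1 (S.reg_injective he)
    exact Or.inr ⟨φ, hφ, u, Ioo_subset_Icc_self hu, by rw [hpu]⟩
  · rintro (⟨h1, -⟩ | ⟨φ, hφ, u, hu, he⟩)
    · exact absurd hlt (not_lt.2 h1)
    · have he' := S.reg_injective he
      refine ⟨φ, hφ, ?_⟩
      rw [(h.starMap_eq_iff hα hδ hr hy hlt hv (hΦ φ hφ)).2 ⟨u, ⟨?_, ?_⟩, he'⟩]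
      · refine lt_of_le_of_ne hu.1 ?_
        rintro rfl
        rw [armCoord_zero hα0 hα, h.apply_sign_mul_dist hr] at he'
        exact hlt.ne ((h.eq_iff y.1 (mem_strip.1 hy) r hr y.2 φ).1 he').1
      · refine lt_of_le_of_ne hu.2 ?_
        rintro rfl
        rw [armCoord_one hδ.1] at he'
        exact hz (by rw [he'])

end PolarChart
end ConicalSurface
end

/-! ### Transversal crossings of a level and the definition of the surgery. -/

noncomputable section
namespace ConicalSurface

/-- Near a transversal crossing of a level, a function is below the level on exactly one side. -/
lemma eventually_crossing {f : ℝ → ℝ} {k r : ℝ} (hk : f k = r) (hd : deriv f k ≠ 0) :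
    ∃ σ : ℝ, (σ = 1 ∨ σ = -1) ∧ ∀ᶠ t in 𝓝 k, t ≠ k → f t ≠ r ∧ (f t < r ↔ 0 < σ * (t - k)) := by
  have hdiff : HasDerivAt f (deriv f k) k := (differentiableAt_of_deriv_ne_zero hd).hasDerivAt
  have hs : Tendsto (slope f k) (𝓝[≠] k) (𝓝 (deriv f k)) := hasDerivAt_iff_tendsto_slope.1 hdiff
  rcases lt_or_gt_of_ne hd with h | h
  · refine ⟨1, Or.inl rfl, ?_⟩
    have h1 := eventually_nhdsWithin_iff.1 (hs.eventually (gt_mem_nhds h))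
    filter_upwards [h1] with t ht htk
    have h2 := ht htk
    rw [slope_def_field, hk] at h2
    rcases lt_or_gt_of_ne htk with h3 | h3
    · have h4 : r < f t := by
        have := (div_neg_iff.1 h2).resolve_right (by intro hh; linarith [hh.2])
        linarith [this.1]
      exact ⟨h4.ne', ⟨fun h5 => absurd h5 h4.not_gt, fun h5 => by linarith⟩⟩
    · have h4 : f t < r := by
        have := (div_neg_iff.1 h2).resolve_left (by intro hh; linarith [hh.2])
        linarith [this.1]
      exact ⟨h4.ne, ⟨fun _ => by linarith, fun _ => h4⟩⟩
  · refine ⟨-1, Or.inr rfl, ?_⟩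
    have h1 := eventually_nhdsWithin_iff.1 (hs.eventually (lt_mem_nhds h))
    filter_upwards [h1] with t ht htk
    have h2 := ht htk
    rw [slope_def_field, hk] at h2
    rcases lt_or_gt_of_ne htk with h3 | h3
    · have h4 : f t < r := by
        have := (div_pos_iff.1 h2).resolve_left (by intro hh; linarith [hh.2])
        linarith [this.1]
      exact ⟨h4.ne, ⟨fun _ => by linarith, fun _ => h4⟩⟩
    · have h4 : r < f t := by
        have := (div_pos_iff.1 h2).resolve_right (by intro hh; linarith [hh.2])
        linarith [this.1]
      exact ⟨h4.ne', ⟨fun h5 => absurd h5 h4.not_gt, fun h5 => by linarith⟩⟩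

/-- Around finitely many transversal crossings of a level there are disjoint intervals of the same
length, on which the function is below the level on exactly one side. -/
lemma exists_crossing_radius {f : ℝ → ℝ} {K : Finset ℝ} {r : ℝ} {O : Set ℝ} (hO : IsOpen O)
    (hKO : ∀ k ∈ K, k ∈ O) (hK : ∀ k ∈ K, f k = r) (hd : ∀ k ∈ K, deriv f k ≠ 0) :
    ∃ (σ : ℝ → ℝ) (η : ℝ), 0 < η ∧ (∀ k, σ k = 1 ∨ σ k = -1) ∧
      (∀ k ∈ K, ∀ t, |t - k| < η → t ∈ O ∧ (t ≠ k → f t ≠ r ∧ (f t < r ↔ 0 < σ k * (t - k)))) ∧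
      ∀ k ∈ K, ∀ k' ∈ K, k ≠ k' → 2 * η ≤ |k - k'| := by
  classical
  have h1 : ∀ k, ∃ σ : ℝ, (σ = 1 ∨ σ = -1) ∧ (k ∈ K → ∀ᶠ t in 𝓝 k, t ∈ O ∧
      (t ≠ k → f t ≠ r ∧ (f t < r ↔ 0 < σ * (t - k)))) := by
    intro k
    by_cases hk : k ∈ K
    · obtain ⟨σ, hσ, h2⟩ := eventually_crossing (hK k hk) (hd k hk)
      exact ⟨σ, hσ, fun _ => by
        filter_upwards [hO.mem_nhds (hKO k hk), h2] with t h3 h4 using ⟨h3, h4⟩⟩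
    · exact ⟨1, Or.inl rfl, fun h => absurd h hk⟩
  choose σ hσ hev using h1
  have h2 : ∀ k ∈ K, ∀ᶠ η in 𝓝[>] (0 : ℝ), ∀ t, |t - k| < 2 * η →
      t ∈ O ∧ (t ≠ k → f t ≠ r ∧ (f t < r ↔ 0 < σ k * (t - k))) := by
    intro k hk
    obtain ⟨ε, hε, hb⟩ := Metric.eventually_nhds_iff.1 (hev k hk)
    filter_upwards [Ioo_mem_nhdsGT (half_pos hε)] with η hη t ht
    exact hb (by rw [Real.dist_eq]; linarith [hη.2])
  obtain ⟨η, hη, hη0⟩ := (((K.eventually_all).2 h2).and self_mem_nhdsWithin).exists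
  refine ⟨σ, η, hη0, hσ, fun k hk t ht => hη k hk t (by linarith), fun k hk k' hk' hne => ?_⟩
  -- If two crossings were closer than `2η`, then `k` would be a point near `k'`, other than `k'`,
  -- at which the level is attained.
  by_contra hcon
  push Not at hcon
  exact ((hη k' hk' k hcon).2 hne).1 (hK k hk)

variable {M : Type*} [TopologicalSpace M] [ChartedSpace (EuclideanHalfSpace 2) M]
  [IsManifold (𝓡∂ 2) ∞ M]
  [RiemannianBundle (fun x : M => TangentSpace (𝓡∂ 2) x)] {ι : Type*}

open Classical in
/-- Replace the parts of a curve in `{radius < r}` by a path that runs from the crossings of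
`{radius = r}` at the parameters in `K` along arms to a vertex. -/
def surgery (S : ConicalSurface M ι) (i : ι) (p : ℝ × ℝ → M) (α δ r η : ℝ) (K : Finset ℝ)
    (φ : ℝ → ℝ) (c : ℝ → S.Completion) (t : ℝ) : S.Completion :=
  if r ≤ S.radius i (c t) then c t else
    -- The arm is traversed while `|t - k| ≤ η/2`. For larger distances the minimum is `1` and the
    -- curve rests at the vertex, which matches the last case.
    if hk : ∃ k ∈ K, |t - k| < η then
      S.reg (p (armCoord α δ r (φ hk.choose) (min 1 (2 * |t - hk.choose| / η))))
    else S.reg (p (r * δ, 0))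

section

variable {S : ConicalSurface M ι} {i : ι} {p : ℝ × ℝ → M} {H : ℝ × ℝ → ℝ} {α δ r η : ℝ}
  {K : Finset ℝ} {φ : ℝ → ℝ} {c : ℝ → S.Completion}

lemma surgery_of_le {t : ℝ} (ht : r ≤ S.radius i (c t)) :
    S.surgery i p α δ r η K φ c t = c t := if_pos ht

lemma surgery_of_near (hsep : ∀ k ∈ K, ∀ k' ∈ K, k ≠ k' → 2 * η ≤ |k - k'|) {t k : ℝ}
    (ht : S.radius i (c t) < r) (hk : k ∈ K) (htk : |t - k| < η) :
    S.surgery i p α δ r η K φ c t =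
      S.reg (p (armCoord α δ r (φ k) (min 1 (2 * |t - k| / η)))) := by
  have hex : ∃ k ∈ K, |t - k| < η := ⟨k, hk, htk⟩
  have : hex.choose = k := by
    by_contra hne
    have h1 := hsep _ hex.choose_spec.1 k hk hne
    have h2 := hex.choose_spec.2
    have h3 := abs_sub_le hex.choose t k
    rw [abs_sub_comm hex.choose t] at h3
    linarith
  rw [surgery, if_neg (not_le.2 ht), dif_pos hex, this]

lemma surgery_of_far (hδ : 0 < δ) (hη : 0 < η)
    (hsep : ∀ k ∈ K, ∀ k' ∈ K, k ≠ k' → 2 * η ≤ |k - k'|) {t : ℝ}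
    (ht : S.radius i (c t) < r) (hk : ∀ k ∈ K, η / 2 ≤ |t - k|) :
    S.surgery i p α δ r η K φ c t = S.reg (p (r * δ, 0)) := by
  by_cases hex : ∃ k ∈ K, |t - k| < η
  · obtain ⟨k, hkK, htk⟩ := hex
    rw [surgery_of_near hsep ht hkK htk, min_eq_left, armCoord_one hδ]
    rw [le_div_iff₀ hη]
    linarith [hk k hkK]
  · rw [surgery, if_neg (not_le.2 ht), dif_neg hex]

end

namespace PolarChart

variable {S : ConicalSurface M ι} {i : ι} {p : ℝ × ℝ → M} {H : ℝ × ℝ → ℝ} {α δ r : ℝ}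

/-- The speed of an arm. -/
lemma speed_arm [Nonempty M] (h : PolarChart S i p H α) (hα : α < 2 * Real.pi)
    (hδ : δ ∈ Ioo (0 : ℝ) 1) (hr : r ∈ Ioo (0 : ℝ) 1) {τ : ℝ} (hτ : 0 ≤ τ)
    (hH : ∀ y ∈ strip, y.1 ≤ r → H y ≤ 1 + τ) (φ : ℝ) {η : ℝ} (hη : 0 < η) {c : ℝ → S.Completion}
    {t k : ℝ} (htk : t ≠ k) (ht : |t - k| < η / 2)
    (hc : ∀ᶠ s in 𝓝 t, c s = S.reg (p (armCoord α δ r φ (2 * |s - k| / η)))) :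
    ContMDiffAt 𝓘(ℝ, ℝ) (𝓡∂ 2) 1 (S.toReg ∘ c) t ∧
      S.speed c t ≤ ENNReal.ofReal (2 / η *
        (r * Real.sqrt (1 + τ) * Real.sqrt (1 - 2 * δ * Real.cos (circDist α φ) + δ ^ 2))) := by
  have hα0 := h.pos
  have hsub : t - k ≠ 0 := sub_ne_zero.2 htk
  have hu : 2 * |t - k| / η ∈ Ioo (0 : ℝ) 1 :=
    ⟨by positivity, by rw [div_lt_one hη]; linarith⟩
  obtain ⟨hC, v, hv, hvn⟩ := exists_hasDerivAt_armCoord (r := r) hα0 hα hδ φ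
    (Ioo_subset_Icc_self hu)
  obtain ⟨s, hs1, hs⟩ : ∃ s : ℝ, s ^ 2 = 1 ∧ HasDerivAt (fun x : ℝ => |x|) s (t - k) := by
    refine ⟨_, ?_, hasDerivAt_abs hsub⟩
    rcases lt_or_gt_of_ne hsub with h1 | h1
    · simp [sign_neg h1]
    · simp [sign_pos h1]
  have hin : HasDerivAt (fun s : ℝ => 2 * |s - k| / η) (2 * s / η) t := by
    have h1 : HasDerivAt (fun s : ℝ => |s - k|) s t := by
      exact (HasDerivAt.comp t hs ((hasDerivAt_id t).sub_const k)).congr_deriv (mul_one s)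
    exact (h1.const_mul 2).div_const η
  have hinC : ContDiffAt ℝ 1 (fun s : ℝ => 2 * |s - k| / η) t := by
    have h1 : ContDiffAt ℝ 1 (fun s : ℝ => |s - k|) t :=
      (contDiffAt_abs hsub).comp t (contDiffAt_id.sub contDiffAt_const)
    exact (contDiffAt_const.mul h1).div_const η
  set y : ℝ → ℝ × ℝ := fun s => armCoord α δ r φ (2 * |s - k| / η) with hy
  have hyt : y t ∈ strip := armCoord_mem_strip hα0 hα hδ hr φ (Ioo_subset_Icc_self hu)
  have hyC : ContDiffAt ℝ 1 y t :=
    ContDiffAt.comp (g := armCoord α δ r φ) (f := fun s : ℝ => 2 * |s - k| / η) t hC hinC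
  have hyd : HasDerivAt y ((2 * s / η) • v) t :=
    HasDerivAt.scomp (h := fun s : ℝ => 2 * |s - k| / η) t hv hin
  have hev : ∀ᶠ s in 𝓝 t, (S.toReg ∘ c) s = p (y s) := by
    filter_upwards [hc] with s hs
    rw [Function.comp_apply, hs, S.toReg_reg]
  refine ⟨(h.contMDiffAt_comp hyt hyC).congr_of_eventuallyEq hev, ?_⟩
  rw [speed, h.norm_mfderiv_curve hyt hyd hev]
  refine ENNReal.ofReal_le_ofReal ?_
  have hH' := hH (y t) hyt (armCoord_fst_lt hδ hr.1 φ ⟨hu.1, hu.2.le⟩).le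
  have hcos : 0 ≤ 1 - 2 * δ * Real.cos (circDist α φ) + δ ^ 2 := by
    nlinarith [Real.cos_le_one (circDist α φ), hδ.1, hδ.2, sq_nonneg (1 - δ)]
  have e1 : 2 / η * (r * Real.sqrt (1 + τ) *
      Real.sqrt (1 - 2 * δ * Real.cos (circDist α φ) + δ ^ 2)) =
      Real.sqrt ((2 / η) ^ 2 * (r ^ 2 * (1 + τ) *
        (1 - 2 * δ * Real.cos (circDist α φ) + δ ^ 2))) := by
    rw [Real.sqrt_mul (by positivity), Real.sqrt_sq (by positivity), Real.sqrt_mul (by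
      have := hr.1; positivity), Real.sqrt_mul (by positivity), Real.sqrt_sq hr.1.le]
  rw [e1]
  refine Real.sqrt_le_sqrt ?_
  have h2 : ((2 * s / η) • v).1 ^ 2 + (y t).1 ^ 2 * H (y t) * ((2 * s / η) • v).2 ^ 2 =
      (2 / η) ^ 2 * (v.1 ^ 2 + (y t).1 ^ 2 * H (y t) * v.2 ^ 2) := by
    simp only [Prod.smul_fst, Prod.smul_snd, smul_eq_mul]
    have : (2 * s / η) ^ 2 = (2 / η) ^ 2 := by
      rw [div_pow, mul_pow, hs1, div_pow, mul_one]
    rw [mul_pow, mul_pow, this]; ring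
  rw [h2]
  refine mul_le_mul_of_nonneg_left ?_ (by positivity)
  have h3 : r ^ 2 * (1 + τ) * (1 - 2 * δ * Real.cos (circDist α φ) + δ ^ 2) =
      (1 + τ) * (v.1 ^ 2 + (y t).1 ^ 2 * v.2 ^ 2) := by
    rw [hvn]; ring
  rw [h3]
  have h4 : (y t).1 ^ 2 * v.2 ^ 2 * H (y t) ≤ (y t).1 ^ 2 * v.2 ^ 2 * (1 + τ) :=
    mul_le_mul_of_nonneg_left hH' (by positivity)
  nlinarith [mul_nonneg hτ (sq_nonneg v.1)]

end PolarChart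
end ConicalSurface
end

/-! ### The curve obtained by surgery: regularity, trace and length. -/

noncomputable section
namespace ConicalSurface

variable {M : Type*} [TopologicalSpace M] [ChartedSpace (EuclideanHalfSpace 2) M]
  [IsManifold (𝓡∂ 2) ∞ M]
  [RiemannianBundle (fun x : M => TangentSpace (𝓡∂ 2) x)] {ι : Type*}

lemma speed_const [Nonempty M] (S : ConicalSurface M ι) (z : S.Completion) (t : ℝ) :
    S.speed (fun _ => z) t = 0 := by
  have : mfderiv 𝓘(ℝ, ℝ) (𝓡∂ 2) (S.toReg ∘ fun _ : ℝ => z) t = 0 := mfderiv_const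
  rw [speed, this]
  exact enorm_zero

/-- The length of an arm of a star, up to the factor by which the metric differs from that of a
cone. -/
def armLength (α δ r τ φ : ℝ) : ℝ :=
  r * Real.sqrt (1 + τ) * Real.sqrt (1 - 2 * δ * Real.cos (circDist α φ) + δ ^ 2)

/-- The side of a crossing on which the curve is replaced by an arm. -/
lemma volume_side {σ k ε : ℝ} (hσ : σ = 1 ∨ σ = -1) :
    MeasurableSet {t : ℝ | 0 < σ * (t - k) ∧ |t - k| < ε} ∧
      volume {t : ℝ | 0 < σ * (t - k) ∧ |t - k| < ε} = ENNReal.ofReal ε := by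
  rcases hσ with rfl | rfl
  · have : {t : ℝ | 0 < 1 * (t - k) ∧ |t - k| < ε} = Ioo k (k + ε) := by
      ext t
      simp only [mem_ofPred_eq, mem_Ioo, abs_lt]
      constructor
      · rintro ⟨h1, h2, h3⟩; constructor <;> linarith
      · rintro ⟨h1, h2⟩; refine ⟨?_, ?_, ?_⟩ <;> linarith
    rw [this]
    exact ⟨measurableSet_Ioo, by rw [Real.volume_Ioo]; congr 1; ring⟩
  · have : {t : ℝ | 0 < -1 * (t - k) ∧ |t - k| < ε} = Ioo (k - ε) k := by
      ext t
      simp only [mem_ofPred_eq, mem_Ioo, abs_lt]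
      constructor
      · rintro ⟨h1, h2, h3⟩; constructor <;> linarith
      · rintro ⟨h1, h2⟩; refine ⟨?_, ?_, ?_⟩ <;> linarith
    rw [this]
    exact ⟨measurableSet_Ioo, by rw [Real.volume_Ioo]; congr 1; ring⟩

namespace PolarChart

variable {S : ConicalSurface M ι} {i : ι} {p : ℝ × ℝ → M} {H : ℝ × ℝ → ℝ} {α δ r : ℝ}

lemma continuous_arm (h : PolarChart S i p H α) (hα : α < 2 * Real.pi)
    (hδ : δ ∈ Ioo (0 : ℝ) 1) (hr : r ∈ Ioo (0 : ℝ) 1) (φ k η : ℝ) (hη : 0 < η) :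
    Continuous fun t => S.reg (p (armCoord α δ r φ (min 1 (2 * |t - k| / η)))) := by
  rw [continuous_iff_continuousAt]
  intro t
  have hu : min 1 (2 * |t - k| / η) ∈ Icc (0 : ℝ) 1 :=
    ⟨le_min zero_le_one (by positivity), min_le_left _ _⟩
  have h1 : ContinuousAt (fun t : ℝ => min 1 (2 * |t - k| / η)) t := by fun_prop
  have h2 : ContinuousAt (armCoord α δ r φ) (min 1 (2 * |t - k| / η)) :=
    (exists_hasDerivAt_armCoord h.pos hα hδ φ hu).1.continuousAt
  exact ContinuousAt.comp (g := fun y => S.reg (p y))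
    (h.continuousAt_reg (armCoord_mem_strip h.pos hα hδ hr φ hu))
    (ContinuousAt.comp (g := armCoord α δ r φ) h2 h1)

variable [Nonempty M]

/-- Replacing the part of a curve in `{radius < r}` by arms of a star. -/
theorem exists_surgery (h : PolarChart S i p H α) (hα : α < 2 * Real.pi)
    (hδ : δ ∈ Ioo (0 : ℝ) 1) (hr : r ∈ Ioo (0 : ℝ) 1) {τ : ℝ} (hτ : 0 ≤ τ)
    (hH : ∀ y ∈ strip, y.1 ≤ r → H y ≤ 1 + τ) {c : ℝ → S.Completion} (hc : S.IsCurve c)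
    {F : Set ℝ} (hF : F.Finite) (hFc : ∀ t ∈ Ioo (0 : ℝ) 1 \ F,
      c t ∈ range S.reg ∧ ContMDiffAt 𝓘(ℝ, ℝ) (𝓡∂ 2) 1 (S.toReg ∘ c) t)
    {K : Finset ℝ} (hK : ∀ t, t ∈ K ↔ t ∈ S.coneTimes i c F ∧ S.radius i (c t) = r)
    (hd : ∀ k ∈ K, deriv (fun t => S.radius i (c t)) k ≠ 0)
    (hlev : ∀ t ∈ Icc (0 : ℝ) 1, S.radius i (c t) = r → t ∈ K)
    (hout : ∃ t ∈ Icc (0 : ℝ) 1, r ≤ S.radius i (c t)) {φ : ℝ → ℝ}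
    (hφ : ∀ k ∈ K, c k = S.reg (p (r, φ k))) :
    ∃ c', S.IsCurve c' ∧
      (∀ z, z ∈ c' '' Icc 0 1 ↔ (r ≤ S.radius i z ∧ z ∈ c '' Icc 0 1) ∨
        ∃ k ∈ K, ∃ u ∈ Icc (0 : ℝ) 1, z = S.reg (p (armCoord α δ r (φ k) u))) ∧
      S.curveLength c' ≤ (∫⁻ t in Ioo 0 1 ∩ {t | r ≤ S.radius i (c t)}, S.speed c t) +
        ∑ k ∈ K, ENNReal.ofReal (armLength α δ r τ (φ k)) := by
  have hα0 := h.pos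
  obtain ⟨σ, η, hη, hσ, hside, hsep⟩ := exists_crossing_radius
    (h.isOpen_coneTimes hF hc.continuousOn) (fun k hk => ((hK k).1 hk).1)
    (f := fun t => S.radius i (c t)) (fun k hk => ((hK k).1 hk).2) hd
  set f : ℝ → ℝ := fun t => S.radius i (c t) with hf
  set c' := S.surgery i p α δ r η K φ c with hc'
  have hfc : ContinuousOn f (Icc 0 1) := h.continuous_radius.comp_continuousOn hc.continuousOn
  have hle : ∀ t, r ≤ f t → c' t = c t := fun t ht => surgery_of_le ht
  have hnear : ∀ t k, f t < r → k ∈ K → |t - k| < η →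
      c' t = S.reg (p (armCoord α δ r (φ k) (min 1 (2 * |t - k| / η)))) :=
    fun t k ht hk htk => surgery_of_near hsep ht hk htk
  have hfar : ∀ t, f t < r → (∀ k ∈ K, η / 2 ≤ |t - k|) → c' t = S.reg (p (r * δ, 0)) :=
    fun t ht hk => surgery_of_far hδ.1 hη hsep ht hk
  have harm0 : ∀ k ∈ K, S.reg (p (armCoord α δ r (φ k) 0)) = c k := fun k hk => by
    rw [armCoord_zero hα0 hα, h.apply_sign_mul_dist hr, hφ k hk]
  have harm1 : ∀ k, S.reg (p (armCoord α δ r (φ k) 1)) = S.reg (p (r * δ, 0)) := fun k => by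
    rw [armCoord_one hδ.1]
  have hK01 : ∀ k ∈ K, ∀ t, |t - k| < η → t ∈ Ioo (0 : ℝ) 1 := fun k hk t ht =>
    (hside k hk t ht).1.1.1
  -- continuity
  have hcont : ContinuousOn c' (Icc 0 1) := by
    intro t ht
    rcases lt_trichotomy (f t) r with hlt | heq | hgt
    · have hev : ∀ᶠ s in 𝓝[Icc 0 1] t, f s < r := (hfc t ht).eventually (gt_mem_nhds hlt)
      by_cases hk : ∃ k ∈ K, |t - k| < η
      · obtain ⟨k, hkK, htk⟩ := hk
        refine ((h.continuous_arm hα hδ hr (φ k) k η hη).continuousWithinAt).congr_of_eventuallyEq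
          ?_ (hnear t k hlt hkK htk)
        have h2 : ∀ᶠ s in 𝓝 t, |s - k| < η :=
          (continuous_abs.comp (continuous_sub_right k)).continuousAt.eventually
            (gt_mem_nhds htk)
        filter_upwards [hev, mem_nhdsWithin_of_mem_nhds h2] with s hs hs2 using hnear s k hs hkK hs2
      · push Not at hk
        have h2 : ∀ᶠ s in 𝓝 t, ∀ k ∈ K, η / 2 < |s - k| := (K.eventually_all).2 fun k hk' =>
          (continuous_abs.comp (continuous_sub_right k)).continuousAt.eventually
            (lt_mem_nhds (by have := hk k hk'; simp only [Function.comp_apply]; linarith))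
        refine (continuousWithinAt_const (b := S.reg (p (r * δ, 0)))).congr_of_eventuallyEq
          ?_ (hfar t hlt fun k hk' => by linarith [hk k hk'])
        filter_upwards [hev, mem_nhdsWithin_of_mem_nhds h2] with s hs hs2 using
          hfar s hs fun k hk => (hs2 k hk).le
    -- Every time at the level is a crossing, and there the old curve and the arm at `u = 0` have
    -- the same value.
    · have htK := hlev t ht heq
      have ht01 : t ∈ Ioo (0 : ℝ) 1 := hK01 t htK t (by simpa using hη)
      have hct : ContinuousAt c t := hc.continuousOn.continuousAt (Icc_mem_nhds ht01.1 ht01.2)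
      have harm := (h.continuous_arm hα hδ hr (φ t) t η hη).continuousAt (x := t)
      classical
      have h1 := continuousAt_ite (C := fun s => r ≤ f s) hct harm
        (Or.inl (by simp [harm0 t htK]))
      refine (h1.congr ?_).continuousWithinAt
      have h2 : ∀ᶠ s in 𝓝 t, |s - t| < η :=
        (continuous_abs.comp (continuous_sub_right t)).continuousAt.eventually
          (gt_mem_nhds (by simpa using hη))
      filter_upwards [h2] with s hs
      split_ifs with hrs
      · exact (hle s hrs).symm
      · exact (hnear s t (not_le.1 hrs) htK hs).symm
    · have hev : ∀ᶠ s in 𝓝[Icc 0 1] t, r < f s := (hfc t ht).eventually (lt_mem_nhds hgt)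
      refine (hc.continuousOn t ht).congr_of_eventuallyEq ?_ (hle t hgt.le)
      filter_upwards [hev] with s hs using hle s hs.le
  -- the exceptional parameters
  set F' : Set ℝ := F ∪ (K ∪ ((fun k => k + η / 2) '' K ∪ (fun k => k - η / 2) '' K)) with hF'
  have hF'f : F'.Finite := hF.union (K.finite_toSet.union
    ((K.finite_toSet.image _).union (K.finite_toSet.image _)))
  -- The times spent on an arm: the lower side of the crossing, up to distance `η/2`. With speed at
  -- most `2/η` times `armLength`, each arm contributes at most its length.
  set A : ℝ → Set ℝ := fun k => {t | 0 < σ k * (t - k) ∧ |t - k| < η / 2} with hA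
  have hmain : ∀ t ∈ Ioo (0 : ℝ) 1 \ F',
      (c' t ∈ range S.reg ∧ ContMDiffAt 𝓘(ℝ, ℝ) (𝓡∂ 2) 1 (S.toReg ∘ c') t) ∧
      S.speed c' t ≤ ({t | r ≤ f t}.indicator (S.speed c) t) +
        ∑ k ∈ K, (A k).indicator
          (fun _ => ENNReal.ofReal (2 / η * armLength α δ r τ (φ k))) t := by
    rintro t ⟨ht, htF⟩
    have htF1 : t ∉ F := fun hh => htF (Or.inl hh)
    have htK : t ∉ K := fun hh => htF (Or.inr (Or.inl hh))
    have htη : ∀ k ∈ K, |t - k| ≠ η / 2 := by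
      intro k hk hh
      refine htF (Or.inr (Or.inr ?_))
      rcases abs_eq (by positivity) |>.1 hh with h1 | h1
      · exact Or.inl ⟨k, hk, by simp only; linarith⟩
      · exact Or.inr ⟨k, hk, by simp only; linarith⟩
    have hnhds : Icc (0 : ℝ) 1 ∈ 𝓝 t := Icc_mem_nhds ht.1 ht.2
    have hft : ContinuousAt f t := hfc.continuousAt hnhds
    rcases lt_trichotomy (f t) r with hlt | heq | hgt
    · have hev : ∀ᶠ s in 𝓝 t, f s < r := hft.eventually (gt_mem_nhds hlt)
      by_cases hk : ∃ k ∈ K, |t - k| < η / 2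
      · obtain ⟨k, hkK, htk⟩ := hk
        have hne : t ≠ k := fun hh => htK (hh ▸ hkK)
        have h2 : ∀ᶠ s in 𝓝 t, |s - k| < η / 2 :=
          (continuous_abs.comp (continuous_sub_right k)).continuousAt.eventually
            (gt_mem_nhds htk)
        have hmin : ∀ s, |s - k| < η / 2 → min 1 (2 * |s - k| / η) = 2 * |s - k| / η :=
          fun s hs => min_eq_right (by rw [div_le_one hη]; linarith)
        have h3 := h.speed_arm hα hδ hr hτ hH (φ k) hη hne htk (c := c') (by
          filter_upwards [hev, h2] with s hs hs2
          rw [hnear s k hs hkK (by linarith), hmin s hs2])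
        refine ⟨⟨⟨_, (hnear t k hlt hkK (by linarith)).symm⟩, h3.1⟩, ?_⟩
        have htA : t ∈ A k := ⟨((hside k hkK t (by linarith)).2 hne).2.1 hlt, htk⟩
        refine h3.2.trans (le_add_left ?_)
        refine le_trans ?_ (Finset.single_le_sum (f := fun k => (A k).indicator
          (fun _ => ENNReal.ofReal (2 / η * armLength α δ r τ (φ k))) t)
          (fun _ _ => zero_le) hkK)
        simp only [indicator_of_mem htA]
        exact le_rfl
      · push Not at hk
        have h2 : ∀ᶠ s in 𝓝 t, ∀ k ∈ K, η / 2 < |s - k| := (K.eventually_all).2 fun k hk' =>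
          (continuous_abs.comp (continuous_sub_right k)).continuousAt.eventually
            (lt_mem_nhds (lt_of_le_of_ne (hk k hk') (Ne.symm (htη k hk'))))
        have hev2 : c' =ᶠ[𝓝 t] fun _ => S.reg (p (r * δ, 0)) := by
          filter_upwards [hev, h2] with s hs hs2 using hfar s hs fun k hk => (hs2 k hk).le
        refine ⟨⟨⟨_, hev2.self_of_nhds.symm⟩, ?_⟩, ?_⟩
        · refine (contMDiffAt_const (c := p (r * δ, 0))).congr_of_eventuallyEq ?_
          filter_upwards [hev2] with s hs
          rw [Function.comp_apply, hs, S.toReg_reg]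
        · rw [S.speed_congr hev2, speed_const]
          exact zero_le
    · exact absurd (hlev t (Ioo_subset_Icc_self ht) heq) htK
    · have hev : c' =ᶠ[𝓝 t] c := by
        filter_upwards [hft.eventually (lt_mem_nhds hgt)] with s hs using hle s (le_of_lt hs)
      refine ⟨⟨?_, ?_⟩, ?_⟩
      · rw [hle t hgt.le]; exact (hFc t ⟨ht, htF1⟩).1
      · refine (hFc t ⟨ht, htF1⟩).2.congr_of_eventuallyEq ?_
        filter_upwards [hev] with s hs
        rw [Function.comp_apply, hs, Function.comp_apply]
      · rw [S.speed_congr hev, indicator_of_mem (show t ∈ {t | r ≤ f t} from hgt.le)]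
        exact le_self_add
  -- the length
  have hlen : S.curveLength c' ≤ (∫⁻ t in Ioo 0 1 ∩ {t | r ≤ f t}, S.speed c t) +
        ∑ k ∈ K, ENNReal.ofReal (armLength α δ r τ (φ k)) := by
    have hmeasAll : ∀ k, MeasurableSet (A k) := fun k => (volume_side (hσ k)).1
    have hfm : MeasurableSet (Ioo (0 : ℝ) 1 ∩ {t | r ≤ f t}) :=
      measurableSet_inter_preimage_of_continuousOn (hfc.mono Ioo_subset_Icc_self) measurableSet_Ioo
        (measurableSet_Ici (a := r))
    rw [S.curveLength_eq]
    calc ∫⁻ t in Ioo 0 1, S.speed c' t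
        ≤ ∫⁻ t in Ioo 0 1, ({t | r ≤ f t}.indicator (S.speed c) t) +
          ∑ k ∈ K, (A k).indicator
            (fun _ => ENNReal.ofReal (2 / η * armLength α δ r τ (φ k))) t := by
          refine setLIntegral_mono_ae' measurableSet_Ioo ?_
          have : ∀ᵐ t : ℝ, t ∉ F' := measure_eq_zero_iff_ae_notMem.1 (hF'f.measure_zero volume)
          filter_upwards [this] with t ht ht01 using (hmain t ⟨ht01, ht⟩).2
      _ = (∫⁻ t in Ioo 0 1, {t | r ≤ f t}.indicator (S.speed c) t) +
          ∫⁻ t in Ioo 0 1, ∑ k ∈ K, (A k).indicator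
            (fun _ => ENNReal.ofReal (2 / η * armLength α δ r τ (φ k))) t :=
          lintegral_add_right _ (Finset.measurable_sum _ fun k _ =>
            measurable_const.indicator (hmeasAll k))
      _ ≤ _ := by
          refine add_le_add ?_ ?_
          · have h1 : ∀ t ∈ Ioo (0 : ℝ) 1, {t | r ≤ f t}.indicator (S.speed c) t =
                (Ioo (0 : ℝ) 1 ∩ {t | r ≤ f t}).indicator (S.speed c) t := by
              intro t ht
              by_cases hrt : r ≤ f t
              · rw [indicator_of_mem (show t ∈ {t | r ≤ f t} from hrt),
                  indicator_of_mem (show t ∈ Ioo (0 : ℝ) 1 ∩ {t | r ≤ f t} from ⟨ht, hrt⟩)]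
              · rw [indicator_of_notMem (show t ∉ {t | r ≤ f t} from hrt),
                  indicator_of_notMem (fun hh => hrt hh.2)]
            rw [setLIntegral_congr_fun measurableSet_Ioo h1, lintegral_indicator hfm,
              Measure.restrict_restrict hfm]
            exact lintegral_mono_set inter_subset_left
          · rw [lintegral_finsetSum _ fun k _ => measurable_const.indicator (hmeasAll k)]
            refine Finset.sum_le_sum fun k _ => ?_
            rw [lintegral_indicator (hmeasAll k), lintegral_const]
            have hv : (volume.restrict (Ioo (0 : ℝ) 1)).restrict (A k) univ ≤
                ENNReal.ofReal (η / 2) := by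
              rw [Measure.restrict_apply_univ]
              refine (Measure.restrict_apply_le _ _).trans ?_
              exact (volume_side (hσ k)).2.le
            refine (mul_le_mul_right hv _).trans ?_
            rw [← ENNReal.ofReal_mul' (by positivity)]
            refine ENNReal.ofReal_le_ofReal (le_of_eq ?_)
            field_simp
  -- an alternative
  have hempty : K = ∅ → ∀ t ∈ Icc (0 : ℝ) 1, r < f t := by
    intro hK0 t ht
    by_contra hcon
    push Not at hcon
    obtain ⟨t₁, ht₁, hrt⟩ := hout
    obtain ⟨s, hs, hsr⟩ := isPreconnected_Icc.intermediate_value ht ht₁ hfc ⟨hcon, hrt⟩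
    have := hlev s hs hsr
    rw [hK0] at this
    exact absurd this (Finset.notMem_empty _)
  have hend : ∀ t : ℝ, t = 0 ∨ t = 1 → ∀ k ∈ K, η ≤ |t - k| := by
    intro t ht k hk
    by_contra hcon
    push Not at hcon
    have := hK01 k hk t hcon
    rcases ht with rfl | rfl
    · exact lt_irrefl _ this.1
    · exact lt_irrefl _ this.2
  -- The point `u` of an arm is attained at `k + σ k · ηu/2`, which is on the side of `k` where the
  -- old curve is below the level.
  have hstep : ∀ k ∈ K, ∀ u : ℝ, u ∈ Ioc (0 : ℝ) 1 → ∃ t ∈ Icc (0 : ℝ) 1,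
      c' t = S.reg (p (armCoord α δ r (φ k) u)) := by
    intro k hk u hu
    have hσ2 : σ k * σ k = 1 := by rcases hσ k with h1 | h1 <;> rw [h1] <;> norm_num
    have habs : |σ k| = 1 := by rcases hσ k with h1 | h1 <;> rw [h1] <;> norm_num
    have hu2 : 0 < η * u / 2 := by have := hu.1; positivity
    have hta : |k + σ k * (η * u / 2) - k| = η * u / 2 := by
      rw [add_sub_cancel_left, abs_mul, habs, one_mul, abs_of_pos hu2]
    have hlt : |k + σ k * (η * u / 2) - k| < η := by rw [hta]; nlinarith [hu.2]
    have h1 := hside k hk _ hlt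
    have hne : k + σ k * (η * u / 2) ≠ k := by
      intro hh; rw [hh] at hta; simp at hta; linarith
    have hflt : f (k + σ k * (η * u / 2)) < r := by
      rw [(h1.2 hne).2]
      rw [add_sub_cancel_left, ← mul_assoc, hσ2, one_mul]; exact hu2
    refine ⟨_, Ioo_subset_Icc_self (hK01 k hk _ hlt), ?_⟩
    rw [hnear _ k hflt hk hlt, hta]
    congr 3
    rw [show 2 * (η * u / 2) / η = u by field_simp]
    exact min_eq_right hu.2
  refine ⟨c', ⟨hcont, ⟨F', hF'f, fun t ht => (hmain t ht).1⟩, ?_, ?_, ?_⟩, ?_, hlen⟩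
  · refine hlen.trans_lt (ENNReal.add_lt_top.2 ⟨?_, ENNReal.sum_lt_top.2 fun _ _ =>
      ENNReal.ofReal_lt_top⟩)
    refine (lintegral_mono_set inter_subset_left).trans_lt ?_
    rw [← S.curveLength_eq]
    exact hc.length_lt_top
  -- Without crossings the curve is unchanged. Otherwise it passes through a crossing of radius `r`
  -- and through the vertex, whose radius is smaller.
  · rcases K.eq_empty_or_nonempty with hK0 | ⟨k, hk⟩
    · obtain ⟨t, ht, hne⟩ := hc.nonconstant
      refine ⟨t, ht, ?_⟩
      rwa [hle t (hempty hK0 t ht).le, hle 0 (hempty hK0 0 ⟨le_rfl, zero_le_one⟩).le]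
    · by_contra hcon
      push Not at hcon
      obtain ⟨t, ht, htc⟩ := hstep k hk 1 ⟨one_pos, le_rfl⟩
      have hfk : f k = r := ((hK k).1 hk).2
      have h1 := hcon k (Ioo_subset_Icc_self (hK01 k hk k (by simpa using hη)))
      rw [← hcon t ht, htc, hle k hfk.ge] at h1
      have h2 := congrArg (S.radius i) h1
      rw [show S.radius i (c k) = r from hfk, h.radius_apply
        (armCoord_mem_strip hα0 hα hδ hr _ ⟨zero_le_one, le_rfl⟩)] at h2
      exact (armCoord_fst_lt hδ hr.1 (φ k) ⟨one_pos, le_rfl⟩).ne h2.symm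
  · rcases hc.closed_or_boundary with h01 | ⟨h0, h1⟩
    · left
      have hf01 : f 0 = f 1 := by simp only [hf, h01]
      rcases le_or_gt r (f 0) with h2 | h2
      · rw [hle 0 h2, hle 1 (hf01 ▸ h2), h01]
      -- A closed component whose base point is inside the ball now starts and ends at the vertex,
      -- because `0` and `1` are at distance at least `η` from all crossings.
      · rw [hfar 0 h2 fun k hk => by linarith [hend 0 (Or.inl rfl) k hk],
          hfar 1 (hf01 ▸ h2) fun k hk => by linarith [hend 1 (Or.inr rfl) k hk]]
    · right
      rw [hle 0 (by rw [show f 0 = 1 from h.notMem_boundary h0]; exact hr.2.le),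
        hle 1 (by rw [show f 1 = 1 from h.notMem_boundary h1]; exact hr.2.le)]
      exact ⟨h0, h1⟩
  · intro z
    constructor
    · rintro ⟨t, ht, rfl⟩
      rcases le_or_gt r (f t) with h1 | h1
      · rw [hle t h1]
        exact Or.inl ⟨h1, t, ht, rfl⟩
      · right
        by_cases hk : ∃ k ∈ K, |t - k| < η
        · obtain ⟨k, hkK, htk⟩ := hk
          exact ⟨k, hkK, _, ⟨le_min zero_le_one (by positivity), min_le_left _ _⟩,
            hnear t k h1 hkK htk⟩
        · push Not at hk
          rcases K.eq_empty_or_nonempty with hK0 | ⟨k, hkK⟩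
          · exact absurd h1 (hempty hK0 t ht).not_gt
          · exact ⟨k, hkK, 1, ⟨zero_le_one, le_rfl⟩, by
              rw [harm1, hfar t h1 fun k hk' => by linarith [hk k hk']]⟩
    · rintro (⟨hz, t, ht, rfl⟩ | ⟨k, hk, u, hu, rfl⟩)
      · exact ⟨t, ht, hle t hz⟩
      · rcases hu.1.eq_or_lt with rfl | hu0
        · refine ⟨k, Ioo_subset_Icc_self (hK01 k hk k (by simpa using hη)), ?_⟩
          rw [harm0 k hk, hle k ((hK k).1 hk).2.ge]
        · exact hstep k hk u ⟨hu0, hu.2⟩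

end PolarChart
end ConicalSurface
end

/-! ### A good direction for the vertex, and rotation of polar coordinates. -/

noncomputable section
namespace ConicalSurface

lemma countable_circDist_eq {α : ℝ} (hα : 0 < α) (b φ : ℝ) :
    {x : ℝ | circDist α (φ - x) = b}.Countable := by
  refine ((countable_range fun k : ℤ => φ - b - k * α).union
    (countable_range fun k : ℤ => φ + b - k * α)).mono fun x hx => ?_
  obtain ⟨k, hk⟩ := exists_eq_sign_mul_dist hα (φ - x)
  rw [mem_ofPred_eq] at hx
  rw [hx] at hk
  rcases circSign_eq α (φ - x) with h1 | h1 <;> rw [h1] at hk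
  · exact Or.inl ⟨k, by simp only; linarith⟩
  · exact Or.inr ⟨k, by simp only; linarith⟩

/-- By periodicity the integral can be taken over `[-α/2, α/2]`, where the distance is `|x|`. Its
positivity for `α < 2π` is the source of the gain in length. -/
lemma integral_cos_circDist {α : ℝ} (hα : 0 < α) (φ : ℝ) :
    ∫ x in (0 : ℝ)..α, Real.cos (circDist α (φ - x)) = 2 * Real.sin (α / 2) := by
  have hper : Function.Periodic (fun x => Real.cos (circDist α x)) α := fun x => by
    have := circDist_add_int_mul α x 1
    simp only [Int.cast_one, one_mul] at this
    simp only [this]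
  rw [intervalIntegral.integral_comp_sub_left (fun x => Real.cos (circDist α x)) φ]
  have h1 := hper.intervalIntegral_add_eq (φ - α) (-(α / 2))
  rw [show φ - α + α = φ - 0 by ring, show -(α / 2) + α = α / 2 by ring] at h1
  rw [h1]
  have h2 : ∫ x in (-(α / 2))..(α / 2), Real.cos (circDist α x) =
      ∫ x in (-(α / 2))..(α / 2), Real.cos x := by
    refine intervalIntegral.integral_congr fun x hx => ?_
    rw [uIcc_of_le (by linarith)] at hx
    simp only [circDist_of_abs_le hα (abs_le.2 hx), Real.cos_abs]
  rw [h2, integral_cos, Real.sin_neg]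
  ring

/-- Among finitely many directions in a cone there is one, not opposite to any of them, with which
they make acute angles on average. -/
lemma exists_direction {α : ℝ} (hα : 0 < α) {J : Type*} [Fintype J] (φ : J → ℝ) :
    ∃ φ₀, (∀ j, circDist α (φ j - φ₀) < α / 2) ∧
      Fintype.card J * (2 * Real.sin (α / 2) / α) ≤ ∑ j, Real.cos (circDist α (φ j - φ₀)) := by
  have hcont : Continuous fun x => ∑ j, Real.cos (circDist α (φ j - x)) := by
    have := continuous_circDist α
    fun_prop
  have hN : volume.restrict (Ioc 0 α) (⋃ j, {x : ℝ | circDist α (φ j - x) = α / 2}) = 0 := by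
    refine le_antisymm ((Measure.restrict_apply_le _ _).trans_eq ?_) zero_le
    exact (countable_iUnion fun j => countable_circDist_eq hα (α / 2) (φ j)).measure_zero volume
  have hint : IntervalIntegrable (fun x => ∑ j, Real.cos (circDist α (φ j - x))) volume 0 α :=
    hcont.intervalIntegrable _ _
  -- Outside a given null set, here the directions opposite to some `φ j`, a function still takes a
  -- value at least its mean.
  obtain ⟨x, hx, hav⟩ := exists_notMem_null_average_le (μ := volume.restrict (Ioc 0 α))
    (by
      intro h0
      have := congrArg (fun μ : Measure ℝ => μ univ) h0
      simp at this
      linarith)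
    ((intervalIntegrable_iff_integrableOn_Ioc_of_le hα.le).1 hint) hN
  refine ⟨x, fun j => lt_of_le_of_ne (circDist_le hα _) fun he => hx (mem_iUnion.2 ⟨j, he⟩), ?_⟩
  refine le_trans (le_of_eq ?_) hav
  rw [average_eq, ← intervalIntegral.integral_of_le hα.le,
    intervalIntegral.integral_finsetSum fun j _ => ?_]
  · simp only [integral_cos_circDist hα]
    rw [Finset.sum_const, Finset.card_univ]
    simp [hα.le]
    ring
  · refine Continuous.intervalIntegrable ?_ _ _
    have := continuous_circDist α
    fun_prop

variable {M : Type*} [TopologicalSpace M] [ChartedSpace (EuclideanHalfSpace 2) M]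
  [IsManifold (𝓡∂ 2) ∞ M]
  [RiemannianBundle (fun x : M => TangentSpace (𝓡∂ 2) x)] {ι : Type*}

namespace PolarChart

variable {S : ConicalSurface M ι} {i : ι} {p : ℝ × ℝ → M} {H : ℝ × ℝ → ℝ} {α δ r : ℝ}

/-- Polar coordinates with another origin of the angle. -/
lemma rotate (h : PolarChart S i p H α) (φ₀ : ℝ) :
    PolarChart S i (fun y => p (y.1, y.2 + φ₀)) (fun y => H (y.1, y.2 + φ₀)) α := by
  set T : ℝ × ℝ → ℝ × ℝ := fun y => (y.1, y.2 + φ₀) with hT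
  have hTm : MapsTo T (Ioo 0 1 ×ˢ univ) (Ioo 0 1 ×ˢ univ) := fun y hy => ⟨hy.1, trivial⟩
  have hTC : ContDiff ℝ 1 T := contDiff_fst.prodMk (contDiff_snd.add contDiff_const)
  have hTd : ∀ y, HasFDerivAt T (ContinuousLinearMap.id ℝ (ℝ × ℝ)) y := by
    intro y
    have h1 : T = fun y => y + (0, φ₀) := by ext y <;> simp [hT]
    rw [h1]
    exact (hasFDerivAt_id y).add_const _
  have hder : ∀ r ∈ Ioo (0 : ℝ) 1, ∀ φ : ℝ, ∀ v : ℝ × ℝ,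
      mfderiv 𝓘(ℝ, ℝ × ℝ) (𝓡∂ 2) (fun y => p (T y)) (r, φ) v =
        mfderiv 𝓘(ℝ, ℝ × ℝ) (𝓡∂ 2) p (r, φ + φ₀) v := by
    intro r hr φ v
    have h1 := mfderiv_comp (I := 𝓘(ℝ, ℝ × ℝ)) (I' := 𝓘(ℝ, ℝ × ℝ)) (I'' := 𝓡∂ 2) (r, φ)
      (f := T) (g := p) (h.mdifferentiableAt (y := T (r, φ)) (mem_strip.2 hr))
      (hTd (r, φ)).differentiableAt.mdifferentiableAt
    have h2 : mfderiv 𝓘(ℝ, ℝ × ℝ) 𝓘(ℝ, ℝ × ℝ) T (r, φ) = ContinuousLinearMap.id ℝ (ℝ × ℝ) := by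
      rw [mfderiv_eq_fderiv]; exact (hTd (r, φ)).fderiv
    rw [h2] at h1
    exact congrArg (fun L => (L : ℝ × ℝ →L[ℝ] _) v) h1
  refine ⟨h.pos, ?_, fun r hr φ => h.interior r hr _, ?_, ?_, ?_, fun r hr φ => h.cross_pos r hr _,
    ?_, ?_, ?_, ?_⟩
  · exact h.smooth.comp (contMDiff_iff_contDiff.2 hTC).contMDiffOn hTm
  · intro r hr r' hr' φ φ'
    rw [h.eq_iff r hr r' hr']
    refine and_congr_right fun _ => exists_congr fun k => ?_
    constructor <;> intro hh <;> linarith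
  · intro r hr
    rw [← h.range_eq r hr]
    exact (Equiv.addRight φ₀).surjective.range_comp (fun φ => p (r, φ))
  · exact h.cross_contDiffOn.comp hTC.contDiffOn hTm
  · intro r hr φ
    have := h.inner_radial_radial r hr (φ + φ₀)
    rw [hder r hr φ]
    exact this
  · intro r hr φ
    have := h.inner_radial_angular r hr (φ + φ₀)
    rw [hder r hr φ, hder r hr φ]
    exact this
  · intro r hr φ
    have := h.inner_angular_angular r hr (φ + φ₀)
    rw [hder r hr φ]
    exact this
  · intro η hη
    obtain ⟨s, hs, hs'⟩ := h.cross_tendsto η hη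
    exact ⟨s, hs, fun r hr φ => hs' r hr _⟩

end PolarChart
end ConicalSurface
end

/-! ### Gain in length of a star and the star competitor. -/

noncomputable section
namespace ConicalSurface

variable {M : Type*} [TopologicalSpace M] [ChartedSpace (EuclideanHalfSpace 2) M]
  [IsManifold (𝓡∂ 2) ∞ M]
  [RiemannianBundle (fun x : M => TangentSpace (𝓡∂ 2) x)] {ι : Type*}

/-- The relative gain of a star over a curve through the tip of a cone of angle `α`. -/
def starGain (α : ℝ) : ℝ := (2 * Real.sin (α / 2) / α) ^ 2 / 4

/-- This is the distance `δ` of the vertex from the tip for `r = 1`. If `c` is the mean cosine, then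
`δ = c` minimizes the bound `1 + δ²/2 - cδ` for the mean length of the arms. Positivity uses `α/2 <
π`. -/
lemma starDist_mem {α : ℝ} (hα0 : 0 < α) (hα : α < 2 * Real.pi) :
    2 * Real.sin (α / 2) / α ∈ Ioo (0 : ℝ) 1 := by
  have h1 := Real.sin_pos_of_pos_of_lt_pi (half_pos hα0) (by linarith)
  have h2 := Real.sin_lt (half_pos hα0)
  exact ⟨by positivity, by rw [div_lt_one hα0]; linarith⟩

lemma starGain_pos {α : ℝ} (hα0 : 0 < α) (hα : α < 2 * Real.pi) : 0 < starGain α := by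
  have := (starDist_mem hα0 hα).1
  unfold starGain
  positivity

lemma armLength_nonneg {α δ r τ φ : ℝ} (hr : 0 ≤ r) : 0 ≤ armLength α δ r τ φ := by
  unfold armLength; positivity

/-- The arms of a star with a good direction are shorter than the corresponding radii. -/
lemma sum_armLength_le {α r : ℝ} (hα0 : 0 < α) (hα : α < 2 * Real.pi) (hr : 0 ≤ r) {J : Type*}
    [Fintype J] {φ : J → ℝ}
    (hφ : Fintype.card J * (2 * Real.sin (α / 2) / α) ≤ ∑ j, Real.cos (circDist α (φ j))) :
    ∑ j, armLength α (2 * Real.sin (α / 2) / α) r (2 * starGain α) (φ j) +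
      starGain α * (r * Fintype.card J) ≤ r * Fintype.card J := by
  set c := 2 * Real.sin (α / 2) / α with hc
  have hc01 := starDist_mem hα0 hα
  rw [← hc] at hc01
  have hg : starGain α = c ^ 2 / 4 := rfl
  -- Both square roots are bounded by `√(1 + x) ≤ 1 + x/2`. Summation with mean cosine at least `c`
  -- then leaves the factor `(1 + c²/4)(1 - c²/2) = 1 - c²/4 - c⁴/8`.
  have h1 : ∀ j, armLength α c r (2 * starGain α) (φ j) ≤
      r * (1 + c ^ 2 / 4) * (1 + c ^ 2 / 2 - c * Real.cos (circDist α (φ j))) := by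
    intro j
    unfold armLength
    have e1 : Real.sqrt (1 + 2 * starGain α) ≤ 1 + c ^ 2 / 4 := by
      rw [hg]
      refine Real.sqrt_le_iff.2 ⟨by positivity, by nlinarith [sq_nonneg (c ^ 2)]⟩
    have hcos := Real.cos_le_one (circDist α (φ j))
    have e3 : 0 ≤ 1 + c ^ 2 / 2 - c * Real.cos (circDist α (φ j)) := by
      nlinarith [hc01.1, hc01.2, sq_nonneg c]
    have e2 : Real.sqrt (1 - 2 * c * Real.cos (circDist α (φ j)) + c ^ 2) ≤
        1 + c ^ 2 / 2 - c * Real.cos (circDist α (φ j)) := by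
      refine Real.sqrt_le_iff.2 ⟨e3, ?_⟩
      nlinarith [sq_nonneg (c ^ 2 / 2 - c * Real.cos (circDist α (φ j)))]
    exact mul_le_mul (mul_le_mul_of_nonneg_left e1 hr) e2 (Real.sqrt_nonneg _) (by positivity)
  have h2 : ∑ j, armLength α c r (2 * starGain α) (φ j) ≤
      r * (1 + c ^ 2 / 4) * (Fintype.card J * (1 + c ^ 2 / 2) -
        c * ∑ j, Real.cos (circDist α (φ j))) := by
    refine (Finset.sum_le_sum fun j _ => h1 j).trans (le_of_eq ?_)
    rw [← Finset.mul_sum, Finset.sum_sub_distrib, ← Finset.mul_sum, Finset.sum_const,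
      Finset.card_univ, nsmul_eq_mul]
  have h3 : r * (1 + c ^ 2 / 4) * (Fintype.card J * (1 + c ^ 2 / 2) -
        c * ∑ j, Real.cos (circDist α (φ j))) ≤
      r * (1 + c ^ 2 / 4) * (Fintype.card J * (1 - c ^ 2 / 2)) := by
    refine mul_le_mul_of_nonneg_left ?_ (by positivity)
    nlinarith [mul_le_mul_of_nonneg_left hφ hc01.1.le]
  have h4 : 0 ≤ r * Fintype.card J * (c ^ 4 / 8) := by positivity
  have h5 : r * (1 + c ^ 2 / 4) * (Fintype.card J * (1 - c ^ 2 / 2)) =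
      r * Fintype.card J - c ^ 2 / 4 * (r * Fintype.card J) -
        r * Fintype.card J * (c ^ 4 / 8) := by ring
  rw [hg] at h2 ⊢
  linarith

namespace PolarChart

variable {S : ConicalSurface M ι} {i : ι} {p : ℝ × ℝ → M} {H : ℝ × ℝ → ℝ} {α δ r : ℝ}
variable [Nonempty M] [T1Space M]

/-- A curve through the tip of a cone of angle less than `2π` can be shortened near the tip, in such
a way that it divides the surface into parts that are the same as before away from the tip. -/
theorem exists_star_competitor (h : PolarChart S i p H α) (hα : α < 2 * Real.pi) {n : ℕ}
    {γ : Fin n → ℝ → S.Completion} (hγ : ∀ j, S.IsCurve (γ j)) (htip : S.tip i ∈ S.trace γ)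
    {U V : Set S.Completion} (hU : IsOpen U) (hV : IsOpen V) (hUV : Disjoint U V)
    (hUVt : U ∪ V = (S.trace γ)ᶜ) {ε : ℝ} (hε : 0 < ε) :
    ∃ r ∈ Ioo 0 ε, ∃ γ' : Fin n → ℝ → S.Completion, ∃ U' V' : Set S.Completion,
      (∀ j, S.IsCurve (γ' j)) ∧ IsOpen U' ∧ IsOpen V' ∧ Disjoint U' V' ∧
      U' ∪ V' = (S.trace γ')ᶜ ∧
      (∀ z, r ≤ S.radius i z → ((z ∈ U' ↔ z ∈ U) ∧ (z ∈ V' ↔ z ∈ V))) ∧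
      (∀ z ∈ U', S.radius i z < r → ∃ w ∈ U, S.radius i w = r) ∧
      (∀ z ∈ V', S.radius i z < r → ∃ w ∈ V, S.radius i w = r) ∧
      S.length γ' + ENNReal.ofReal (starGain α * r) ≤ S.length γ := by
  have hα0 := h.pos
  choose F hF hFc using fun j => (hγ j).piecewise_contMDiff
  set f : Fin n → ℝ → ℝ := fun j t => S.radius i (γ j t) with hf
  set δ := 2 * Real.sin (α / 2) / α with hδdef
  have hδ : δ ∈ Ioo (0 : ℝ) 1 := starDist_mem hα0 hα
  have hgain := starGain_pos hα0 hα
  obtain ⟨s, hs, hsH⟩ := h.cross_tendsto (2 * starGain α) (by linarith)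
  have hfc : ∀ j, ContinuousOn (f j) (Icc 0 1) := fun j =>
    h.continuous_radius.comp_continuousOn (hγ j).continuousOn
  -- each component leaves the tip
  have hleave : ∀ j, ∃ t ∈ Icc (0 : ℝ) 1, 0 < f j t := by
    intro j
    by_contra hcon
    push Not at hcon
    have h1 : ∀ t ∈ Icc (0 : ℝ) 1, γ j t = S.tip i := fun t ht =>
      S.radius_eq_zero (le_antisymm (hcon t ht) (S.radius_nonneg i _))
    obtain ⟨t, ht, hne⟩ := (hγ j).nonconstant
    exact hne (by rw [h1 t ht, h1 0 ⟨le_rfl, zero_le_one⟩])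
  choose tm htm htmpos using hleave
  -- Below `s` the metric is close to that of the cone, and below the radii `f j (tm j)` each
  -- component has a point outside the ball.
  have hmin : ∃ ε' > 0, ε' ≤ ε ∧ ε' ≤ s ∧ ∀ j, ε' ≤ f j (tm j) := by
    have h1 : ∀ᶠ ε' in 𝓝[>] (0 : ℝ), ε' ≤ ε ∧ ε' ≤ s ∧ ∀ j, ε' ≤ f j (tm j) := by
      have h2 : ∀ x : ℝ, 0 < x → ∀ᶠ ε' in 𝓝[>] (0 : ℝ), ε' ≤ x := fun x hx => by
        filter_upwards [Ioo_mem_nhdsGT hx] with y hy using hy.2.le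
      exact (h2 ε hε).and ((h2 s hs.1).and (eventually_all.2 fun j => h2 _ (htmpos j)))
    obtain ⟨ε', h3, h4⟩ := (h1.and self_mem_nhdsWithin).exists
    exact ⟨ε', h4, h3⟩
  obtain ⟨ε', hε'0, hε'ε, hε's, hε'f⟩ := hmin
  set O : Fin n → Set ℝ := fun j => S.coneTimes i (γ j) (F j) with hO
  have hOopen : ∀ j, IsOpen (O j) := fun j => h.isOpen_coneTimes (hF j) (hγ j).continuousOn
  have hO01 : ∀ j, O j ⊆ Ioo 0 1 := fun j t ht => ht.1.1
  -- Levels attained at an end of the interval or at a parameter where a component is not known to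
  -- be `C¹`.
  set bad : Set ℝ := ⋃ j, f j '' (F j ∪ {0, 1}) with hbad
  have hbad0 : volume bad = 0 := by
    refine Set.Finite.measure_zero (finite_iUnion fun j => ?_) volume
    exact ((hF j).union (Set.toFinite _)).image _
  obtain ⟨r, hr, hrbad, K, hK, hKd, hKlen⟩ := exists_good_level (f := f)
    (v := fun j => S.speed (γ j)) (O := O) (fun j => (hOopen j).measurableSet)
    (fun j => (hO01 j).trans Ioo_subset_Ico_self)
    (fun j t ht => h.hasDerivAt_radius_curve (hF j) (hFc j) ht.1 ht.2)
    (fun j => (lintegral_mono_set (hO01 j)).trans_lt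
      ((S.curveLength_eq (γ j)).symm.trans_lt (hγ j).length_lt_top)) hbad0 hε'0
  have hrs : r < s := hr.2.trans_le hε's
  have hr01 : r ∈ Ioo (0 : ℝ) 1 := ⟨hr.1, hrs.trans hs.2⟩
  have hlev : ∀ j, ∀ t ∈ Icc (0 : ℝ) 1, f j t = r → t ∈ K j := by
    intro j t ht htr
    have hn : t ∉ F j ∪ {0, 1} := fun hh => hrbad (mem_iUnion.2 ⟨j, t, hh, htr⟩)
    refine (hK j t).2 ⟨⟨⟨⟨lt_of_le_of_ne ht.1 ?_, lt_of_le_of_ne ht.2 ?_⟩, ?_⟩, ?_⟩, htr⟩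
    · rintro rfl; exact hn (by simp)
    · rintro rfl; exact hn (by simp)
    · exact fun hh => hn (Or.inl hh)
    · change f j t ∈ _
      rw [htr]; exact hr01
  have hout : ∀ j, ∃ t ∈ Icc (0 : ℝ) 1, r ≤ f j t := fun j =>
    ⟨tm j, htm j, hr.2.le.trans (hε'f j)⟩
  -- the angles of the crossings
  have hang : ∀ j t, ∃ φ : ℝ, t ∈ K j → γ j t = S.reg (p (r, φ)) := by
    intro j t
    by_cases ht : t ∈ K j
    · have h1 := (hK j t).1 ht
      obtain ⟨y, hy, he⟩ := h.exists_of_radius_mem h1.1.2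
      refine ⟨y.2, fun _ => ?_⟩
      have h2 : y.1 = r := by
        rw [← h.radius_apply hy, ← he]; exact h1.2
      rw [he, ← h2]
    · exact ⟨0, fun hh => absurd hh ht⟩
  choose ψ hψ using hang
  let J := (j : Fin n) × {t // t ∈ K j}
  obtain ⟨φ₀, hφ₀, hφsum⟩ := exists_direction hα0 fun x : J => ψ x.1 x.2
  set p' : ℝ × ℝ → M := fun y => p (y.1, y.2 + φ₀) with hp'
  have h' := h.rotate φ₀
  set φ : Fin n → ℝ → ℝ := fun j t => ψ j t - φ₀ with hφdef
  have hφ : ∀ j, ∀ k ∈ K j, γ j k = S.reg (p' (r, φ j k)) := fun j k hk => by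
    rw [hψ j k hk]; simp [hp', hφdef]
  have hH : ∀ y ∈ strip, y.1 ≤ r → H (y.1, y.2 + φ₀) ≤ 1 + 2 * starGain α := by
    intro y hy hyr
    have := (abs_lt.1 (hsH y.1 ⟨(mem_strip.1 hy).1, hyr.trans_lt hrs⟩ (y.2 + φ₀))).2
    linarith
  choose γ' hγ' htr hlen using fun j => h'.exists_surgery hα hδ hr01 (by linarith) hH (hγ j)
    (hF j) (hFc j) (hK j) (hKd j) (hlev j) (hout j) (hφ j)
  -- there is at least one crossing
  obtain ⟨j₀, k₀, hk₀⟩ : ∃ j, ∃ k, k ∈ K j := by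
    obtain ⟨j, t, ht, he⟩ := mem_iUnion.1 htip
    have h0 : f j t = 0 := by simp [hf, he]
    obtain ⟨t₁, ht₁, h1⟩ := hout j
    obtain ⟨k, hk, hkr⟩ := isPreconnected_Icc.intermediate_value ht ht₁ (hfc j)
      ⟨by rw [h0]; exact hr.1.le, h1⟩
    exact ⟨j, k, hlev j k hk hkr⟩
  set Q := S.reg (p' (r * δ, 0)) with hQ
  set R := S.starRetract i p' α δ r with hR
  set Φ : Set ℝ := {x | ∃ j, ∃ k ∈ K j, x = φ j k} with hΦ
  -- Apart from the vertex, the new trace is the preimage of the old one. Hence the preimages of `U`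
  -- and `V` are exactly the parts of the new complement.
  have htrace : ∀ z, z ∈ S.trace γ' ↔ z = Q ∨ R z ∈ S.trace γ := by
    have hmem : ∀ z, z ∈ S.trace γ' ↔ (r ≤ S.radius i z ∧ z ∈ S.trace γ) ∨
      ∃ φ ∈ Φ, ∃ u ∈ Icc (0 : ℝ) 1, z = S.reg (p' (armCoord α δ r φ u)) := by
      intro z
      simp only [trace, mem_iUnion]
      constructor
      · rintro ⟨j, hz⟩
        rcases (htr j z).1 hz with ⟨h1, h2⟩ | ⟨k, hk, u, hu, he⟩
        · exact Or.inl ⟨h1, j, h2⟩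
        · exact Or.inr ⟨_, ⟨j, k, hk, rfl⟩, u, hu, he⟩
      · rintro (⟨h1, j, h2⟩ | ⟨_, ⟨j, k, hk, rfl⟩, u, hu, he⟩)
        · exact ⟨j, (htr j z).2 (Or.inl ⟨h1, h2⟩)⟩
        · exact ⟨j, (htr j z).2 (Or.inr ⟨k, hk, u, hu, he⟩)⟩
    intro z
    rw [hmem z]
    by_cases hzQ : z = Q
    · refine iff_of_true (Or.inr ⟨φ j₀ k₀, ⟨j₀, k₀, hk₀, rfl⟩, 1, ⟨zero_le_one, le_rfl⟩, ?_⟩)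
        (Or.inl hzQ)
      rw [armCoord_one hδ.1, hzQ]
    · rw [or_iff_right hzQ, ← h'.starRetract_mem_iff hα hδ hr01 (A := S.trace γ) (Φ := Φ) ?_ ?_ hzQ]
      · rintro _ ⟨j, k, hk, rfl⟩
        exact hφ₀ ⟨j, k, hk⟩
      · intro w hw
        simp only [trace, mem_iUnion]
        constructor
        · rintro ⟨j, t, ht, rfl⟩
          have := hlev j t ht hw
          exact ⟨φ j t, ⟨j, t, this, rfl⟩, hφ j t this⟩
        · rintro ⟨_, ⟨j, k, hk, rfl⟩, rfl⟩
          exact ⟨j, k, Ioo_subset_Icc_self (hO01 j ((hK j k).1 hk).1), hφ j k hk⟩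
  refine ⟨r, ⟨hr.1, hr.2.trans_le hε'ε⟩, γ', {Q}ᶜ ∩ R ⁻¹' U, {Q}ᶜ ∩ R ⁻¹' V, hγ',
    h'.isOpen_starPart hα hδ hr01 hU, h'.isOpen_starPart hα hδ hr01 hV, ?_, ?_, ?_,
    fun z hz hzr => ⟨R z, hz.2, h'.radius_starRetract_of_lt hr01 hzr⟩,
    fun z hz hzr => ⟨R z, hz.2, h'.radius_starRetract_of_lt hr01 hzr⟩, ?_⟩
  · exact Set.disjoint_left.2 fun z hz hz' => Set.disjoint_left.1 hUV hz.2 hz'.2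
  · rw [← inter_union_distrib_left, ← preimage_union, hUVt]
    ext z
    rw [mem_compl_iff, htrace z]
    simp
  · intro z hz
    have h1 : R z = z := starRetract_of_le hz
    have h2 : z ∈ ({Q}ᶜ : Set S.Completion) := by
      rintro rfl
      rw [hQ, h'.radius_apply (vertex_mem_strip hδ hr01)] at hz
      nlinarith [hr.1, hδ.2]
    simp only [mem_inter_iff, mem_preimage, h1, h2, true_and, and_self]
  -- The old length is at least its outer part, which is kept, plus the variation inside, which
  -- `hKlen` bounds below by `r` for each crossing.
  · have hold : ∀ j, (∫⁻ t in Ioo 0 1 ∩ {t | r ≤ f j t}, S.speed (γ j) t) +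
        ∫⁻ t in O j ∩ {t | f j t < r}, S.speed (γ j) t ≤ S.curveLength (γ j) := by
      intro j
      have hm : MeasurableSet (O j ∩ {t | f j t < r}) := by
        have h1 : ContinuousOn (f j) (O j) :=
          (hfc j).mono ((hO01 j).trans Ioo_subset_Icc_self)
        exact (h1.isOpen_inter_preimage (hOopen j) (isOpen_Iio (a := r))).measurableSet
      rw [← lintegral_union hm, S.curveLength_eq]
      · exact lintegral_mono_set (union_subset inter_subset_left (inter_subset_left.trans (hO01 j)))
      · exact Set.disjoint_left.2 fun t ht ht' => 
          absurd (show f j t < r from ht'.2) (not_lt.2 ht.2)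
    have hcard : Fintype.card J = ∑ j, (K j).card := by
      simp [J, Fintype.card_sigma]
    have hcard1 : 1 ≤ Fintype.card J := Fintype.card_pos_iff.2 ⟨⟨j₀, k₀, hk₀⟩⟩
    -- The gain is proportional to `r` times the number of crossings. Since there is at least one
    -- crossing, it is at least `starGain α * r`.
    have harms : (∑ j, ∑ k ∈ K j, ENNReal.ofReal (armLength α δ r (2 * starGain α) (φ j k))) +
        ENNReal.ofReal (starGain α * r) ≤ ENNReal.ofReal r * (∑ j, (K j).card : ℕ) := by
      have e1 : (∑ j, ∑ k ∈ K j, ENNReal.ofReal (armLength α δ r (2 * starGain α) (φ j k))) =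
          ENNReal.ofReal (∑ x : J, armLength α δ r (2 * starGain α) (φ x.1 x.2)) := by
        rw [ENNReal.ofReal_sum_of_nonneg fun x _ => armLength_nonneg hr.1.le, Fintype.sum_sigma]
        refine Finset.sum_congr rfl fun j _ => ?_
        exact (Finset.sum_coe_sort (K j)
          (fun k => ENNReal.ofReal (armLength α δ r (2 * starGain α) (φ j k)))).symm
      have e2 := sum_armLength_le hα0 hα hr.1.le (φ := fun x : J => φ x.1 x.2) hφsum
      rw [e1, ← ENNReal.ofReal_add (Finset.sum_nonneg fun x _ => armLength_nonneg hr.1.le)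
        (mul_nonneg hgain.le hr.1.le), ← hcard, ← ENNReal.ofReal_natCast, ← ENNReal.ofReal_mul hr.1.le]
      refine ENNReal.ofReal_le_ofReal (le_trans ?_ e2)
      have : (1 : ℝ) ≤ Fintype.card J := by exact_mod_cast hcard1
      have h3 : starGain α * r ≤ starGain α * (r * Fintype.card J) :=
        mul_le_mul_of_nonneg_left (by nlinarith [hr.1]) hgain.le
      linarith
    calc S.length γ' + ENNReal.ofReal (starGain α * r)
        ≤ (∑ j, ((∫⁻ t in Ioo 0 1 ∩ {t | r ≤ f j t}, S.speed (γ j) t) +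
          ∑ k ∈ K j, ENNReal.ofReal (armLength α δ r (2 * starGain α) (φ j k)))) +
            ENNReal.ofReal (starGain α * r) := by
          refine add_le_add_left (Finset.sum_le_sum fun j _ => hlen j) _
      _ = (∑ j, (∫⁻ t in Ioo 0 1 ∩ {t | r ≤ f j t}, S.speed (γ j) t)) +
          ((∑ j, ∑ k ∈ K j, ENNReal.ofReal (armLength α δ r (2 * starGain α) (φ j k))) +
            ENNReal.ofReal (starGain α * r)) := by
          rw [Finset.sum_add_distrib, add_assoc]
      _ ≤ (∑ j, (∫⁻ t in Ioo 0 1 ∩ {t | r ≤ f j t}, S.speed (γ j) t)) +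
          ∑ j, ∫⁻ t in O j ∩ {t | f j t < r}, S.speed (γ j) t :=
          add_le_add_right (harms.trans hKlen) _
      _ = ∑ j, ((∫⁻ t in Ioo 0 1 ∩ {t | r ≤ f j t}, S.speed (γ j) t) +
          ∫⁻ t in O j ∩ {t | f j t < r}, S.speed (γ j) t) := by
          rw [Finset.sum_add_distrib]
      _ ≤ S.length γ := Finset.sum_le_sum fun j _ => hold j

end PolarChart
end ConicalSurface
end

/-! ### A bump function along a segment with controlled sign of its directional derivative. -/

noncomputable section
namespace ConicalSurface

/-- A smooth bump on the line. -/
def lineBump : ContDiffBump (0 : ℝ) := ⟨1 / 2, 1, by norm_num, by norm_num⟩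

lemma lineBump_eq_zero {x : ℝ} (hx : 1 ≤ |x|) : lineBump x = 0 :=
  lineBump.zero_of_le_dist (by rw [Real.dist_eq, sub_zero]; exact hx)

lemma lineBump_zero : lineBump 0 = 1 :=
  lineBump.one_of_mem_closedBall (by simp [lineBump])

lemma lineBump_contDiff : ContDiff ℝ 1 lineBump := lineBump.contDiff

/-- A primitive of the bump. -/
def lineStep (x : ℝ) : ℝ := ∫ s in (0 : ℝ)..x, lineBump s

lemma hasDerivAt_lineStep (x : ℝ) : HasDerivAt lineStep (lineBump x) x :=
  intervalIntegral.integral_hasDerivAt_right (lineBump.continuous.intervalIntegrable _ _)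
    (lineBump.continuous.stronglyMeasurableAtFilter _ _) lineBump.continuous.continuousAt

lemma lineStep_contDiff : ContDiff ℝ 1 lineStep := by
  refine contDiff_one_iff_deriv.2 ⟨fun x => (hasDerivAt_lineStep x).differentiableAt, ?_⟩
  have : deriv lineStep = lineBump := funext fun x => (hasDerivAt_lineStep x).deriv
  rw [this]
  exact lineBump.continuous

lemma lineStep_eq {x y : ℝ} (hxy : x ≤ y) (h : ∀ s ∈ Icc x y, lineBump s = 0) :
    lineStep x = lineStep y := by
  have h1 : lineStep y - lineStep x = ∫ s in x..y, lineBump s :=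
    intervalIntegral.integral_interval_sub_left (lineBump.continuous.intervalIntegrable _ _)
      (lineBump.continuous.intervalIntegrable _ _)
  have h2 : ∫ s in x..y, lineBump s = ∫ s in x..y, (0 : ℝ) :=
    intervalIntegral.integral_congr fun s hs => h s (by rwa [uIcc_of_le hxy] at hs)
  rw [h2, intervalIntegral.integral_zero] at h1
  linarith

/-- A smooth function with compact support in a neighbourhood of a segment, increasing along the
segment only near its first end point, decreasing only near its second end point. -/
lemma exists_tube {R N₀ N₁ : Set (ℝ × ℝ)} {u e : ℝ × ℝ} (hR : IsOpen R) (he : e ≠ 0)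
    (hseg : ∀ s ∈ Icc (0 : ℝ) 1, u + s • e ∈ R) (h₀ : N₀ ∈ 𝓝 u) (h₁ : N₁ ∈ 𝓝 (u + e)) :
    ∃ Φ : ℝ × ℝ → ℝ, ContDiff ℝ 1 Φ ∧ HasCompactSupport Φ ∧ tsupport Φ ⊆ R ∧
      (∀ y ∉ N₁, 0 ≤ fderiv ℝ Φ y e) ∧ (∀ y ∉ N₀, fderiv ℝ Φ y e ≤ 0) ∧ 0 < fderiv ℝ Φ u e := by
  set N := e.1 ^ 2 + e.2 ^ 2 with hN
  have hNpos : 0 < N := by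
    rcases eq_or_ne e.1 0 with h1 | h1
    · have h2 : e.2 ≠ 0 := fun h2 => he (Prod.ext h1 h2)
      positivity
    · positivity
  -- Coordinates with origin `u` whose axes are `e` and `e` turned by a right angle. The functions
  -- `l₁` and `l₂` invert `E`.
  set E : ℝ × ℝ → ℝ × ℝ := fun x =>
    (u.1 + x.1 * e.1 - x.2 * e.2, u.2 + x.1 * e.2 + x.2 * e.1) with hE
  have hEc : Continuous E := by fun_prop
  set l₁ : ℝ × ℝ → ℝ := fun y => ((y.1 - u.1) * e.1 + (y.2 - u.2) * e.2) / N with hl₁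
  set l₂ : ℝ × ℝ → ℝ := fun y => (-(y.1 - u.1) * e.2 + (y.2 - u.2) * e.1) / N with hl₂
  have hEl : ∀ y, E (l₁ y, l₂ y) = y := by
    intro y
    ext
    · simp only [hE, hl₁, hl₂]; field_simp; rw [hN]; ring
    · simp only [hE, hl₁, hl₂]; field_simp; rw [hN]; ring
  have hE0 : E (0, 0) = u := by ext <;> simp [hE]
  have hE1 : E (1, 0) = u + e := by ext <;> simp [hE]
  have hsmall : ∀ᶠ ε in 𝓝[>] (0 : ℝ),
      (∀ x : ℝ × ℝ, x.1 ∈ Icc (-ε) (1 + ε) → |x.2| ≤ ε → E x ∈ R) ∧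
      (∀ x : ℝ × ℝ, |x.1| ≤ ε → |x.2| ≤ ε → E x ∈ N₀) ∧
      (∀ x : ℝ × ℝ, |x.1 - 1| ≤ ε → |x.2| ≤ ε → E x ∈ N₁) := by
    have hball : ∀ (z : ℝ × ℝ) (X : Set (ℝ × ℝ)), X ∈ 𝓝 (E z) → ∀ᶠ ε in 𝓝[>] (0 : ℝ),
        ∀ x : ℝ × ℝ, |x.1 - z.1| ≤ ε → |x.2 - z.2| ≤ ε → E x ∈ X := by
      intro z X hX
      obtain ⟨ε₀, hε₀, hb⟩ := Metric.mem_nhds_iff.1 (hEc.continuousAt hX)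
      filter_upwards [Ioo_mem_nhdsGT hε₀] with ε hε x h1 h2
      refine hb ?_
      rw [Metric.mem_ball, Prod.dist_eq, Real.dist_eq, Real.dist_eq]
      exact (max_le h1 h2).trans_lt hε.2
    refine Filter.Eventually.and ?_ (Filter.Eventually.and ?_ ?_)
    · have hK : IsCompact (Icc (0 : ℝ) 1 ×ˢ {(0 : ℝ)}) := isCompact_Icc.prod isCompact_singleton
      obtain ⟨ε₀, hε₀, hb⟩ := hK.exists_cthickening_subset_open (hR.preimage hEc) (by
        rintro ⟨x, y⟩ ⟨hx, hy⟩
        rw [mem_singleton_iff] at hy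
        simp only at hy hx
        subst hy
        have := hseg x hx
        rw [mem_preimage]
        convert this using 1
        ext <;> simp [hE])
      filter_upwards [Ioo_mem_nhdsGT hε₀] with ε hε x h1 h2
      refine hb (Metric.mem_cthickening_of_dist_le x (max 0 (min 1 x.1), 0) _ _ ?_ ?_)
      · exact ⟨⟨le_max_left _ _, max_le zero_le_one (min_le_left _ _)⟩, rfl⟩
      · rw [Prod.dist_eq, Real.dist_eq, Real.dist_eq, sub_zero]
        refine max_le ?_ (h2.trans hε.2.le)
        refine le_trans ?_ hε.2.le
        have hε0 := hε.1.le
        rcases le_total 1 x.1 with h3 | h3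
        · rw [min_eq_left h3, max_eq_right zero_le_one, abs_of_nonneg (by linarith)]
          linarith [h1.2]
        · rw [min_eq_right h3]
          rcases le_total 0 x.1 with h4 | h4
          · rw [max_eq_right h4, sub_self, abs_zero]; exact hε0
          · rw [max_eq_left h4, sub_zero, abs_of_nonpos h4]; linarith [h1.1]
    · simpa using hball (0, 0) N₀ (by rwa [hE0])
    · simpa using hball (1, 0) N₁ (by rwa [hE1])
  obtain ⟨ε, ⟨hεR, hεN₀, hεN₁⟩, hε⟩ :=
    (((hsmall.and (Ioo_mem_nhdsGT (one_half_pos (α := ℝ))))).exists)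
  have hε0 := hε.1
  -- A plateau: it rises within `ε` of `0` and falls back to zero within `ε` of `1`.
  set g : ℝ → ℝ := fun x => lineStep (x / ε) - lineStep ((x - 1) / ε) with hg
  have hgd : ∀ x, HasDerivAt g ((lineBump (x / ε) - lineBump ((x - 1) / ε)) / ε) x := by
    intro x
    have h1 : HasDerivAt (fun x : ℝ => lineStep (x / ε)) (lineBump (x / ε) * (1 / ε)) x :=
      HasDerivAt.comp x (h₂ := lineStep) (h := fun x : ℝ => x / ε)
        (hasDerivAt_lineStep (x / ε)) ((hasDerivAt_id x).div_const ε)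
    have h2 : HasDerivAt (fun x : ℝ => lineStep ((x - 1) / ε))
        (lineBump ((x - 1) / ε) * (1 / ε)) x :=
      HasDerivAt.comp x (h₂ := lineStep) (h := fun x : ℝ => (x - 1) / ε)
        (hasDerivAt_lineStep ((x - 1) / ε))
        (((hasDerivAt_id x).sub_const 1).div_const ε)
    exact (h1.sub h2).congr_deriv (by ring)
  have hgC : ContDiff ℝ 1 g := by
    have h1 := lineStep_contDiff
    exact (h1.comp (contDiff_id.div_const ε)).sub
      (h1.comp ((contDiff_id.sub contDiff_const).div_const ε))
  have hg0 : ∀ x, x ∉ Icc (-ε) (1 + ε) → g x = 0 := by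
    intro x hx
    rw [mem_Icc, not_and_or, not_le, not_le] at hx
    have hle : (x - 1) / ε ≤ x / ε := div_le_div_of_nonneg_right (by linarith) hε0.le
    have : lineStep ((x - 1) / ε) = lineStep (x / ε) := by
      refine lineStep_eq hle fun s hs => lineBump_eq_zero ?_
      rcases hx with hx | hx
      · have h1 : x / ε ≤ -1 := by rw [div_le_iff₀ hε0]; linarith
        rw [abs_of_nonpos (by linarith [hs.2])]; linarith [hs.2]
      · have h1 : 1 ≤ (x - 1) / ε := by rw [le_div_iff₀ hε0]; linarith
        rw [abs_of_nonneg (by linarith [hs.1])]; linarith [hs.1]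
    simp only [hg, this, sub_self]
  have hb0 : ∀ x, ε < |x| → lineBump (x / ε) = 0 := fun x hx => lineBump_eq_zero (by
    rw [abs_div, abs_of_pos hε0, le_div_iff₀ hε0]; linarith)
  set Φ : ℝ × ℝ → ℝ := fun y => lineBump (l₂ y / ε) * g (l₁ y) with hΦ
  have hl₁C : ContDiff ℝ 1 l₁ := by fun_prop
  have hl₂C : ContDiff ℝ 1 l₂ := by fun_prop
  have hΦC : ContDiff ℝ 1 Φ :=
    (lineBump_contDiff.comp (hl₂C.div_const ε)).mul (hgC.comp hl₁C)
  -- In the direction `e` only `l₁` varies, at unit rate, so the derivative is a positive bump at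
  -- `u` minus a bump at `u + e`.
  have hfd : ∀ y, fderiv ℝ Φ y e = lineBump (l₂ y / ε) *
      ((lineBump (l₁ y / ε) - lineBump ((l₁ y - 1) / ε)) / ε) := by
    intro y
    have h1 : HasDerivAt (fun s : ℝ => y + s • e) e 0 := by
      simpa using ((hasDerivAt_id (0 : ℝ)).smul_const e).const_add y
    have h2 : HasDerivAt (fun s : ℝ => Φ (y + s • e)) (fderiv ℝ Φ y e) 0 := by
      have h3 : HasFDerivAt Φ (fderiv ℝ Φ y) (y + (0 : ℝ) • e) := by
        rw [zero_smul, add_zero]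
        exact (hΦC.differentiable one_ne_zero y).hasFDerivAt
      exact h3.comp_hasDerivAt 0 h1
    have h4 : (fun s : ℝ => Φ (y + s • e)) = fun s => lineBump (l₂ y / ε) * g (l₁ y + s) := by
      funext s
      have e1 : l₁ (y + s • e) = l₁ y + s := by
        simp only [hl₁, Prod.fst_add, Prod.snd_add, Prod.smul_fst, Prod.smul_snd, smul_eq_mul]
        field_simp; rw [hN]; ring
      have e2 : l₂ (y + s • e) = l₂ y := by
        simp only [hl₂, Prod.fst_add, Prod.snd_add, Prod.smul_fst, Prod.smul_snd, smul_eq_mul]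
        field_simp; ring
      simp only [hΦ, e1, e2]
    have h5 : HasDerivAt (fun s : ℝ => g (l₁ y + s))
        ((lineBump (l₁ y / ε) - lineBump ((l₁ y - 1) / ε)) / ε) 0 := by
      have h6 := hgd (l₁ y + 0)
      have := h6.comp_const_add (l₁ y) 0
      simpa using this
    rw [h4] at h2
    exact h2.unique (h5.const_mul _)
  have hsupp : ∀ y, Φ y ≠ 0 → l₁ y ∈ Icc (-ε) (1 + ε) ∧ |l₂ y| ≤ ε := by
    intro y hy
    constructor
    · by_contra hcon
      exact hy (by simp only [hΦ, hg0 _ hcon, mul_zero])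
    · by_contra hcon
      exact hy (by simp only [hΦ, hb0 _ (not_le.1 hcon), zero_mul])
  have hbox : IsCompact (E '' (Icc (-ε) (1 + ε) ×ˢ Icc (-ε) ε)) :=
    (isCompact_Icc.prod isCompact_Icc).image hEc
  have hts : tsupport Φ ⊆ E '' (Icc (-ε) (1 + ε) ×ˢ Icc (-ε) ε) :=
    closure_minimal (fun y hy => ⟨(l₁ y, l₂ y), ⟨(hsupp y hy).1, abs_le.1 (hsupp y hy).2⟩, hEl y⟩)
      hbox.isClosed
  refine ⟨Φ, hΦC, hbox.of_isClosed_subset (isClosed_tsupport Φ) hts, fun y hy => ?_,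
    fun y hy => ?_, fun y hy => ?_, ?_⟩
  · obtain ⟨x, hx, rfl⟩ := hts hy
    exact hεR x hx.1 (abs_le.2 hx.2)
  · rw [hfd]
    rcases lt_or_ge ε |l₂ y| with h2 | h2
    · rw [hb0 _ h2, zero_mul]
    rcases lt_or_ge ε |l₁ y - 1| with h3 | h3
    · rw [hb0 _ h3, sub_zero]
      exact mul_nonneg lineBump.nonneg (div_nonneg lineBump.nonneg hε0.le)
    · exact absurd (by rw [← hEl y]; exact hεN₁ (l₁ y, l₂ y) h3 h2) hy
  · rw [hfd]
    rcases lt_or_ge ε |l₂ y| with h2 | h2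
    · rw [hb0 _ h2, zero_mul]
    rcases lt_or_ge ε |l₁ y| with h3 | h3
    · rw [hb0 _ h3, zero_sub]
      exact mul_nonpos_of_nonneg_of_nonpos lineBump.nonneg
        (div_nonpos_of_nonpos_of_nonneg (neg_nonpos.2 lineBump.nonneg) hε0.le)
    · exact absurd (by rw [← hEl y]; exact hεN₀ (l₁ y, l₂ y) h3 h2) hy
  · rw [hfd]
    have e1 : l₁ u = 0 := by simp [hl₁]
    have e2 : l₂ u = 0 := by simp [hl₂]
    have e3 : lineBump ((0 - 1) / ε) = 0 := hb0 _ (by norm_num; linarith [hε.2])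
    rw [e1, e2, e3, zero_div, lineBump_zero]
    simp [hε0]

end ConicalSurface
end

/-! ### Displacements of the plane: homeomorphisms, areas and lengths. -/

noncomputable section
namespace ConicalSurface

/-- Displacement of the points of the plane in the direction `e`, by amounts proportional to `f`. -/
def displace (f : ℝ × ℝ → ℝ) (e : ℝ × ℝ) (t : ℝ) (y : ℝ × ℝ) : ℝ × ℝ := y + (t * f y) • e

section displace

variable {f : ℝ × ℝ → ℝ} {e : ℝ × ℝ} {t : ℝ} {y : ℝ × ℝ}

lemma displace_of_eq_zero (hy : f y = 0) : displace f e t y = y := by simp [displace, hy]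

@[simp] lemma displace_zero : displace f e 0 y = y := by simp [displace]

lemma contDiff_displace (hf : ContDiff ℝ 1 f) : ContDiff ℝ 1 (displace f e t) := by
  unfold displace; fun_prop

lemma hasFDerivAt_displace (hf : ContDiff ℝ 1 f) : HasFDerivAt (displace f e t)
    (ContinuousLinearMap.id ℝ (ℝ × ℝ) + (t • fderiv ℝ f y).smulRight e) y := by
  have h1 : HasFDerivAt f (fderiv ℝ f y) y := (hf.differentiable one_ne_zero y).hasFDerivAt
  exact (hasFDerivAt_id y).add ((h1.const_mul t).smul_const e)

/-- Determinant of a rank-one perturbation of the identity. -/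
lemma det_displace (A : ℝ × ℝ →L[ℝ] ℝ) :
    (ContinuousLinearMap.id ℝ (ℝ × ℝ) + (t • A).smulRight e).det = 1 + t * A e := by
  have h1 : A e = e.1 * A (1, 0) + e.2 * A (0, 1) := by
    have : e = e.1 • ((1, 0) : ℝ × ℝ) + e.2 • ((0, 1) : ℝ × ℝ) := by ext <;> simp
    conv_lhs => rw [this]
    rw [map_add, map_smul, map_smul, smul_eq_mul, smul_eq_mul]
  rw [det_clm_prod, h1]
  simp
  ring

lemma hasDerivAt_displace : HasDerivAt (fun t => displace f e t y) (f y • e) t := by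
  have h1 : HasDerivAt (fun t : ℝ => (t * f y) • e) ((1 * f y) • e) t :=
    ((hasDerivAt_id t).mul_const (f y)).smul_const e
  rw [one_mul] at h1
  exact h1.const_add y

/-- Small displacements are homeomorphisms. -/
lemma exists_displace_homeomorph (hf : ContDiff ℝ 1 f) (hfc : HasCompactSupport f) (e : ℝ × ℝ) :
    ∃ t₀ > 0, ∀ t, |t| ≤ t₀ →
      (∃ Ψ : (ℝ × ℝ) ≃ₜ (ℝ × ℝ), ∀ y, Ψ y = displace f e t y) ∧
      ∀ y, |t * fderiv ℝ f y e| ≤ 1 / 2 := by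
  obtain ⟨C, hC⟩ := ContDiff.lipschitzWith_of_hasCompactSupport hfc hf one_ne_zero
  have hD : 0 < 2 * (C * ‖e‖ + 1) := by positivity
  refine ⟨1 / (2 * (C * ‖e‖ + 1)), by positivity, fun t ht => ?_⟩
  have ht' : |t| * (C * ‖e‖) ≤ 1 / 2 := by
    rw [le_div_iff₀ hD] at ht
    nlinarith [abs_nonneg t]
  refine ⟨?_, fun y => ?_⟩
  -- The displacement differs from the identity by a map with Lipschitz constant at most `1/2`, so
  -- it is a homeomorphism.
  · have happ : ApproximatesLinearOn (displace f e t)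
        ((ContinuousLinearEquiv.refl ℝ (ℝ × ℝ) : ℝ × ℝ →L[ℝ] ℝ × ℝ)) univ (1 / 2) := by
      intro x _ y _
      have e1 : displace f e t x - displace f e t y -
          (ContinuousLinearEquiv.refl ℝ (ℝ × ℝ) : ℝ × ℝ →L[ℝ] ℝ × ℝ) (x - y) =
          (t * (f x - f y)) • e := by
        simp only [displace, ContinuousLinearEquiv.coe_refl, ContinuousLinearMap.id_apply]
        rw [mul_sub, sub_smul]; abel
      rw [e1, norm_smul, norm_mul, Real.norm_eq_abs]
      have h2 : ‖f x - f y‖ ≤ C * ‖x - y‖ := hC.norm_sub_le x y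
      have h3 : |t| * ‖f x - f y‖ * ‖e‖ ≤ |t| * (C * ‖x - y‖) * ‖e‖ := by gcongr
      refine h3.trans ?_
      push_cast
      nlinarith [norm_nonneg (x - y)]
    refine ⟨happ.toHomeomorph _ (Or.inr ?_), fun y => rfl⟩
    have : ‖((ContinuousLinearEquiv.refl ℝ (ℝ × ℝ)).symm : ℝ × ℝ →L[ℝ] ℝ × ℝ)‖₊ = 1 := by
      ext
      simp
    rw [this, inv_one, ← NNReal.coe_lt_coe]
    norm_num
  · rw [abs_mul]
    have h1 : ‖fderiv ℝ f y‖ ≤ C := norm_fderiv_le_of_lipschitz ℝ hC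
    have h2 : |fderiv ℝ f y e| ≤ C * ‖e‖ :=
      ((fderiv ℝ f y).le_opNorm e).trans (by gcongr)
    exact (mul_le_mul_of_nonneg_left h2 (abs_nonneg t)).trans ht'

/-- Points off `R` are fixed, so by injectivity no point of `R` can be moved out of `R`. -/
lemma displace_mem {R : Set (ℝ × ℝ)} (hR : tsupport f ⊆ R)
    {Ψ : (ℝ × ℝ) ≃ₜ (ℝ × ℝ)} (hΨ : ∀ y, Ψ y = displace f e t y) : Ψ y ∈ R ↔ y ∈ R := by
  have hout : ∀ z, z ∉ R → Ψ z = z := fun z hz => by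
    rw [hΨ, displace_of_eq_zero (image_eq_zero_of_notMem_tsupport fun h => hz (hR h))]
  constructor
  · intro h
    by_contra hy
    rw [hout y hy] at h
    exact hy h
  · intro hy
    by_contra h
    have := Ψ.injective (hout _ h)
    rw [this] at h
    exact h hy

end displace

/-- The derivative of a density along a displacement, multiplied by the Jacobian. -/
lemma hasDerivAt_integral_displace {O Q R W : Set (ℝ × ℝ)} {ρ f : ℝ × ℝ → ℝ} {e : ℝ × ℝ}
    (hO : IsOpen O) (hρ : ContDiffOn ℝ 1 ρ O) (hQ : IsCompact Q) (hQO : Q ⊆ O) (hRQ : R ⊆ Q)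
    (hf : ContDiff ℝ 1 f) (hfc : HasCompactSupport f)
    {t₀ : ℝ} (ht₀ : 0 < t₀) (hmem : ∀ t, |t| ≤ t₀ → ∀ y ∈ R, displace f e t y ∈ R)
    (hW : MeasurableSet W) (hWR : W ⊆ R) :
    ContinuousOn (fun t => ∫ y in W, ρ (displace f e t y) * (1 + t * fderiv ℝ f y e))
      (Icc (-t₀) t₀) ∧
    HasDerivAt (fun t => ∫ y in W, ρ (displace f e t y) * (1 + t * fderiv ℝ f y e))
      (∫ y in W, fderiv ℝ (fun y => ρ y * f y) y e) 0 ∧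
    ∀ t, |t| ≤ t₀ →
      IntegrableOn (fun y => ρ (displace f e t y) * (1 + t * fderiv ℝ f y e)) W := by
  have hfd : Continuous fun y => fderiv ℝ f y e :=
    (hf.continuous_fderiv one_ne_zero).clm_apply continuous_const
  have hρd : ContinuousOn (fun y => fderiv ℝ ρ y e) O :=
    (hρ.continuousOn_fderiv_of_isOpen hO le_rfl).clm_apply continuousOn_const
  obtain ⟨A, hA⟩ := hQ.exists_bound_of_continuousOn (hρ.continuousOn.mono hQO)
  obtain ⟨A', hA'⟩ := hQ.exists_bound_of_continuousOn (hρd.mono hQO)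
  obtain ⟨B, hB⟩ := hfc.exists_bound_of_continuous hf.continuous
  obtain ⟨B', hB'⟩ := hQ.exists_bound_of_continuousOn hfd.continuousOn
  have hvol : volume W < ⊤ := (measure_mono (hWR.trans hRQ)).trans_lt hQ.measure_lt_top
  have hconst : ∀ c : ℝ, IntegrableOn (fun _ : ℝ × ℝ => c) W := fun c =>
    integrableOn_const hvol.ne
  have habs : ∀ {t}, t ∈ Icc (-t₀) t₀ ↔ |t| ≤ t₀ := by intro t; rw [mem_Icc, abs_le]
  have hDc : ∀ t, Continuous (displace f e t) := fun t => (contDiff_displace hf).continuous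
  have hcontF : ∀ t, |t| ≤ t₀ →
      ContinuousOn (fun y => ρ (displace f e t y) * (1 + t * fderiv ℝ f y e)) W := by
    intro t ht
    refine ContinuousOn.mul ?_ (by fun_prop)
    exact hρ.continuousOn.comp (hDc t).continuousOn fun y hy => hQO (hRQ (hmem t ht y (hWR hy)))
  have hmeasF : ∀ t, |t| ≤ t₀ → AEStronglyMeasurable
      (fun y => ρ (displace f e t y) * (1 + t * fderiv ℝ f y e)) (volume.restrict W) :=
    fun t ht => (hcontF t ht).aestronglyMeasurable hW
  have hbF : ∀ t, |t| ≤ t₀ → ∀ y ∈ W,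
      ‖ρ (displace f e t y) * (1 + t * fderiv ℝ f y e)‖ ≤ A * (1 + t₀ * B') := by
    intro t ht y hy
    have h1 := hA _ (hRQ (hmem t ht y (hWR hy)))
    have h2 : ‖1 + t * fderiv ℝ f y e‖ ≤ 1 + t₀ * B' := by
      refine (norm_add_le _ _).trans ?_
      rw [norm_one, norm_mul]
      have := hB' y (hRQ (hWR hy))
      gcongr
      exact ht
    rw [norm_mul]
    have hA0 : 0 ≤ A := (norm_nonneg _).trans h1
    exact mul_le_mul h1 h2 (norm_nonneg _) hA0
  have hderF : ∀ t, |t| ≤ t₀ → ∀ y ∈ W,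
      HasDerivAt (fun t => ρ (displace f e t y) * (1 + t * fderiv ℝ f y e))
        (fderiv ℝ ρ (displace f e t y) e * f y * (1 + t * fderiv ℝ f y e) +
          ρ (displace f e t y) * fderiv ℝ f y e) t := by
    intro t ht y hy
    have hyO := hQO (hRQ (hmem t ht y (hWR hy)))
    have h1 : HasFDerivAt ρ (fderiv ℝ ρ (displace f e t y)) (displace f e t y) :=
      ((hρ.contDiffAt (hO.mem_nhds hyO)).differentiableAt one_ne_zero).hasFDerivAt
    have h2 := h1.comp_hasDerivAt t (hasDerivAt_displace (f := f) (e := e) (y := y))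
    have h3 : HasDerivAt (fun t : ℝ => 1 + t * fderiv ℝ f y e) (fderiv ℝ f y e) t := by
      simpa using ((hasDerivAt_id t).mul_const (fderiv ℝ f y e)).const_add 1
    refine (h2.mul h3).congr_deriv ?_
    rw [map_smul, smul_eq_mul]
    simp only [Function.comp_apply]
    ring
  have hint : ∀ t, |t| ≤ t₀ →
      IntegrableOn (fun y => ρ (displace f e t y) * (1 + t * fderiv ℝ f y e)) W := fun t ht =>
    Integrable.mono' (hconst _) (hmeasF t ht)
      ((ae_restrict_iff' hW).2 (Eventually.of_forall fun y hy => hbF t ht y hy))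
  refine ⟨?_, ?_, hint⟩
  · refine continuousOn_of_dominated (bound := fun _ => A * (1 + t₀ * B'))
      (fun t ht => hmeasF t (habs.1 ht)) (fun t ht =>
        (ae_restrict_iff' hW).2 (Eventually.of_forall fun y hy => hbF t (habs.1 ht) y hy))
      (hconst _) ((ae_restrict_iff' hW).2 (Eventually.of_forall fun y hy t ht =>
        (hderF t (habs.1 ht) y hy).continuousAt.continuousWithinAt))
  · have hnhds : Icc (-t₀) t₀ ∈ 𝓝 (0 : ℝ) := Icc_mem_nhds (by linarith) ht₀
    have h0 : |(0 : ℝ)| ≤ t₀ := by rw [abs_zero]; exact ht₀.le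
    -- All displaced points stay in the compact set `Q`, where the density and its derivative are
    -- bounded. A constant dominates on `W`, which has finite measure.
    have key := (hasDerivAt_integral_of_dominated_loc_of_deriv_le (𝕜 := ℝ) (E := ℝ)
      (μ := volume.restrict W) (F := fun t y => ρ (displace f e t y) * (1 + t * fderiv ℝ f y e))
      (F' := fun t y => fderiv ℝ ρ (displace f e t y) e * f y * (1 + t * fderiv ℝ f y e) +
          ρ (displace f e t y) * fderiv ℝ f y e)
      (bound := fun _ => A' * B * (1 + t₀ * B') + A * B') hnhds
      (by filter_upwards [hnhds] with t ht using hmeasF t (habs.1 ht)) (hint 0 h0) ?_ ?_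
      (hconst _) ?_).2
    · refine key.congr_deriv ?_
      refine setIntegral_congr_fun hW fun y hy => ?_
      have hyO := hQO (hRQ (hWR hy))
      have h1 : HasFDerivAt ρ (fderiv ℝ ρ y) y :=
        ((hρ.contDiffAt (hO.mem_nhds hyO)).differentiableAt one_ne_zero).hasFDerivAt
      have h2 : HasFDerivAt f (fderiv ℝ f y) y := (hf.differentiable one_ne_zero y).hasFDerivAt
      have h3 := (h1.mul h2).fderiv
      have h4 : fderiv ℝ (fun y => ρ y * f y) y = ρ y • fderiv ℝ f y + f y • fderiv ℝ ρ y := h3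
      simp only [h4, displace_zero, zero_mul, add_zero, mul_one,
        add_apply, smul_apply, smul_eq_mul]
      ring
    · refine ContinuousOn.aestronglyMeasurable ?_ hW
      simp only [displace_zero, zero_mul, add_zero, mul_one]
      have hWO : W ⊆ O := hWR.trans (hRQ.trans hQO)
      exact ((hρd.mono hWO).mul hf.continuous.continuousOn).add
        ((hρ.continuousOn.mono hWO).mul hfd.continuousOn)
    · refine (ae_restrict_iff' hW).2 (Eventually.of_forall fun y hy t ht => ?_)
      have hyQ := hRQ (hmem t (habs.1 ht) y (hWR hy))
      have h1 := hA _ hyQ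
      have h2 := hA' _ hyQ
      have h3 := hB y
      have h4 := hB' y (hRQ (hWR hy))
      have h5 : ‖1 + t * fderiv ℝ f y e‖ ≤ 1 + t₀ * B' := by
        refine (norm_add_le _ _).trans ?_
        rw [norm_one, norm_mul]
        gcongr
        exact habs.1 ht
      have hA0 : 0 ≤ A := (norm_nonneg _).trans h1
      have hA'0 : 0 ≤ A' := (norm_nonneg _).trans h2
      have hB0 : 0 ≤ B := (norm_nonneg _).trans h3
      refine (norm_add_le _ _).trans ?_
      rw [norm_mul, norm_mul, norm_mul]
      gcongr
    · exact (ae_restrict_iff' hW).2 (Eventually.of_forall fun y hy t ht =>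
        hderF t (habs.1 ht) y hy)

/-- The cross term is estimated by `2ab ≤ a² + b²` and the quadratic one by `t² ≤ |t| t₀`, so that
the increase is linear in `|t|`. -/
lemma sq_add_mul_le {x E q t t₀ B : ℝ} (ht : |t| ≤ t₀) (hq : q ^ 2 ≤ B) :
    (x + t * q * E) ^ 2 ≤ x ^ 2 + |t| * ((1 + t₀) * E ^ 2 * B + x ^ 2) := by
  have ht0 := abs_nonneg t
  have h1 : 2 * (t * (q * E) * x) ≤ |t| * ((q * E) ^ 2 + x ^ 2) := by
    have h2 : t * (2 * (q * E * x)) ≤ |t| * |2 * (q * E * x)| := by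
      rw [← abs_mul]; exact le_abs_self _
    have h3 : |2 * (q * E * x)| ≤ (q * E) ^ 2 + x ^ 2 := by
      rw [abs_le]
      constructor <;> nlinarith [sq_nonneg (q * E + x), sq_nonneg (q * E - x)]
    have h4 := mul_le_mul_of_nonneg_left h3 ht0
    have h5 : 2 * (t * (q * E) * x) = t * (2 * (q * E * x)) := by ring
    linarith
  have h4 : (t * q * E) ^ 2 ≤ |t| * t₀ * (q * E) ^ 2 := by
    have : t ^ 2 ≤ |t| * t₀ := by rw [← sq_abs, sq]; exact mul_le_mul_of_nonneg_left ht ht0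
    calc (t * q * E) ^ 2 = t ^ 2 * (q * E) ^ 2 := by ring
      _ ≤ _ := mul_le_mul_of_nonneg_right this (sq_nonneg _)
  have h5 : (q * E) ^ 2 ≤ E ^ 2 * B := by
    rw [mul_pow, mul_comm]; exact mul_le_mul_of_nonneg_left hq (sq_nonneg _)
  have h6 : |t| * (1 + t₀) * (q * E) ^ 2 ≤ |t| * (1 + t₀) * (E ^ 2 * B) :=
    mul_le_mul_of_nonneg_left h5 (by have := ht0.trans ht; positivity)
  have h7 : (x + t * q * E) ^ 2 = x ^ 2 + 2 * (t * (q * E) * x) + (t * q * E) ^ 2 := by ring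
  have h8 : |t| * ((1 + t₀) * E ^ 2 * B + x ^ 2) =
    |t| * (1 + t₀) * (E ^ 2 * B) + |t| * x ^ 2 := by ring
  rw [h7, h8]
  linarith

/-- The change of the length of a vector under a perturbation of the vector and of the metric. -/
lemma sqrt_metric_le {v₁ v₂ e₁ e₂ q t t₀ g g' g₀ g₁ L b : ℝ} (ht : |t| ≤ t₀) (hg₀ : 0 < g₀)
    (hg : g₀ ≤ g) (hg' : 0 < g') (hg'1 : g' ≤ g₁) (hL : 0 ≤ L) (hlip : g' ≤ g + L * |t|)
    (hb : 0 ≤ b) (hq : q ^ 2 ≤ b * (v₁ ^ 2 + g * v₂ ^ 2)) :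
    Real.sqrt ((v₁ + t * q * e₁) ^ 2 + g' * (v₂ + t * q * e₂) ^ 2) ≤
      (1 + (((1 + t₀) * e₁ ^ 2 * b + 1) + L / g₀ + g₁ * ((1 + t₀) * e₂ ^ 2 * b + 1 / g₀)) * |t|) *
        Real.sqrt (v₁ ^ 2 + g * v₂ ^ 2) := by
  set N := v₁ ^ 2 + g * v₂ ^ 2 with hN
  have ht0 := abs_nonneg t
  have ht₀ := ht0.trans ht
  have hgpos := hg₀.trans_le hg
  have hg₁ := hg'.le.trans hg'1
  have hN0 : 0 ≤ N := by positivity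
  have hv1 : v₁ ^ 2 ≤ N := by
    have := mul_nonneg hgpos.le (sq_nonneg v₂)
    linarith
  have hv2 : v₂ ^ 2 ≤ N / g₀ := by
    rw [le_div_iff₀ hg₀]
    have := mul_le_mul_of_nonneg_right hg (sq_nonneg v₂)
    nlinarith [sq_nonneg v₁]
  have hw1 := sq_add_mul_le (x := v₁) (E := e₁) ht hq
  have hw2 := sq_add_mul_le (x := v₂) (E := e₂) ht hq
  have hw1' : (v₁ + t * q * e₁) ^ 2 ≤ v₁ ^ 2 + |t| * (((1 + t₀) * e₁ ^ 2 * b + 1) * N) := by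
    have h1 := mul_le_mul_of_nonneg_left hv1 ht0
    have h2 : |t| * (((1 + t₀) * e₁ ^ 2 * b + 1) * N) =
      |t| * ((1 + t₀) * e₁ ^ 2 * (b * N)) + |t| * N := by ring
    have h3 : |t| * ((1 + t₀) * e₁ ^ 2 * (b * N) + v₁ ^ 2) =
      |t| * ((1 + t₀) * e₁ ^ 2 * (b * N)) + |t| * v₁ ^ 2 := by ring
    linarith
  have hw2' : g' * (v₂ + t * q * e₂) ^ 2 ≤ g * v₂ ^ 2 + |t| * ((L / g₀) * N) +
      |t| * (g₁ * ((1 + t₀) * e₂ ^ 2 * b + 1 / g₀) * N) := by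
    have h1 := mul_le_mul_of_nonneg_left hw2 hg'.le
    have h2 : g' * v₂ ^ 2 ≤ g * v₂ ^ 2 + |t| * (L / g₀ * N) := by
      have h3 := mul_le_mul_of_nonneg_right hlip (sq_nonneg v₂)
      have h4 : L * |t| * v₂ ^ 2 ≤ L * |t| * (N / g₀) :=
        mul_le_mul_of_nonneg_left hv2 (by positivity)
      have h5 : L * |t| * (N / g₀) = |t| * (L / g₀ * N) := by ring
      rw [add_mul] at h3
      linarith
    have h3 : g' * (|t| * ((1 + t₀) * e₂ ^ 2 * (b * N) + v₂ ^ 2)) ≤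
        g₁ * (|t| * ((1 + t₀) * e₂ ^ 2 * (b * N) + N / g₀)) := by
      gcongr
    have h4 : g₁ * (|t| * ((1 + t₀) * e₂ ^ 2 * (b * N) + N / g₀)) =
        |t| * (g₁ * ((1 + t₀) * e₂ ^ 2 * b + 1 / g₀) * N) := by ring
    rw [mul_add] at h1
    linarith
  set C := ((1 + t₀) * e₁ ^ 2 * b + 1) + L / g₀ + g₁ * ((1 + t₀) * e₂ ^ 2 * b + 1 / g₀)
    with hC
  have hC0 : 0 ≤ C := by positivity
  have h1 : (v₁ + t * q * e₁) ^ 2 + g' * (v₂ + t * q * e₂) ^ 2 ≤ (1 + C * |t|) * N := by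
    have : (1 + C * |t|) * N = N + |t| * (((1 + t₀) * e₁ ^ 2 * b + 1) * N) +
      |t| * ((L / g₀) * N) + |t| * (g₁ * ((1 + t₀) * e₂ ^ 2 * b + 1 / g₀) * N) := by
      rw [hC]; ring
    rw [this]
    linarith
  -- Enlarging `1 + C|t|` to its square permits taking the root while the bound stays linear in
  -- `|t|`.
  have htot : (v₁ + t * q * e₁) ^ 2 + g' * (v₂ + t * q * e₂) ^ 2 ≤ (1 + C * |t|) ^ 2 * N := by
    refine h1.trans (mul_le_mul_of_nonneg_right ?_ hN0)
    exact le_self_pow₀ (le_add_of_nonneg_right (mul_nonneg hC0 ht0)) two_ne_zero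
  calc _ ≤ Real.sqrt ((1 + C * |t|) ^ 2 * N) := Real.sqrt_le_sqrt htot
    _ = (1 + C * |t|) * Real.sqrt N := by
      rw [Real.sqrt_mul (sq_nonneg _), Real.sqrt_sq (by positivity)]

/-- A small displacement changes the lengths of vectors, with respect to a metric
`dx² + G dy²`, by small factors only. -/
lemma exists_speed_displace_le {O Q R : Set (ℝ × ℝ)} {G f : ℝ × ℝ → ℝ} {e : ℝ × ℝ}
    (hO : IsOpen O) (hG : ContDiffOn ℝ 1 G O) (hGpos : ∀ y ∈ O, 0 < G y) (hQ : IsCompact Q)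
    (hQO : Q ⊆ O) (hRQ : R ⊆ Q) (hf : ContDiff ℝ 1 f) (hfc : HasCompactSupport f)
    {t₀ : ℝ} (ht₀ : 0 < t₀) (hmem : ∀ t, |t| ≤ t₀ → ∀ y ∈ R, displace f e t y ∈ R) :
    ∃ C ≥ 0, ∀ t, |t| ≤ t₀ → ∀ y ∈ R, ∀ v w : ℝ × ℝ, w = v + (t * fderiv ℝ f y v) • e →
      Real.sqrt (w.1 ^ 2 + G (displace f e t y) * w.2 ^ 2) ≤
        (1 + C * |t|) * Real.sqrt (v.1 ^ 2 + G y * v.2 ^ 2) := by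
  have hGd : ContinuousOn (fun y => fderiv ℝ G y e) O :=
    (hG.continuousOn_fderiv_of_isOpen hO le_rfl).clm_apply continuousOn_const
  obtain ⟨g₁, hg₁⟩ := hQ.exists_bound_of_continuousOn (hG.continuousOn.mono hQO)
  obtain ⟨A', hA'⟩ := hQ.exists_bound_of_continuousOn (hGd.mono hQO)
  obtain ⟨B, hB⟩ := hfc.exists_bound_of_continuous hf.continuous
  obtain ⟨B', hB'⟩ := hQ.exists_bound_of_continuousOn
    (hf.continuous_fderiv one_ne_zero).continuousOn
  obtain ⟨g₀, hg₀, hg₀Q⟩ : ∃ g₀ > 0, ∀ y ∈ Q, g₀ ≤ G y := by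
    rcases Q.eq_empty_or_nonempty with rfl | hne
    · exact ⟨1, one_pos, by simp⟩
    · obtain ⟨z, hz, hmin⟩ := hQ.exists_isMinOn hne (hG.continuousOn.mono hQO)
      exact ⟨G z, hGpos z (hQO hz), fun y hy => hmin hy⟩
  set L := |A'| * |B| with hL
  set b := B' ^ 2 * (1 + 1 / g₀) with hb
  have hL0 : 0 ≤ L := by positivity
  have hb0 : 0 ≤ b := by positivity
  have hg1 : 0 ≤ |g₁| := abs_nonneg _
  refine ⟨((1 + t₀) * e.1 ^ 2 * b + 1) + L / g₀ + |g₁| * ((1 + t₀) * e.2 ^ 2 * b + 1 / g₀),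
    by positivity, ?_⟩
  intro t ht y hy v w hw
  set G' := G (displace f e t y) with hG'
  have hyQ := hRQ hy
  have hG0 := hg₀Q y hyQ
  have hG'0 : 0 < G' := hGpos _ (hQO (hRQ (hmem t ht y hy)))
  have hG'1 : G' ≤ |g₁| := by
    have := hg₁ _ (hRQ (hmem t ht y hy))
    exact (le_abs_self _).trans (this.trans (le_abs_self _))
  -- Mean value inequality along the path `s ↦ displace f e s y`, which stays in `Q`.
  have hlip : G' ≤ G y + L * |t| := by
    have hder : ∀ s ∈ Icc (-t₀) t₀, HasDerivWithinAt (fun s => G (displace f e s y))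
        (fderiv ℝ G (displace f e s y) (f y • e)) (Icc (-t₀) t₀) s := by
      intro s hs
      have hs' := hQO (hRQ (hmem s (abs_le.2 hs) y hy))
      have h1 : HasFDerivAt G (fderiv ℝ G (displace f e s y)) (displace f e s y) :=
        ((hG.contDiffAt (hO.mem_nhds hs')).differentiableAt one_ne_zero).hasFDerivAt
      exact (h1.comp_hasDerivAt s hasDerivAt_displace).hasDerivWithinAt
    have hbd : ∀ s ∈ Icc (-t₀) t₀, ‖fderiv ℝ G (displace f e s y) (f y • e)‖ ≤ L := by
      intro s hs
      rw [map_smul, norm_smul, mul_comm]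
      exact mul_le_mul ((hA' _ (hRQ (hmem s (abs_le.2 hs) y hy))).trans (le_abs_self _))
        ((hB y).trans (le_abs_self _)) (norm_nonneg _) (abs_nonneg _)
    have := (convex_Icc (-t₀) t₀).norm_image_sub_le_of_norm_hasDerivWithin_le hder hbd
      (x := 0) (y := t) ⟨by linarith, ht₀.le⟩ (abs_le.1 ht)
    rw [displace_zero, sub_zero, Real.norm_eq_abs, Real.norm_eq_abs] at this
    linarith [le_abs_self (G (displace f e t y) - G y)]
  set q := fderiv ℝ f y v with hq
  have hq2 : q ^ 2 ≤ b * (v.1 ^ 2 + G y * v.2 ^ 2) := by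
    have h1 : |q| ≤ B' * ‖v‖ :=
      ((fderiv ℝ f y).le_opNorm v).trans (mul_le_mul_of_nonneg_right (hB' y hyQ) (norm_nonneg _))
    have h2 : ‖v‖ ^ 2 ≤ v.1 ^ 2 + v.2 ^ 2 := by
      rcases max_choice ‖v.1‖ ‖v.2‖ with h3 | h3
      · rw [Prod.norm_def, h3, Real.norm_eq_abs, sq_abs]; linarith [sq_nonneg v.2]
      · rw [Prod.norm_def, h3, Real.norm_eq_abs, sq_abs]; linarith [sq_nonneg v.1]
    have h3 : q ^ 2 ≤ (B' * ‖v‖) ^ 2 := by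
      rw [← sq_abs q]; exact pow_le_pow_left₀ (abs_nonneg _) h1 2
    have h4 : v.1 ^ 2 + v.2 ^ 2 ≤ (1 + 1 / g₀) * (v.1 ^ 2 + G y * v.2 ^ 2) := by
      have h5 : v.2 ^ 2 ≤ 1 / g₀ * (G y * v.2 ^ 2) := by
        rw [one_div, ← mul_assoc, inv_mul_eq_div]
        exact le_mul_of_one_le_left (sq_nonneg _) ((one_le_div hg₀).2 hG0)
      have h6 : 0 ≤ 1 / g₀ * v.1 ^ 2 := by positivity
      have h7 : 0 ≤ G y * v.2 ^ 2 := mul_nonneg (hg₀.le.trans hG0) (sq_nonneg _)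
      have h8 : (1 + 1 / g₀) * (v.1 ^ 2 + G y * v.2 ^ 2) = v.1 ^ 2 + G y * v.2 ^ 2 +
        1 / g₀ * v.1 ^ 2 + 1 / g₀ * (G y * v.2 ^ 2) := by ring
      linarith
    calc q ^ 2 ≤ B' ^ 2 * ‖v‖ ^ 2 := by rw [← mul_pow]; exact h3
      _ ≤ B' ^ 2 * ((1 + 1 / g₀) * (v.1 ^ 2 + G y * v.2 ^ 2)) :=
        mul_le_mul_of_nonneg_left (h2.trans h4) (sq_nonneg _)
      _ = b * (v.1 ^ 2 + G y * v.2 ^ 2) := by rw [hb]; ring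
  rw [hw]
  exact sqrt_metric_le ht hg₀ hG0 hG'0 hG'1 hL0 hlip hb0 hq2

end ConicalSurface
end

/-! ### Transplanting a displacement to the surface: effect on curves and areas. -/

noncomputable section
namespace ConicalSurface

variable {M : Type*} [TopologicalSpace M] [ChartedSpace (EuclideanHalfSpace 2) M]
  [IsManifold (𝓡∂ 2) ∞ M]
  [RiemannianBundle (fun x : M => TangentSpace (𝓡∂ 2) x)] {ι : Type*}

open Classical in
/-- The map of the surface given in polar coordinates by `Ψ` on `R`, and the identity elsewhere. -/
def transplant (S : ConicalSurface M ι) (p : ℝ × ℝ → M) (R : Set (ℝ × ℝ)) (Ψ : ℝ × ℝ → ℝ × ℝ)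
    (z : S.Completion) : S.Completion :=
  if hz : ∃ y ∈ R, z = S.reg (p y) then S.reg (p (Ψ hz.choose)) else z

namespace PolarChart

variable {S : ConicalSurface M ι} {i : ι} {p : ℝ × ℝ → M} {H : ℝ × ℝ → ℝ} {α : ℝ}
  {R K : Set (ℝ × ℝ)} {Ψ : ℝ × ℝ → ℝ × ℝ}

lemma transplant_reg (hinj : InjOn p R) {y : ℝ × ℝ} (hy : y ∈ R) :
    S.transplant p R Ψ (S.reg (p y)) = S.reg (p (Ψ y)) := by
  have hz : ∃ y' ∈ R, S.reg (p y) = S.reg (p y') := ⟨y, hy, rfl⟩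
  rw [transplant, dif_pos hz]
  rw [hinj hz.choose_spec.1 hy (S.reg_injective hz.choose_spec.2).symm]

lemma transplant_of_notMem {z : S.Completion} (hz : ¬ ∃ y ∈ R, z = S.reg (p y)) :
    S.transplant p R Ψ z = z := dif_neg hz

/-- Off the compact `K` the map is the identity even inside `R`. This is an open condition, so
nothing can go wrong at the boundary of `R`. -/
lemma transplant_of_notMem_compact (hinj : InjOn p R) (hid : ∀ y ∉ K, Ψ y = y)
    {z : S.Completion} (hz : ¬ ∃ y ∈ K, z = S.reg (p y)) : S.transplant p R Ψ z = z := by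
  by_cases h : ∃ y ∈ R, z = S.reg (p y)
  · obtain ⟨y, hy, rfl⟩ := h
    rw [transplant_reg hinj hy, hid y fun hyK => hz ⟨y, hyK, rfl⟩]
  · exact transplant_of_notMem h

/-- On `K` the radius stays between two constants in `(0, 1)`. This keeps the set away from the tip
`i` as well as from the other tips, which have radius `1`. In `M` the image is compact, hence
closed. -/
lemma isClosed_reg_image [T2Space M] (h : PolarChart S i p H α) (hK : IsCompact K)
    (hKs : K ⊆ strip) : IsClosed {z : S.Completion | ∃ y ∈ K, z = S.reg (p y)} := by
  rw [← isOpen_compl_iff, isOpen_iff_mem_nhds]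
  intro z hz
  have hcl : IsClosed (p '' K) := (hK.image_of_continuousOn (h.continuousOn.mono hKs)).isClosed
  have hpos : ∃ a > 0, ∀ y ∈ K, a ≤ y.1 := by
    rcases K.eq_empty_or_nonempty with rfl | hne
    · exact ⟨1, one_pos, by simp⟩
    · obtain ⟨y₀, hy₀, hmin⟩ := hK.exists_isMinOn hne continuous_fst.continuousOn
      exact ⟨y₀.1, (mem_strip.1 (hKs hy₀)).1, fun y hy => hmin hy⟩
  obtain ⟨a, ha, haK⟩ := hpos
  rcases S.reg_or_tip z with ⟨x, rfl⟩ | ⟨j, rfl⟩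
  · rw [← S.map_reg_nhds]
    have hx : x ∉ p '' K := by
      rintro ⟨y, hy, rfl⟩
      exact hz ⟨y, hy, rfl⟩
    rw [mem_map]
    filter_upwards [hcl.isOpen_compl.mem_nhds hx] with w hw
    rintro ⟨y, hy, he⟩
    exact hw ⟨y, hy, (S.reg_injective he).symm⟩
  · by_cases hj : j = i
    · subst hj
      filter_upwards [(h.isOpen_radius_lt a).mem_nhds (by simpa using ha)] with w hw
      rintro ⟨y, hy, rfl⟩
      rw [h.radius_apply (hKs hy)] at hw
      exact (haK y hy).not_gt hw
    · have hb : ∃ b < 1, ∀ y ∈ K, y.1 ≤ b := by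
        rcases K.eq_empty_or_nonempty with rfl | hne
        · exact ⟨0, one_pos, by simp⟩
        · obtain ⟨y₀, hy₀, hmax⟩ := hK.exists_isMaxOn hne continuous_fst.continuousOn
          exact ⟨y₀.1, (mem_strip.1 (hKs hy₀)).2, fun y hy => hmax hy⟩
      obtain ⟨b, hb, hbK⟩ := hb
      filter_upwards [(h.isOpen_lt_radius b).mem_nhds
        (by rw [mem_ofPred_eq, S.radius_tip_of_ne hj]; exact hb)] with w hw
      rintro ⟨y, hy, rfl⟩
      rw [h.radius_apply (hKs hy)] at hw
      exact (hbK y hy).not_gt hw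

lemma continuous_transplant [T2Space M] (h : PolarChart S i p H α) (hinj : InjOn p R)
    (hR : IsOpen R) (hRs : R ⊆ strip) (hK : IsCompact K) (hKR : K ⊆ R) (hΨ : Continuous Ψ)
    (hΨR : ∀ y ∈ R, Ψ y ∈ R) (hid : ∀ y ∉ K, Ψ y = y) :
    Continuous (S.transplant p R Ψ) := by
  rw [continuous_iff_continuousAt]
  intro z
  by_cases hz : ∃ y ∈ K, z = S.reg (p y)
  · obtain ⟨y, hyK, rfl⟩ := hz
    have hy := hKR hyK
    have h1 : ContinuousAt (fun y => S.reg (p (Ψ y))) y :=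
      ContinuousAt.comp (g := fun y => S.reg (p y)) (h.continuousAt_reg (hRs (hΨR y hy)))
        hΨ.continuousAt
    rw [ContinuousAt, ← S.map_reg_nhds, ← h.map_nhds (hRs hy), tendsto_map'_iff, tendsto_map'_iff,
      transplant_reg hinj hy]
    refine h1.tendsto.congr' ?_
    filter_upwards [hR.mem_nhds hy] with w hw using (transplant_reg hinj hw).symm
  · refine continuousAt_id.congr ?_
    filter_upwards [(h.isClosed_reg_image hK (hKR.trans hRs)).isOpen_compl.mem_nhds hz] with w hw
    exact (transplant_of_notMem_compact hinj hid hw).symm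

/-- The homeomorphism of the surface given in polar coordinates by a homeomorphism with compact
support. -/
lemma exists_transplant_homeomorph [T2Space M] (h : PolarChart S i p H α) (hinj : InjOn p R)
    (hR : IsOpen R) (hRs : R ⊆ strip) (hK : IsCompact K) (hKR : K ⊆ R)
    (Ψ : (ℝ × ℝ) ≃ₜ (ℝ × ℝ)) (hΨR : ∀ y, Ψ y ∈ R ↔ y ∈ R) (hid : ∀ y ∉ K, Ψ y = y) :
    ∃ T : S.Completion ≃ₜ S.Completion, ∀ z, T z = S.transplant p R Ψ z := by
  have hΨR' : ∀ y, Ψ.symm y ∈ R ↔ y ∈ R := fun y => by rw [← hΨR, Ψ.apply_symm_apply]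
  have hid' : ∀ y ∉ K, Ψ.symm y = y := fun y hy => by
    rw [Homeomorph.symm_apply_eq]; exact (hid y hy).symm
  have hinv : ∀ (Ψ₁ Ψ₂ : ℝ × ℝ → ℝ × ℝ), (∀ y, Ψ₁ (Ψ₂ y) = y) → (∀ y ∈ R, Ψ₂ y ∈ R) → ∀ z,
      S.transplant p R Ψ₁ (S.transplant p R Ψ₂ z) = z := by
    intro Ψ₁ Ψ₂ h12 h2 z
    by_cases hz : ∃ y ∈ R, z = S.reg (p y)
    · obtain ⟨y, hy, rfl⟩ := hz
      rw [transplant_reg hinj hy, transplant_reg hinj (h2 y hy), h12]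
    · rw [transplant_of_notMem hz, transplant_of_notMem hz]
  exact ⟨{
    toFun := S.transplant p R Ψ
    invFun := S.transplant p R Ψ.symm
    left_inv := hinv _ _ Ψ.symm_apply_apply fun y hy => (hΨR y).2 hy
    right_inv := hinv _ _ Ψ.apply_symm_apply fun y hy => (hΨR' y).2 hy
    continuous_toFun := h.continuous_transplant hinj hR hRs hK hKR Ψ.continuous
      (fun y hy => (hΨR y).2 hy) hid
    continuous_invFun := h.continuous_transplant hinj hR hRs hK hKR Ψ.symm.continuous
      (fun y hy => (hΨR' y).2 hy) hid' }, fun z => rfl⟩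

/-- The effect of a displacement on curves. -/
lemma isCurve_transplant [Nonempty M] [T2Space M] (h : PolarChart S i p H α) (hinj : InjOn p R)
    (hR : IsOpen R) (hRs : R ⊆ strip) {f : ℝ × ℝ → ℝ} {e : ℝ × ℝ} {t₁ : ℝ} (hf : ContDiff ℝ 1 f)
    (hfc : HasCompactSupport f) (hfR : tsupport f ⊆ R) (hmem : ∀ y ∈ R, displace f e t₁ y ∈ R)
    {T : S.Completion ≃ₜ S.Completion} (hT : ∀ z, T z = S.transplant p R (displace f e t₁) z)
    {k : ℝ} (hk1 : 1 ≤ k) (hk : ∀ y ∈ R, ∀ v w : ℝ × ℝ, w = v + (t₁ * fderiv ℝ f y v) • e →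
      Real.sqrt (w.1 ^ 2 + (displace f e t₁ y).1 ^ 2 * H (displace f e t₁ y) * w.2 ^ 2) ≤
        k * Real.sqrt (v.1 ^ 2 + y.1 ^ 2 * H y * v.2 ^ 2))
    {c : ℝ → S.Completion} (hc : S.IsCurve c) :
    S.IsCurve (fun t => T (c t)) ∧
      S.curveLength (fun t => T (c t)) ≤ ENNReal.ofReal k * S.curveLength c := by
  obtain ⟨F, hF, hFc⟩ := hc.piecewise_contMDiff
  have hid : ∀ y ∉ tsupport f, displace f e t₁ y = y := fun y hy =>
    displace_of_eq_zero (image_eq_zero_of_notMem_tsupport hy)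
  have hmain : ∀ t ∈ Ioo (0 : ℝ) 1 \ F,
      (T (c t) ∈ range S.reg ∧
        ContMDiffAt 𝓘(ℝ, ℝ) (𝓡∂ 2) 1 (S.toReg ∘ fun t => T (c t)) t) ∧
      S.speed (fun t => T (c t)) t ≤ ENNReal.ofReal k * S.speed c t := by
    intro t ht
    have hct : ContinuousAt c t := hc.continuousOn.continuousAt
      (Icc_mem_nhds ht.1.1 ht.1.2)
    by_cases hz : ∃ y ∈ tsupport f, c t = S.reg (p y)
    · obtain ⟨y₀, hy₀, he⟩ := hz
      have hy₀R := hfR hy₀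
      obtain ⟨y, hyC, hyt, hev⟩ := h.exists_lift_curve hF hFc ht (hRs hy₀R) he
      have hyR : ∀ᶠ s in 𝓝 t, y s ∈ R :=
        hyC.continuousAt.eventually (hR.mem_nhds (by rw [hyt]; exact hy₀R))
      have hev' : ∀ᶠ s in 𝓝 t, T (c s) = S.reg (p (displace f e t₁ (y s))) := by
        filter_upwards [hev, hyR] with s hs hsR
        rw [hT, hs.2, transplant_reg hinj hsR]
      have hDC : ContDiffAt ℝ 1 (fun s => displace f e t₁ (y s)) t :=
        (contDiff_displace hf).contDiffAt.comp t hyC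
      have hyd := (hyC.differentiableAt one_ne_zero).hasDerivAt
      have hDd : HasDerivAt (fun s => displace f e t₁ (y s))
          (deriv y t + (t₁ * fderiv ℝ f (y t) (deriv y t)) • e) t :=
        (hasFDerivAt_displace (e := e) (t := t₁) hf (y := y t)).comp_hasDerivAt t hyd
      have hDR : displace f e t₁ (y t) ∈ strip := hRs (hmem _ hyR.self_of_nhds)
      have hev1 : ∀ᶠ s in 𝓝 t, (S.toReg ∘ fun t => T (c t)) s = p (displace f e t₁ (y s)) := by
        filter_upwards [hev'] with s hs
        rw [Function.comp_apply, hs, S.toReg_reg]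
      have hev2 : ∀ᶠ s in 𝓝 t, (S.toReg ∘ c) s = p (y s) := by
        filter_upwards [hev] with s hs
        rw [Function.comp_apply, hs.2, S.toReg_reg]
      refine ⟨⟨⟨_, hev'.self_of_nhds.symm⟩,
        (h.contMDiffAt_comp (y := fun s => displace f e t₁ (y s)) hDR hDC).congr_of_eventuallyEq hev1⟩, ?_⟩
      rw [speed, speed, h.norm_mfderiv_curve (y := fun s => displace f e t₁ (y s)) hDR hDd hev1,
        h.norm_mfderiv_curve hev.self_of_nhds.1 hyd hev2,
        ← ENNReal.ofReal_mul (zero_le_one.trans hk1)]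
      exact ENNReal.ofReal_le_ofReal (hk (y t) hyR.self_of_nhds _ _ rfl)
    · have hev : (fun t => T (c t)) =ᶠ[𝓝 t] c := by
        have h1 := hct.eventually
          ((h.isClosed_reg_image hfc (hfR.trans hRs)).isOpen_compl.mem_nhds hz)
        filter_upwards [h1] with s hs
        rw [hT, transplant_of_notMem_compact hinj hid hs]
      refine ⟨⟨?_, ?_⟩, ?_⟩
      · have := hev.self_of_nhds
        simp only at this
        rw [this]; exact (hFc t ht).1
      · refine (hFc t ht).2.congr_of_eventuallyEq ?_
        filter_upwards [hev] with s hs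
        rw [Function.comp_apply, hs, Function.comp_apply]
      · rw [S.speed_congr hev]
        exact le_mul_of_one_le_left zero_le (by rwa [ENNReal.one_le_ofReal])
  have hlen : S.curveLength (fun t => T (c t)) ≤ ENNReal.ofReal k * S.curveLength c := by
    rw [S.curveLength_eq, S.curveLength_eq, ← lintegral_const_mul' _ _ ENNReal.ofReal_ne_top]
    refine setLIntegral_mono_ae' measurableSet_Ioo ?_
    have : ∀ᵐ t : ℝ, t ∉ F := measure_eq_zero_iff_ae_notMem.1 (hF.measure_zero volume)
    filter_upwards [this] with t ht ht01 using (hmain t ⟨ht01, ht⟩).2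
  refine ⟨⟨T.continuous.comp_continuousOn hc.continuousOn, ⟨F, hF, fun t ht => (hmain t ht).1⟩,
    hlen.trans_lt (ENNReal.mul_lt_top ENNReal.ofReal_lt_top hc.length_lt_top), ?_, ?_⟩, hlen⟩
  · obtain ⟨t, ht, hne⟩ := hc.nonconstant
    exact ⟨t, ht, fun he => hne (T.injective he)⟩
  · have hb : ∀ z ∈ S.boundary, T z ∈ S.boundary := by
      intro z hz
      rw [hT, transplant_of_notMem]
      · exact hz
      · rintro ⟨y, hy, rfl⟩
        have := h.notMem_boundary hz
        rw [h.radius_apply (hRs hy)] at this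
        exact (mem_strip.1 (hRs hy)).2.ne this
    rcases hc.closed_or_boundary with h01 | ⟨h0, h1⟩
    · exact Or.inl (by simp only [h01])
    · exact Or.inr ⟨hb _ h0, hb _ h1⟩

variable [MeasurableSpace M] [BorelSpace M]

lemma riemannianArea_image (h : PolarChart S i p H α) {φ₁ : ℝ} (hRw : R ⊆ window φ₁ α)
    {Z : Set (ℝ × ℝ)} (hZ : IsOpen Z) (hZR : Z ⊆ R) :
    riemannianArea M (p '' Z) = ∫⁻ y in Z, ENNReal.ofReal (areaDensity H y) := by
  have hZs : Z ⊆ strip := hZR.trans (hRw.trans (window_subset _ _))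
  rw [h.riemannianArea_eq φ₁ (h.isOpen_image hZ hZs).measurableSet (image_mono hZs)]
  congr 2
  ext y
  constructor
  · rintro ⟨hy, z, hz, he⟩
    rwa [← h.injOn_window φ₁ (hRw (hZR hz)) hy he]
  · exact fun hy => ⟨hRw (hZR hy), y, hy, rfl⟩

/-- The effect of a displacement on areas. -/
lemma area_transplant (h : PolarChart S i p H α) {φ₁ : ℝ} (hRw : R ⊆ window φ₁ α)
    (hR : IsOpen R) {f : ℝ × ℝ → ℝ} {e : ℝ × ℝ} {t₁ : ℝ} (hf : ContDiff ℝ 1 f)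
    {Ψ : (ℝ × ℝ) ≃ₜ (ℝ × ℝ)} (hΨ : ∀ y, Ψ y = displace f e t₁ y) (hΨR : ∀ y, Ψ y ∈ R ↔ y ∈ R)
    {T : S.Completion ≃ₜ S.Completion} (hT : ∀ z, T z = S.transplant p R (displace f e t₁) z)
    (hdet : ∀ y, |t₁ * fderiv ℝ f y e| ≤ 1 / 2) {W : Set S.Completion} (hW : IsOpen W)
    (hint : IntegrableOn (fun y => areaDensity H (displace f e t₁ y) *
      (1 + t₁ * fderiv ℝ f y e)) (R ∩ {y | S.reg (p y) ∈ W})) :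
    S.area (T '' W) = riemannianArea M ({x | S.reg x ∈ W} \ p '' R) +
      ENNReal.ofReal (∫ y in R ∩ {y | S.reg (p y) ∈ W},
        areaDensity H (displace f e t₁ y) * (1 + t₁ * fderiv ℝ f y e)) := by
  have hRs : R ⊆ strip := hRw.trans (window_subset _ _)
  have hinj : InjOn p R := (h.injOn_window φ₁).mono hRw
  set X : Set M := {x | S.reg x ∈ W} with hX
  have hXo : IsOpen X := hW.preimage S.isOpenEmbedding_reg.continuous
  set Z : Set (ℝ × ℝ) := R ∩ {y | S.reg (p y) ∈ W} with hZ
  have hZo : IsOpen Z := (h.continuousOn.mono hRs).isOpen_inter_preimage hR hXo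
  have hΨZ : IsOpen (Ψ '' Z) := Ψ.isOpenMap _ hZo
  have hΨZR : Ψ '' Z ⊆ R := by
    rintro _ ⟨y, hy, rfl⟩
    exact (hΨR y).2 hy.1
  -- Points outside `p '' R` do not move, and the rest of `W` moves by `Ψ` within `R`.
  have hset : {x | S.reg x ∈ T '' W} = (X \ p '' R) ∪ p '' (Ψ '' Z) := by
    ext x
    constructor
    · rintro ⟨z, hz, he⟩
      by_cases hzR : ∃ y ∈ R, z = S.reg (p y)
      · obtain ⟨y, hy, rfl⟩ := hzR
        right
        rw [hT, transplant_reg hinj hy] at he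
        exact ⟨Ψ y, ⟨y, ⟨hy, hz⟩, rfl⟩, by rw [hΨ, S.reg_injective he]⟩
      · left
        rw [hT, transplant_of_notMem hzR] at he
        subst he
        exact ⟨hz, fun ⟨y, hy, he⟩ => hzR ⟨y, hy, by rw [he]⟩⟩
    · rintro (⟨hx, hxR⟩ | ⟨_, ⟨y, hy, rfl⟩, rfl⟩)
      · refine ⟨S.reg x, hx, ?_⟩
        rw [hT, transplant_of_notMem]
        rintro ⟨y, hy, he⟩
        exact hxR ⟨y, hy, (S.reg_injective he).symm⟩
      · refine ⟨S.reg (p y), hy.2, ?_⟩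
        rw [hT, transplant_reg hinj hy.1, hΨ]
  have hpo : IsOpen (p '' (Ψ '' Z)) := h.isOpen_image hΨZ (hΨZR.trans hRs)
  rw [area, hset, measure_union _ hpo.measurableSet]
  swap
  · exact Set.disjoint_left.2 fun x hx hx' => hx.2 (image_mono hΨZR hx')
  congr 1
  rw [h.riemannianArea_image hRw hΨZ hΨZR]
  have hpos : ∀ y, 0 < 1 + t₁ * fderiv ℝ f y e := fun y => by
    have := (abs_le.1 (hdet y)).1
    linarith
  have hdens : ∀ y ∈ Z, 0 ≤ areaDensity H (displace f e t₁ y) := by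
    intro y hy
    rw [← hΨ]
    exact mul_nonneg (mem_strip.1 (hRs ((hΨR y).2 hy.1))).1.le (Real.sqrt_nonneg _)
  -- Change of variables along `Ψ`. Its Jacobian `1 + t₁ ∂ₑf` is at least `1/2`, so the absolute
  -- value can be dropped.
  rw [lintegral_image_eq_lintegral_abs_det_fderiv_mul volume hZo.measurableSet
    (f' := fun y => ContinuousLinearMap.id ℝ (ℝ × ℝ) + (t₁ • fderiv ℝ f y).smulRight e)
    (fun y _ => by
      have : (Ψ : ℝ × ℝ → ℝ × ℝ) = displace f e t₁ := funext hΨ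
      rw [this]
      exact (hasFDerivAt_displace hf).hasFDerivWithinAt) Ψ.injective.injOn,
    ofReal_integral_eq_lintegral_ofReal hint]
  · refine setLIntegral_congr_fun hZo.measurableSet fun y hy => ?_
    simp only [det_displace, hΨ]
    rw [abs_of_pos (hpos y), ← ENNReal.ofReal_mul (hpos y).le, mul_comm]
  · exact (ae_restrict_iff' hZo.measurableSet).2 (Eventually.of_forall fun y hy =>
      mul_nonneg (hdens y hy) (hpos y).le)

end PolarChart
end ConicalSurface
end

/-! ### A deformation that changes the area ratio to first order. -/

noncomputable section
namespace ConicalSurface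

variable {M : Type*} [TopologicalSpace M] [ChartedSpace (EuclideanHalfSpace 2) M]
  [IsManifold (𝓡∂ 2) ∞ M]
  [RiemannianBundle (fun x : M => TangentSpace (𝓡∂ 2) x)] {ι : Type*}

namespace PolarChart

variable {S : ConicalSurface M ι} {i : ι} {p : ℝ × ℝ → M} {H : ℝ × ℝ → ℝ} {α : ℝ}

lemma contDiffOn_coeff (h : PolarChart S i p H α) :
    ContDiffOn ℝ 1 (fun y => y.1 ^ 2 * H y) strip :=
  (contDiff_fst.pow 2).contDiffOn.mul h.cross_contDiffOn

lemma contDiffOn_areaDensity (h : PolarChart S i p H α) :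
    ContDiffOn ℝ 1 (areaDensity H) strip := by
  intro y hy
  have h1 : ContDiffAt ℝ 1 H y := h.cross_contDiffOn.contDiffAt (strip_mem_nhds hy)
  have h2 : H y ≠ 0 := (h.cross_pos y.1 (mem_strip.1 hy) y.2).ne'
  exact (contDiffAt_fst.mul (h1.sqrt h2)).contDiffWithinAt

lemma areaDensity_pos (h : PolarChart S i p H α) {y : ℝ × ℝ} (hy : y ∈ strip) :
    0 < areaDensity H y :=
  mul_pos (mem_strip.1 hy).1 (Real.sqrt_pos.2 (h.cross_pos y.1 (mem_strip.1 hy) y.2))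

variable [Nonempty M] [T2Space M] [MeasurableSpace M] [BorelSpace M]

/-- If two disjoint open sets meet a cone, then the ratio of their areas can be changed by
deformations of the surface that change lengths by small factors only. -/
theorem exists_deformation (h : PolarChart S i p H α) {U V : Set S.Completion} (hU : IsOpen U)
    (hV : IsOpen V) (hUV : Disjoint U V) (hUc : ∃ y ∈ strip, S.reg (p y) ∈ U)
    (hVc : ∃ y ∈ strip, S.reg (p y) ∈ V) {κ : ℝ} (hκ : 0 < κ) :
    ∃ a ∈ Ioo (0 : ℝ) 1, ∃ E : Set M, IsOpen E ∧ (∀ x ∈ E, a < S.radius i (S.reg x)) ∧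
      ∃ t₀ > 0, ∃ C ≥ 0, ∃ IU IV : ℝ → ℝ, ∃ d > 0,
        ContinuousOn IU (Icc (-t₀) t₀) ∧ ContinuousOn IV (Icc (-t₀) t₀) ∧
        HasDerivAt (fun t => IU t - κ * IV t) d 0 ∧
        ∀ t, |t| ≤ t₀ → 0 ≤ IU t ∧ 0 ≤ IV t ∧ ∃ T : S.Completion ≃ₜ S.Completion,
          (t = 0 → ∀ z, T z = z) ∧
          (∀ c, S.IsCurve c → S.IsCurve (fun s => T (c s)) ∧
            S.curveLength (fun s => T (c s)) ≤ ENNReal.ofReal (1 + C * |t|) * S.curveLength c) ∧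
          (∀ W, IsOpen W → (∀ x ∈ E, S.reg x ∈ W ↔ S.reg x ∈ U) →
            S.area (T '' W) = riemannianArea M ({x | S.reg x ∈ W} \ E) +
              ENNReal.ofReal (IU t)) ∧
          (∀ W, IsOpen W → (∀ x ∈ E, S.reg x ∈ W ↔ S.reg x ∈ V) →
            S.area (T '' W) = riemannianArea M ({x | S.reg x ∈ W} \ E) +
              ENNReal.ofReal (IV t)) := by
  have hα0 := h.pos
  obtain ⟨u, hu, huU⟩ := hUc
  -- The angle of a point of `V` is shifted by periods until it is within `α/2` of that of `u`.
  obtain ⟨v, hv, hvV, hdist⟩ : ∃ v ∈ strip, S.reg (p v) ∈ V ∧ |v.2 - u.2| ≤ α / 2 := by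
    obtain ⟨v, hv, hvV⟩ := hVc
    obtain ⟨ψ, k, hk, hψ⟩ := exists_circ_rep hα0 (v.2 - u.2)
    refine ⟨(v.1, u.2 + ψ), mem_strip.2 (mem_strip.1 hv), ?_, by simpa using hψ⟩
    have : v.2 = u.2 + ψ + k * α := by linarith
    rw [← h.apply_add_int_mul (mem_strip.1 hv) (u.2 + ψ) k, ← this]
    exact hvV
  set e := v - u with he
  have hve : u + e = v := by rw [he]; abel
  have he0 : e ≠ 0 := by
    intro h0
    rw [h0, add_zero] at hve
    subst hve
    exact Set.disjoint_left.1 hUV huU hvV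
  have hu' := mem_strip.1 hu
  have hv' := mem_strip.1 hv
  set a := min u.1 v.1 / 2 with ha
  set b := (max u.1 v.1 + 1) / 2 with hb
  set l := min u.2 v.2 - α / 8 with hl
  set m := max u.2 v.2 + α / 8 with hm
  have hmin : 0 < min u.1 v.1 := lt_min hu'.1 hv'.1
  have hmax : max u.1 v.1 < 1 := max_lt hu'.2 hv'.2
  have ha0 : 0 < a := by rw [ha]; linarith
  have hb1 : b < 1 := by rw [hb]; linarith
  have hau : a < min u.1 v.1 := by rw [ha]; linarith
  have hbv : max u.1 v.1 < b := by rw [hb]; linarith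
  have hml : m < l + α := by
    have h1 : max u.2 v.2 - min u.2 v.2 ≤ α / 2 := by
      rw [max_sub_min_eq_abs]; exact hdist
    rw [hm, hl]; linarith
  -- A rectangle containing both points. Its angular width is at most `α/2 + 2 · α/8 < α`, which
  -- makes `p` injective on it, and its radii stay away from `0` and `1`.
  set R : Set (ℝ × ℝ) := Ioo a b ×ˢ Ioo l m with hR
  set Q : Set (ℝ × ℝ) := Icc a b ×ˢ Icc l m with hQ
  have hRo : IsOpen R := isOpen_Ioo.prod isOpen_Ioo
  have hQc : IsCompact Q := isCompact_Icc.prod isCompact_Icc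
  have hRQ : R ⊆ Q := prod_mono Ioo_subset_Icc_self Ioo_subset_Icc_self
  have hQs : Q ⊆ strip := fun y hy => mem_strip.2 ⟨ha0.trans_le hy.1.1, hy.1.2.trans_lt hb1⟩
  have hRs : R ⊆ strip := hRQ.trans hQs
  have hRw : R ⊆ window l α := fun y hy =>
    ⟨mem_strip.1 (hRs hy), hy.2.1.le, hy.2.2.trans hml⟩
  have hinj : InjOn p R := (h.injOn_window l).mono hRw
  have huR : u ∈ R := ⟨⟨hau.trans_le (min_le_left _ _), (le_max_left _ _).trans_lt hbv⟩,
    by have := min_le_left u.2 v.2; rw [hl]; linarith,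
    by have := le_max_left u.2 v.2; rw [hm]; linarith⟩
  have hvR : v ∈ R := ⟨⟨hau.trans_le (min_le_right _ _), (le_max_right _ _).trans_lt hbv⟩,
    by have := min_le_right u.2 v.2; rw [hl]; linarith,
    by have := le_max_right u.2 v.2; rw [hm]; linarith⟩
  have hRconv : Convex ℝ R := (convex_Ioo a b).prod (convex_Ioo l m)
  set WU : Set (ℝ × ℝ) := R ∩ {y | S.reg (p y) ∈ U} with hWU
  set WV : Set (ℝ × ℝ) := R ∩ {y | S.reg (p y) ∈ V} with hWV
  have hWo : ∀ W : Set S.Completion, IsOpen W → IsOpen (R ∩ {y | S.reg (p y) ∈ W}) := fun W hW =>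
    (h.continuousOn.mono hRs).isOpen_inter_preimage hRo
      (hW.preimage S.isOpenEmbedding_reg.continuous)
  have hWUo : IsOpen WU := hWo U hU
  have hWVo : IsOpen WV := hWo V hV
  obtain ⟨Φ, hΦC, hΦc, hΦR, hΦV, hΦU, hΦu⟩ := exists_tube hRo he0
    (fun s hs => hRconv.add_smul_sub_mem huR hvR hs) (hWUo.mem_nhds ⟨huR, huU⟩)
    (by rw [hve]; exact hWVo.mem_nhds ⟨hvR, hvV⟩)
  set ρ := areaDensity H with hρ
  have hρC := h.contDiffOn_areaDensity
  -- Division by the density makes the field `f e` have weighted divergence `∂ₑ(ρ f) = ∂ₑΦ`, so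
  -- first variations of area are integrals of `∂ₑΦ`.
  set f : ℝ × ℝ → ℝ := fun y => Φ y * (ρ y)⁻¹ with hf
  have hfsupp : tsupport f ⊆ tsupport Φ := tsupport_mul_subset_left
  have hfR : tsupport f ⊆ R := hfsupp.trans hΦR
  have hfc : HasCompactSupport f := hΦc.mul_right
  have hfC : ContDiff ℝ 1 f := by
    refine contDiff_iff_contDiffAt.2 fun y => ?_
    by_cases hy : y ∈ strip
    · exact hΦC.contDiffAt.mul
        ((hρC.contDiffAt (strip_mem_nhds hy)).inv (h.areaDensity_pos hy).ne')
    · have hy' : y ∉ tsupport f := fun hh => hy (hRs (hfR hh))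
      refine (contDiffAt_const (c := (0 : ℝ))).congr_of_eventuallyEq ?_
      filter_upwards [(isClosed_tsupport f).isOpen_compl.mem_nhds hy'] with z hz
        using image_eq_zero_of_notMem_tsupport hz
  obtain ⟨t₀, ht₀, hdisp⟩ := exists_displace_homeomorph hfC hfc e
  have hmem : ∀ t, |t| ≤ t₀ → ∀ y ∈ R, displace f e t y ∈ R := by
    intro t ht y hy
    obtain ⟨Ψ, hΨ⟩ := (hdisp t ht).1
    rw [← hΨ]
    exact (displace_mem hfR hΨ).2 hy
  obtain ⟨C, hC0, hC⟩ := exists_speed_displace_le isOpen_strip h.contDiffOn_coeff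
    (fun y hy => h.coeff_pos hy) hQc hQs hRQ hfC hfc ht₀ hmem
  obtain ⟨hUc, hUd, hUi⟩ := hasDerivAt_integral_displace isOpen_strip hρC hQc hQs hRQ hfC hfc ht₀
    hmem hWUo.measurableSet inter_subset_left
  obtain ⟨hVc, hVd, hVi⟩ := hasDerivAt_integral_displace isOpen_strip hρC hQc hQs hRQ hfC hfc ht₀
    hmem hWVo.measurableSet inter_subset_left
  set IU : ℝ → ℝ := fun t => ∫ y in WU, ρ (displace f e t y) * (1 + t * fderiv ℝ f y e) with hIU
  set IV : ℝ → ℝ := fun t => ∫ y in WV, ρ (displace f e t y) * (1 + t * fderiv ℝ f y e) with hIV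
  have hprod : ∀ y ∈ R, fderiv ℝ (fun y => ρ y * f y) y e = fderiv ℝ Φ y e := by
    intro y hy
    have : (fun y => ρ y * f y) =ᶠ[𝓝 y] Φ := by
      filter_upwards [hRo.mem_nhds hy] with z hz
      have : ρ z ≠ 0 := (h.areaDensity_pos (hRs hz)).ne'
      simp only [hf]
      rw [mul_comm, mul_assoc, inv_mul_cancel₀ this, mul_one]
    rw [this.fderiv_eq]
  have hΦd : Continuous fun y => fderiv ℝ Φ y e :=
    (hΦC.continuous_fderiv one_ne_zero).clm_apply continuous_const
  have hΦint : Integrable fun y => fderiv ℝ Φ y e := by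
    refine hΦd.integrable_of_hasCompactSupport ?_
    exact (hΦc.fderiv ℝ).comp_left (g := fun A : ℝ × ℝ →L[ℝ] ℝ => A e) rfl
  have hdisj : ∀ y ∈ WU, y ∉ WV := fun y hy hy' => Set.disjoint_left.1 hUV hy.2 hy'.2
  -- `∂ₑΦ` is negative at most near `v`, within `V`. On `U` it is nonnegative, and it is positive
  -- near `u`.
  have hposU : 0 < ∫ y in WU, fderiv ℝ (fun y => ρ y * f y) y e := by
    rw [setIntegral_congr_fun hWUo.measurableSet fun y hy => hprod y hy.1,
      setIntegral_pos_iff_support_of_nonneg_ae _ hΦint.integrableOn]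
    · have hopen : IsOpen (WU ∩ {y | 0 < fderiv ℝ Φ y e}) :=
        hWUo.inter (isOpen_lt continuous_const hΦd)
      refine (hopen.measure_pos volume ⟨u, ⟨huR, huU⟩, hΦu⟩).trans_le (measure_mono ?_)
      exact fun y hy => ⟨ne_of_gt hy.2, hy.1⟩
    · exact (ae_restrict_iff' hWUo.measurableSet).2
        (Eventually.of_forall fun y hy => hΦV y (hdisj y hy))
  -- `∂ₑΦ` is positive at most near `u`, within `U`, so `V` does not gain area to first order.
  have hnegV : ∫ y in WV, fderiv ℝ (fun y => ρ y * f y) y e ≤ 0 := by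
    refine setIntegral_nonpos hWVo.measurableSet fun y hy => ?_
    rw [hprod y hy.1]
    exact hΦU y fun hy' => hdisj y hy' hy
  refine ⟨a, ⟨ha0, ?_⟩, p '' R, h.isOpen_image hRo hRs, ?_, t₀, ht₀, C, hC0, IU, IV,
    (∫ y in WU, fderiv ℝ (fun y => ρ y * f y) y e) -
      κ * ∫ y in WV, fderiv ℝ (fun y => ρ y * f y) y e, ?_, hUc, hVc,
    hUd.sub (hVd.const_mul κ), ?_⟩
  · exact hau.trans ((min_le_left _ _).trans_lt hu'.2)
  · rintro _ ⟨y, hy, rfl⟩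
    rw [h.radius_apply (hRs hy)]
    exact hy.1.1
  · have := mul_nonpos_of_nonneg_of_nonpos hκ.le hnegV
    exact sub_pos.2 (this.trans_lt hposU)
  intro t ht
  obtain ⟨⟨Ψ, hΨ⟩, hdet⟩ := hdisp t ht
  have hΨR : ∀ y, Ψ y ∈ R ↔ y ∈ R := fun y => displace_mem hfR hΨ
  have hid : ∀ y ∉ tsupport f, displace f e t y = y := fun y hy =>
    displace_of_eq_zero (image_eq_zero_of_notMem_tsupport hy)
  have hnn : ∀ W : Set S.Completion, IsOpen W → 0 ≤ ∫ y in R ∩ {y | S.reg (p y) ∈ W},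
      ρ (displace f e t y) * (1 + t * fderiv ℝ f y e) := by
    intro W hW
    refine setIntegral_nonneg (hWo W hW).measurableSet fun y hy => ?_
    have h1 := (abs_le.1 (hdet y)).1
    exact mul_nonneg (h.areaDensity_pos (hRs (hmem t ht y hy.1))).le (by linarith)
  obtain ⟨T, hT⟩ := h.exists_transplant_homeomorph hinj hRo hRs hfc hfR Ψ hΨR
    fun y hy => by rw [hΨ]; exact hid y hy
  have hΨf : (Ψ : ℝ × ℝ → ℝ × ℝ) = displace f e t := funext hΨ
  rw [hΨf] at hT
  refine ⟨hnn U hU, hnn V hV, T, ?_, fun c hc => ?_, fun W hW hWE => ?_, fun W hW hWE => ?_⟩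
  · rintro rfl z
    rw [hT]
    exact transplant_of_notMem_compact (K := ∅) hinj (fun y _ => displace_zero) (by simp)
  · exact h.isCurve_transplant hinj hRo hRs hfC hfc hfR (hmem t ht) hT
      (le_add_of_nonneg_right (mul_nonneg hC0 (abs_nonneg t))) (hC t ht) hc
  · have hWeq : R ∩ {y | S.reg (p y) ∈ W} = WU := by
      ext y
      exact and_congr_right fun hy => hWE _ ⟨y, hy, rfl⟩
    have := h.area_transplant hRw hRo hfC hΨ hΨR hT hdet hW (by rw [hWeq]; exact hUi t ht)
    rwa [hWeq] at this
  · have hWeq : R ∩ {y | S.reg (p y) ∈ W} = WV := by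
      ext y
      exact and_congr_right fun hy => hWE _ ⟨y, hy, rfl⟩
    have := h.area_transplant hRw hRo hfC hΨ hΨR hT hdet hW (by rw [hWeq]; exact hVi t ht)
    rwa [hWeq] at this

end PolarChart
end ConicalSurface
end

/-! ### Restoring the area ratio, and areas near the tip. -/

noncomputable section
namespace ConicalSurface

/-- Two areas with given ratio that are changed slightly can be brought to this ratio by a small
change of parameter. -/
lemma exists_balance {u v u₀ v₀ u₁ v₁ : ℝ≥0∞} {IU IV : ℝ → ℝ} {κ d t₁ β : ℝ} (hκ : 0 < κ)
    (hd : 0 < d) (ht₁ : 0 ≤ t₁) (hβ : 0 ≤ β)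
    (hu₀ : u₀ ≤ ENNReal.ofReal β) (hv₀ : v₀ ≤ ENNReal.ofReal β)
    (hu₁ : u₁ ≤ ENNReal.ofReal β) (hv₁ : v₁ ≤ ENNReal.ofReal β)
    (hIU : ContinuousOn IU (Icc (-t₁) t₁)) (hIV : ContinuousOn IV (Icc (-t₁) t₁))
    (hIU0 : ∀ t, |t| ≤ t₁ → 0 ≤ IU t) (hIV0 : ∀ t, |t| ≤ t₁ → 0 ≤ IV t)
    (hgrow : ∀ t, |t| ≤ t₁ → |IU t - κ * IV t - (IU 0 - κ * IV 0) - d * t| ≤ d / 2 * |t|)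
    (hsmall : 2 * ((1 + κ) * β) / d ≤ t₁)
    (h0 : u + u₀ + ENNReal.ofReal (IU 0) = ENNReal.ofReal κ * (v + v₀ + ENNReal.ofReal (IV 0))) :
    ∃ t, |t| ≤ 2 * ((1 + κ) * β) / d ∧
      u + u₁ + ENNReal.ofReal (IU t) = ENNReal.ofReal κ * (v + v₁ + ENNReal.ofReal (IV t)) := by
  have hκ' : ENNReal.ofReal κ ≠ 0 := by simpa using hκ
  have hfin : ∀ {x : ℝ≥0∞}, x ≤ ENNReal.ofReal β → x ≠ ⊤ := fun hx =>
    (hx.trans_lt ENNReal.ofReal_lt_top).ne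
  have h00 : |(0 : ℝ)| ≤ t₁ := by simpa using ht₁
  -- If one fixed area is infinite, the given ratio forces the other to be infinite too, and `t = 0`
  -- works. Otherwise everything is a real number.
  by_cases hu : u = ⊤
  · have hv : v = ⊤ := by
      by_contra hv
      rw [hu, top_add, top_add] at h0
      exact ENNReal.mul_ne_top ENNReal.ofReal_ne_top (ENNReal.add_ne_top.2
        ⟨ENNReal.add_ne_top.2 ⟨hv, hfin hv₀⟩, ENNReal.ofReal_ne_top⟩) h0.symm
    refine ⟨0, by rw [abs_zero]; positivity, ?_⟩
    rw [hu, hv, top_add, top_add, top_add, top_add, ENNReal.mul_top hκ']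
  have hv : v ≠ ⊤ := by
    rintro rfl
    rw [top_add, top_add, ENNReal.mul_top hκ'] at h0
    exact ENNReal.add_ne_top.2 ⟨ENNReal.add_ne_top.2 ⟨hu, hfin hu₀⟩, ENNReal.ofReal_ne_top⟩ h0
  lift u to NNReal using hu
  lift v to NNReal using hv
  lift u₀ to NNReal using hfin hu₀
  lift v₀ to NNReal using hfin hv₀
  lift u₁ to NNReal using hfin hu₁
  lift v₁ to NNReal using hfin hv₁
  have hle : ∀ {x : NNReal}, (x : ℝ≥0∞) ≤ ENNReal.ofReal β → (x : ℝ) ≤ β := fun {x} hx => by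
    rw [← ENNReal.ofReal_coe_nnreal] at hx
    exact (ENNReal.ofReal_le_ofReal_iff hβ).1 hx
  have hconv : ∀ (x x' y y' : NNReal) (a b : ℝ), 0 ≤ a → 0 ≤ b →
      ((x : ℝ≥0∞) + x' + ENNReal.ofReal a = ENNReal.ofReal κ * (y + y' + ENNReal.ofReal b) ↔
        (x : ℝ) + x' + a = κ * (y + y' + b)) := by
    intro x x' y y' a b ha hb
    rw [← ENNReal.ofReal_coe_nnreal (p := x), ← ENNReal.ofReal_coe_nnreal (p := x'),
      ← ENNReal.ofReal_coe_nnreal (p := y), ← ENNReal.ofReal_coe_nnreal (p := y'),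
      ← ENNReal.ofReal_add (NNReal.coe_nonneg x) (NNReal.coe_nonneg x'), ← ENNReal.ofReal_add (by positivity) ha,
      ← ENNReal.ofReal_add (NNReal.coe_nonneg y) (NNReal.coe_nonneg y'), ← ENNReal.ofReal_add (by positivity) hb,
      ← ENNReal.ofReal_mul hκ.le, ENNReal.ofReal_eq_ofReal_iff (by positivity) (by positivity)]
  rw [hconv _ _ _ _ _ _ (hIU0 0 h00) (hIV0 0 h00)] at h0
  set D : ℝ → ℝ := fun t => IU t - κ * IV t with hD
  -- The amount by which `IU - κ IV` has to change in order to compensate the new areas near the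
  -- tip.
  set τ : ℝ := κ * (v₁ - v₀) - (u₁ - u₀) with hτ
  have hτβ : |τ| ≤ (1 + κ) * β := by
    have b1 := hle hu₀
    have b2 := hle hv₀
    have b3 := hle hu₁
    have b4 := hle hv₁
    have c1 := u₀.2
    have c2 := v₀.2
    have c3 := u₁.2
    have c4 := v₁.2
    rw [NNReal.val_eq_coe] at c1 c2 c3 c4
    have d1 : κ * (v₁ - v₀ : ℝ) ≤ κ * β := mul_le_mul_of_nonneg_left (by linarith) hκ.le
    have d2 : κ * (v₀ - v₁ : ℝ) ≤ κ * β := mul_le_mul_of_nonneg_left (by linarith) hκ.le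
    have d3 : κ * (v₀ - v₁ : ℝ) = -(κ * (v₁ - v₀)) := by ring
    have d4 : (1 + κ) * β = β + κ * β := by ring
    rw [abs_le, hτ, d4]
    constructor <;> linarith
  have hDc : ContinuousOn D (Icc (-t₁) t₁) := hIU.sub (continuousOn_const.mul hIV)
  -- At `t = ±x` with `x = 2|τ|/d` the function `D` has moved by at least `d/2 · x = |τ|` in each
  -- direction, so the intermediate value theorem applies.
  have key : ∃ t, |t| ≤ 2 * ((1 + κ) * β) / d ∧ D t = D 0 + τ := by
    set x := 2 * |τ| / d with hx
    have hx0 : 0 ≤ x := by positivity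
    have hxβ : x ≤ 2 * ((1 + κ) * β) / d := by rw [hx]; gcongr
    have hx1 : x ≤ t₁ := hxβ.trans hsmall
    have hdx : d / 2 * x = |τ| := by rw [hx]; field_simp
    have hp := abs_le.1 (hgrow x (by rwa [abs_of_nonneg hx0]))
    have hn := abs_le.1 (hgrow (-x) (by rwa [abs_neg, abs_of_nonneg hx0]))
    rw [abs_of_nonneg hx0] at hp
    rw [abs_neg, abs_of_nonneg hx0] at hn
    have hsub : Icc (-x) x ⊆ Icc (-t₁) t₁ := Icc_subset_Icc (by linarith) hx1
    obtain ⟨t, ht, hDt⟩ := intermediate_value_Icc (by linarith : -x ≤ x) (hDc.mono hsub)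
      (show D 0 + τ ∈ Icc (D (-x)) (D x) from by
        have t1 := neg_abs_le τ
        have t2 := le_abs_self τ
        constructor <;> simp only [hD] <;> linarith [hp.1, hn.2])
    exact ⟨t, (abs_le.2 ht).trans hxβ, hDt⟩
  obtain ⟨t, ht, hDt⟩ := key
  refine ⟨t, ht, (hconv _ _ _ _ _ _ (hIU0 t (ht.trans hsmall)) (hIV0 t (ht.trans hsmall))).2 ?_⟩
  simp only [hD, hτ] at hDt
  linarith

variable {M : Type*} [TopologicalSpace M] [ChartedSpace (EuclideanHalfSpace 2) M]
  [IsManifold (𝓡∂ 2) ∞ M]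
  [RiemannianBundle (fun x : M => TangentSpace (𝓡∂ 2) x)] {ι : Type*}

namespace PolarChart

variable {S : ConicalSurface M ι} {i : ι} {p : ℝ × ℝ → M} {H : ℝ × ℝ → ℝ} {α : ℝ}
variable [Nonempty M] [T2Space M] [MeasurableSpace M] [BorelSpace M]

/-- The area of small neighbourhoods of the tip. -/
lemma exists_area_ball_le (h : PolarChart S i p H α) :
    ∃ s ∈ Ioo (0 : ℝ) 1, ∃ B ≥ 0, ∀ r ∈ Ioo 0 s,
      riemannianArea M {x | S.radius i (S.reg x) < r} ≤ ENNReal.ofReal (B * r ^ 2) := by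
  have hα0 := h.pos
  -- Then `H < 4`, so the density is at most `2r` on a coordinate rectangle of sides `r` and `α`.
  obtain ⟨s, hs, hH⟩ := h.cross_tendsto 3 (by norm_num)
  refine ⟨s, hs, 2 * α, by positivity, fun r hr => ?_⟩
  have hr1 : r ≤ 1 := (hr.2.trans hs.2).le
  have hsub : Ioo 0 r ×ˢ univ ⊆ strip := prod_mono (Ioo_subset_Ioo_right hr1) Subset.rfl
  have hopen : IsOpen (p '' (Ioo 0 r ×ˢ univ)) :=
    h.isOpen_image (isOpen_Ioo.prod isOpen_univ) hsub
  rw [h.setOf_radius_reg_lt hr1, h.riemannianArea_eq 0 hopen.measurableSet (image_mono hsub)]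
  have hrad : ∀ y ∈ window 0 α ∩ p ⁻¹' (p '' (Ioo 0 r ×ˢ univ)), y ∈ Ioo 0 r ×ˢ Ico 0 α := by
    rintro y ⟨hy, z, hz, he⟩
    have := ((h.eq_iff z.1 (mem_strip.1 (hsub hz)) y.1 hy.1 z.2 y.2).1 he).1
    exact ⟨this ▸ hz.1, by simpa using hy.2⟩
  calc ∫⁻ y in window 0 α ∩ p ⁻¹' (p '' (Ioo 0 r ×ˢ univ)), ENNReal.ofReal (areaDensity H y)
      ≤ ∫⁻ y in Ioo 0 r ×ˢ Ico 0 α, ENNReal.ofReal (areaDensity H y) := lintegral_mono_set hrad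
    _ ≤ ∫⁻ _ in Ioo 0 r ×ˢ Ico 0 α, ENNReal.ofReal (2 * r) := by
        refine setLIntegral_mono' (measurableSet_Ioo.prod measurableSet_Ico) fun y hy => ?_
        refine ENNReal.ofReal_le_ofReal ?_
        have h1 := (abs_lt.1 (hH y.1 ⟨hy.1.1, hy.1.2.trans hr.2⟩ y.2)).2
        have h2 : Real.sqrt (H y) ≤ 2 := Real.sqrt_le_iff.2 ⟨by norm_num, by linarith⟩
        have h3 : y.1 * Real.sqrt (H y) ≤ r * 2 :=
          mul_le_mul hy.1.2.le h2 (Real.sqrt_nonneg _) hr.1.le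
        rw [areaDensity]
        linarith
    _ = ENNReal.ofReal (2 * α * r ^ 2) := by
        rw [setLIntegral_const, Measure.volume_eq_prod, Measure.prod_prod, Real.volume_Ioo,
          Real.volume_Ico, ← ENNReal.ofReal_mul (by linarith [hr.1]),
          ← ENNReal.ofReal_mul (by linarith [hr.1])]
        congr 1
        ring

lemma area_trace_inter_eq_zero (h : PolarChart S i p H α) {n : ℕ} {γ : Fin n → ℝ → S.Completion}
    (hγ : ∀ j, S.IsCurve (γ j)) : riemannianArea M ({x | S.reg x ∈ S.trace γ} ∩ p '' strip) = 0 := by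
  have : {x | S.reg x ∈ S.trace γ} ∩ p '' strip =
      ⋃ j, ({x | S.reg x ∈ γ j '' Icc 0 1} ∩ p '' strip) := by
    ext x
    simp only [trace, mem_inter_iff, mem_ofPred_eq, mem_iUnion]
    exact ⟨fun ⟨⟨j, hj⟩, hx⟩ => ⟨j, hj, hx⟩, fun ⟨j, hj, hx⟩ => ⟨⟨j, hj⟩, hx⟩⟩
  rw [this]
  exact measure_iUnion_null fun j => h.area_trace_eq_zero (hγ j)

lemma measurableSet_radius_lt (h : PolarChart S i p H α) (r : ℝ) :
    MeasurableSet {x : M | S.radius i (S.reg x) < r} :=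
  ((h.isOpen_radius_lt r).preimage S.isOpenEmbedding_reg.continuous).measurableSet

/-- If one part does not meet the cone, then a change of the division inside the cone does not
change areas. -/
lemma area_eq_of_misses_cone (h : PolarChart S i p H α) {n : ℕ} {γ γ' : Fin n → ℝ → S.Completion}
    (hγ : ∀ j, S.IsCurve (γ j)) (hγ' : ∀ j, S.IsCurve (γ' j)) {U V U' V' : Set S.Completion}
    (hUV : U ∪ V = (S.trace γ)ᶜ) (hUV' : U' ∪ V' = (S.trace γ')ᶜ) {r : ℝ} (hr : r ∈ Ioo (0 : ℝ) 1)
    (hU : ∀ z, r ≤ S.radius i z → (z ∈ U' ↔ z ∈ U)) (hV : ∀ z, r ≤ S.radius i z → (z ∈ V' ↔ z ∈ V))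
    (hV' : ∀ z ∈ V', S.radius i z < r → ∃ w ∈ V, S.radius i w = r)
    (hVc : ∀ y ∈ strip, S.reg (p y) ∉ V) : S.area U' = S.area U ∧ S.area V' = S.area V := by
  -- The new part misses the cone as well: a point of `V'` in the ball would yield a point of `V` on
  -- its bounding circle.
  have hVc' : ∀ y ∈ strip, S.reg (p y) ∉ V' := by
    intro y hy hyV
    rcases le_or_gt r (S.radius i (S.reg (p y))) with h1 | h1
    · exact hVc y hy ((hV _ h1).1 hyV)
    · obtain ⟨w, hw, hwr⟩ := hV' _ hyV h1
      obtain ⟨y', hy', rfl⟩ := h.exists_of_radius_mem (z := w) (by rw [hwr]; exact hr)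
      exact hVc y' hy' hw
  have hBl : {x : M | S.radius i (S.reg x) < r} ⊆ p '' strip := by
    rw [h.setOf_radius_reg_lt hr.2.le]
    exact image_mono (prod_mono (Ioo_subset_Ioo_right hr.2.le) Subset.rfl)
  -- If `B` misses the cone, then `A` fills the ball up to the trace, which is a null set. The area
  -- of `A` in the ball is then independent of the curve.
  have hpart : ∀ (c : Fin n → ℝ → S.Completion) (A B : Set S.Completion), (∀ j, S.IsCurve (c j)) →
      A ∪ B = (S.trace c)ᶜ → (∀ y ∈ strip, S.reg (p y) ∉ B) →
      S.area A = riemannianArea M {x | S.radius i (S.reg x) < r} +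
        riemannianArea M ({x | S.reg x ∈ A} \ {x | S.radius i (S.reg x) < r}) := by
    intro c A B hc hAB hB
    rw [area, ← measure_inter_add_sdiff _ (h.measurableSet_radius_lt r)]
    congr 1
    refine le_antisymm (measure_mono inter_subset_right) ?_
    refine (measure_mono (t := ({x | S.reg x ∈ A} ∩ {x | S.radius i (S.reg x) < r}) ∪
      ({x | S.reg x ∈ S.trace c} ∩ p '' strip)) ?_).trans ?_
    · intro x hx
      by_cases hxt : S.reg x ∈ S.trace c
      · exact Or.inr ⟨hxt, hBl hx⟩
      · left
        have hx' : S.reg x ∈ A ∪ B := by rw [hAB]; exact hxt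
        obtain ⟨y, hy, rfl⟩ := hBl hx
        exact ⟨hx'.resolve_right (hB y hy), hx⟩
    · refine (measure_union_le _ _).trans ?_
      rw [h.area_trace_inter_eq_zero hc, add_zero]
  constructor
  · rw [hpart γ' U' V' hγ' hUV' hVc', hpart γ U V hγ hUV hVc]
    congr 2
    ext x
    simp only [Set.mem_sdiff, mem_ofPred_eq, not_lt]
    exact and_congr_left fun hx => hU _ hx
  · rw [area, area]
    congr 1
    ext x
    rcases le_or_gt r (S.radius i (S.reg x)) with h1 | h1
    · exact hV _ h1
    · obtain ⟨y, hy, rfl⟩ := hBl h1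
      exact iff_of_false (hVc' y hy) (hVc y hy)

end PolarChart
end ConicalSurface
end

/-! ### Comparison of gain and cost: a minimizer avoids the tip. -/

noncomputable section
namespace ConicalSurface

variable {M : Type*} [TopologicalSpace M] [ChartedSpace (EuclideanHalfSpace 2) M]
  [IsManifold (𝓡∂ 2) ∞ M]
  [RiemannianBundle (fun x : M => TangentSpace (𝓡∂ 2) x)] {ι : Type*}

lemma length_lt_top [Nonempty M] {S : ConicalSurface M ι} {n : ℕ} {γ : Fin n → ℝ → S.Completion}
    (hγ : ∀ j, S.IsCurve (γ j)) : S.length γ < ⊤ :=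
  ENNReal.sum_lt_top.2 fun j _ => (hγ j).length_lt_top

/-- A function with positive derivative at `0` grows at about this rate near `0`. -/
lemma exists_growth {D : ℝ → ℝ} {d t₀ : ℝ} (hD : HasDerivAt D d 0) (hd : 0 < d) (ht₀ : 0 < t₀) :
    ∃ t₁ > 0, t₁ ≤ t₀ ∧ ∀ t, |t| ≤ t₁ → |D t - D 0 - d * t| ≤ d / 2 * |t| := by
  have h1 := (hasDerivAt_iff_isLittleO.1 hD).def (half_pos hd)
  obtain ⟨ε, hε, h2⟩ := Metric.eventually_nhds_iff.1 h1
  refine ⟨min t₀ (ε / 2), lt_min ht₀ (half_pos hε), min_le_left _ _, fun t ht => ?_⟩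
  have h3 := h2 (y := t) (by
    rw [Real.dist_eq, sub_zero]
    exact (ht.trans (min_le_right _ _)).trans_lt (half_lt_self hε))
  simpa [Real.norm_eq_abs, mul_comm] using h3

namespace PolarChart

variable {S : ConicalSurface M ι} {i : ι} {p : ℝ × ℝ → M} {H : ℝ × ℝ → ℝ} {α : ℝ}
variable [Nonempty M] [T2Space M] [MeasurableSpace M] [BorelSpace M]

/-- A shortest curve that divides the surface with given area ratio does not pass through a tip
of angle less than `2π` if one of the parts does not meet the cone. -/
lemma tip_notMem_trace_of_misses_cone (h : PolarChart S i p H α) (hα : α < 2 * Real.pi) {κ : ℝ}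
    {n : ℕ} {γ : Fin n → ℝ → S.Completion} (hγ : ∀ j, S.IsCurve (γ j)) {U V : Set S.Completion}
    (hU : IsOpen U) (hV : IsOpen V) (hUV : Disjoint U V) (hUVt : U ∪ V = (S.trace γ)ᶜ)
    (harea : S.area U = ENNReal.ofReal κ * S.area V)
    (hmin : ∀ γ' : Fin n → ℝ → S.Completion, S.Divides κ γ' → S.length γ ≤ S.length γ')
    (hmiss : (∀ y ∈ strip, S.reg (p y) ∉ U) ∨ ∀ y ∈ strip, S.reg (p y) ∉ V) :
    S.tip i ∉ S.trace γ := by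
  intro htip
  obtain ⟨r, hr, γ', U', V', hγ', hU', hV', hUV', hUVt', hout, hinU, hinV, hlen⟩ :=
    h.exists_star_competitor hα hγ htip hU hV hUV hUVt one_pos
  have hareas : S.area U' = S.area U ∧ S.area V' = S.area V := by
    rcases hmiss with hm | hm
    · rw [union_comm] at hUVt hUVt'
      exact (h.area_eq_of_misses_cone hγ hγ' hUVt hUVt' hr (fun z hz => (hout z hz).2)
        (fun z hz => (hout z hz).1) hinU hm).symm
    · exact h.area_eq_of_misses_cone hγ hγ' hUVt hUVt' hr (fun z hz => (hout z hz).1)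
        (fun z hz => (hout z hz).2) hinV hm
  have hdiv : S.Divides κ γ' :=
    ⟨hγ', U', V', hU', hV', hUV', hUVt', by rw [hareas.1, hareas.2, harea]⟩
  have hgain := mul_pos (starGain_pos h.pos hα) hr.1
  refine absurd (hlen.trans (hmin γ' hdiv)) (not_le.2 ?_)
  exact ENNReal.lt_add_right (length_lt_top hγ').ne (by simpa using hgain)

/-- A shortest curve that divides the surface with given area ratio does not pass through a tip
of angle less than `2π`. -/
theorem tip_notMem_trace (h : PolarChart S i p H α) (hα : α < 2 * Real.pi) {κ : ℝ} (hκ : 0 < κ)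
    {n : ℕ} {γ : Fin n → ℝ → S.Completion} (hγ : S.Divides κ γ)
    (hmin : ∀ γ' : Fin n → ℝ → S.Completion, S.Divides κ γ' → S.length γ ≤ S.length γ') :
    S.tip i ∉ S.trace γ := by
  obtain ⟨hγ, U, V, hU, hV, hUV, hUVt, harea⟩ := hγ
  by_cases hUc : ∃ y ∈ strip, S.reg (p y) ∈ U
  swap
  · push Not at hUc
    exact h.tip_notMem_trace_of_misses_cone hα hγ hU hV hUV hUVt harea hmin (Or.inl hUc)
  by_cases hVc : ∃ y ∈ strip, S.reg (p y) ∈ V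
  swap
  · push Not at hVc
    exact h.tip_notMem_trace_of_misses_cone hα hγ hU hV hUV hUVt harea hmin (Or.inr hVc)
  intro htip
  obtain ⟨a, ha, E, -, hEa, t₀, ht₀, C, hC, IU, IV, d, hd, hIUc, hIVc, hderiv, hT⟩ :=
    h.exists_deformation hU hV hUV hUc hVc hκ
  obtain ⟨t₁, ht₁, ht₁₀, hgrow⟩ := exists_growth hderiv hd ht₀
  obtain ⟨s, hs, B, hB, hball⟩ := h.exists_area_ball_le
  have hgain := starGain_pos h.pos hα
  -- A ball of radius `r` has area at most `B r²`, so the ratio is restored by a parameter of size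
  -- at most `A r²`.
  set A := 2 * ((1 + κ) * B) / d with hA
  have hA0 : 0 ≤ A := by positivity
  set L := (S.length γ).toReal with hL
  have hL0 : 0 ≤ L := ENNReal.toReal_nonneg
  have hK0 : 0 < C * A * L + 1 := by positivity
  -- `r < a` keeps the ball off the support `E` of the deformation and `r < s` bounds its area. The
  -- third bound gives `A r² ≤ t₁`, and the last one makes the cost `C A L r²` smaller than the gain
  -- `starGain α * r`.
  obtain ⟨r, hr, γ', U', V', hγ', hU', hV', hUV', hUVt', hout, -, -, hlen⟩ :=
    h.exists_star_competitor hα hγ htip hU hV hUV hUVt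
      (ε := min (min a s) (min (t₁ / (A + 1)) (starGain α / (C * A * L + 1))))
      (lt_min (lt_min ha.1 hs.1) (lt_min (by positivity) (by positivity)))
  obtain ⟨⟨hra, hrs⟩, hrt, hrg⟩ : (r < a ∧ r < s) ∧ r < t₁ / (A + 1) ∧
      r < starGain α / (C * A * L + 1) := by simpa [lt_min_iff] using hr.2
  have hr0 := hr.1
  rw [lt_div_iff₀ (by positivity)] at hrt hrg
  have hr1 : r < 1 := hra.trans ha.2
  have hβ : 2 * ((1 + κ) * (B * r ^ 2)) / d = A * r ^ 2 := by rw [hA]; ring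
  have hAr : A * r ^ 2 ≤ t₁ := by nlinarith [mul_nonneg hA0 hr0.le]
  have hABl : ∀ X : Set M, riemannianArea M (X ∩ {x | S.radius i (S.reg x) < r}) ≤
      ENNReal.ofReal (B * r ^ 2) := fun X =>
    (measure_mono inter_subset_right).trans (hball r ⟨hr0, hrs⟩)
  have hsplit : ∀ W : Set S.Completion, riemannianArea M ({x | S.reg x ∈ W} \ E) =
      riemannianArea M (({x | S.reg x ∈ W} \ E) \ {x | S.radius i (S.reg x) < r}) +
      riemannianArea M (({x | S.reg x ∈ W} \ E) ∩ {x | S.radius i (S.reg x) < r}) := fun W => by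
    rw [add_comm, measure_inter_add_sdiff _ (h.measurableSet_radius_lt r)]
  have houtM : ∀ W W' : Set S.Completion, (∀ z, r ≤ S.radius i z → (z ∈ W' ↔ z ∈ W)) →
      ({x | S.reg x ∈ W'} \ E) \ {x | S.radius i (S.reg x) < r} =
        ({x | S.reg x ∈ W} \ E) \ {x | S.radius i (S.reg x) < r} := by
    intro W W' hWW'
    ext x
    simp only [Set.mem_sdiff, mem_ofPred_eq, not_lt]
    exact and_congr_left fun hx => and_congr_left fun _ => hWW' _ hx
  have hsub : Icc (-t₁) t₁ ⊆ Icc (-t₀) t₀ := Icc_subset_Icc (by linarith) ht₁₀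
  have h0 := hT 0 (by simpa using ht₀.le)
  -- At parameter `0` the deformation is the identity, which writes the original areas in the form
  -- that `exists_balance` needs.
  obtain ⟨-, -, T₀, hid, -, hTU, hTV⟩ := h0
  have hT₀ : ∀ W : Set S.Completion, T₀ '' W = W := fun W => by
    have : (T₀ : S.Completion → S.Completion) = id := funext (hid rfl)
    rw [this, image_id]
  have haU := hTU U hU fun _ _ => Iff.rfl
  have haV := hTV V hV fun _ _ => Iff.rfl
  rw [hT₀, hsplit] at haU haV
  rw [haU, haV] at harea
  obtain ⟨t, ht, hbal⟩ := exists_balance (t₁ := t₁) hκ hd ht₁.le (by positivity : 0 ≤ B * r ^ 2)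
    (hABl _) (hABl _) (hABl ({x | S.reg x ∈ U'} \ E)) (hABl ({x | S.reg x ∈ V'} \ E))
    (hIUc.mono hsub) (hIVc.mono hsub)
    (fun t ht => (hT t (ht.trans ht₁₀)).1) (fun t ht => (hT t (ht.trans ht₁₀)).2.1) hgrow
    (by rw [hβ]; exact hAr) harea
  rw [hβ] at ht
  obtain ⟨-, -, T, -, hTc, hTU, hTV⟩ := hT t ((ht.trans hAr).trans ht₁₀)
  have hEr : ∀ x ∈ E, r ≤ S.radius i (S.reg x) := fun x hx => (hra.trans (hEa x hx)).le
  have haU' := hTU U' hU' fun x hx => (hout _ (hEr x hx)).1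
  have haV' := hTV V' hV' fun x hx => (hout _ (hEr x hx)).2
  rw [hsplit, houtM _ _ fun z hz => (hout z hz).1] at haU'
  rw [hsplit, houtM _ _ fun z hz => (hout z hz).2] at haV'
  rw [← haU', ← haV'] at hbal
  have htr : S.trace (fun j s => T (γ' j s)) = T '' S.trace γ' := by
    simp only [trace, image_iUnion, image_image]
  have hdiv : S.Divides κ (fun j s => T (γ' j s)) :=
    ⟨fun j => (hTc _ (hγ' j)).1, T '' U', T '' V', T.isOpenMap _ hU', T.isOpenMap _ hV',
      (disjoint_image_iff T.injective).2 hUV',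
      by rw [htr, ← image_union, hUVt', image_compl_eq T.bijective], hbal⟩
  have hle : S.length γ ≤ ENNReal.ofReal (1 + C * |t|) * S.length γ' := by
    refine (hmin _ hdiv).trans ?_
    rw [length, length, Finset.mul_sum]
    exact Finset.sum_le_sum fun j _ => (hTc _ (hγ' j)).2
  have hfin := (length_lt_top hγ).ne
  have hfin' := (length_lt_top hγ').ne
  set L' := (S.length γ').toReal with hL'
  have hL'0 : 0 ≤ L' := ENNReal.toReal_nonneg
  rw [← ENNReal.ofReal_toReal hfin, ← ENNReal.ofReal_toReal hfin', ← hL, ← hL',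
    ← ENNReal.ofReal_add hL'0 (by positivity), ENNReal.ofReal_le_ofReal_iff hL0] at hlen
  rw [← ENNReal.ofReal_toReal hfin, ← ENNReal.ofReal_toReal hfin', ← hL, ← hL',
    ← ENNReal.ofReal_mul (by positivity), ENNReal.ofReal_le_ofReal_iff (by positivity)] at hle
  -- The factor `1 + C|t|` multiplies the length `L'` of the star competitor, and `L' ≤ L`. The
  -- added length is therefore of order `r²`.
  have e1 : C * |t| * L' ≤ C * (A * r ^ 2) * L :=
    mul_le_mul (mul_le_mul_of_nonneg_left ht hC) (by nlinarith [mul_pos hgain hr0]) hL'0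
      (by positivity)
  have e2 : C * (A * r ^ 2) * L = r * (r * (C * A * L)) := by ring
  have e3 : r * (r * (C * A * L)) < r * starGain α :=
    mul_lt_mul_of_pos_left (by nlinarith) hr0
  nlinarith

end PolarChart
end ConicalSurface
end

/-! ### Polar coordinates normalized by the arc length of the cross section at the tip. -/

noncomputable section
namespace ConicalSurface

variable {M : Type*} [TopologicalSpace M] [ChartedSpace (EuclideanHalfSpace 2) M]
  [IsManifold (𝓡∂ 2) ∞ M]
  [RiemannianBundle (fun x : M => TangentSpace (𝓡∂ 2) x)] {ι : Type*}

section CrossSection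

variable (S : ConicalSurface M ι) (i : ι)

lemma norm_mfderiv_polar {r : ℝ} (hr : r ∈ Ioo (0 : ℝ) 1) (θ : ℝ) :
    ‖mfderiv 𝓘(ℝ, ℝ × ℝ) (𝓡∂ 2) (S.polar i) (r, θ) ((0, 1) : ℝ × ℝ)‖ =
      r * Real.sqrt (S.cross i (r, θ)) := by
  rw [norm_eq_sqrt_real_inner, S.inner_angular_angular i r hr θ, Real.sqrt_mul (sq_nonneg r),
    Real.sqrt_sq hr.1.le]

lemma mdifferentiableAt_polar {y : ℝ × ℝ} (hy : y ∈ strip) :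
    MDifferentiableAt 𝓘(ℝ, ℝ × ℝ) (𝓡∂ 2) (S.polar i) y :=
  ((S.contMDiffOn_polar i y hy).contMDiffAt (strip_mem_nhds hy)).mdifferentiableAt (by simp)

/-- `polar` is `2π`-periodic, so the circle of radius `r` has the same speed at `θ` and `θ + 2π`,
and this speed is `r √h`. -/
lemma cross_periodic_of_pos {r : ℝ} (hr : r ∈ Ioo (0 : ℝ) 1) (θ : ℝ) :
    S.cross i (r, θ + 2 * Real.pi) = S.cross i (r, θ) := by
  have hmem : ∀ θ, ((r, θ) : ℝ × ℝ) ∈ strip := fun θ => mem_strip.2 hr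
  have hspeed : ∀ (f : ℝ → ℝ) (t : ℝ), HasDerivAt f 1 t →
      ‖mfderiv 𝓘(ℝ, ℝ) (𝓡∂ 2) (fun s => S.polar i (r, f s)) t 1‖ₑ =
        ENNReal.ofReal (r * Real.sqrt (S.cross i (r, f t))) := by
    intro f t hf
    have hd : HasFDerivAt (fun s => ((r, f s) : ℝ × ℝ))
        (ContinuousLinearMap.toSpanSingleton ℝ ((0, 1) : ℝ × ℝ)) t :=
      ((hasDerivAt_const t r).prodMk hf).hasFDerivAt
    have h1 := mfderiv_comp t (I := 𝓘(ℝ, ℝ)) (I' := 𝓘(ℝ, ℝ × ℝ)) (I'' := 𝓡∂ 2)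
      (g := S.polar i) (f := fun s => ((r, f s) : ℝ × ℝ))
      (S.mdifferentiableAt_polar i (hmem _)) hd.differentiableAt.mdifferentiableAt
    have h2 : mfderiv 𝓘(ℝ, ℝ) (𝓡∂ 2) (fun s => S.polar i (r, f s)) t 1 =
        mfderiv 𝓘(ℝ, ℝ × ℝ) (𝓡∂ 2) (S.polar i) (r, f t) ((0, 1) : ℝ × ℝ) := by
      refine (congrArg (fun A => A (1 : ℝ)) h1).trans ?_
      refine congrArg (mfderiv 𝓘(ℝ, ℝ × ℝ) (𝓡∂ 2) (S.polar i) (r, f t)) ?_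
      rw [mfderiv_eq_fderiv, hd.fderiv]
      exact one_smul ℝ _
    rw [h2, ← ofReal_norm, S.norm_mfderiv_polar i hr]
  have e1 := hspeed (fun s => s + 2 * Real.pi) θ ((hasDerivAt_id θ).add_const _)
  have e2 := hspeed (fun s => s) θ (hasDerivAt_id θ)
  have e3 : (fun s => S.polar i (r, s + 2 * Real.pi)) = fun s => S.polar i (r, s) := by
    funext s
    exact ((S.polar_eq_iff i r hr r hr s (s + 2 * Real.pi)).2 ⟨rfl, 1, by simp⟩).symm
  rw [enorm_mfderiv_congr (Eventually.of_forall (congrFun e3)), e2,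
    ENNReal.ofReal_eq_ofReal_iff (by have := hr.1; positivity) (by have := hr.1; positivity),
    mul_right_inj' hr.1.ne', Real.sqrt_inj (S.cross_pos i r ⟨hr.1.le, hr.2⟩ _).le
      (S.cross_pos i r ⟨hr.1.le, hr.2⟩ _).le] at e1
  exact e1.symm

/-- The cross section metric, extended constantly beyond `0 ≤ r ≤ 1 / 2`. -/
def clampedCross (y : ℝ × ℝ) : ℝ := S.cross i (max 0 (min y.1 (1 / 2)), y.2)

lemma clamp_mem (r : ℝ) : max 0 (min r (1 / 2)) ∈ Ico (0 : ℝ) 1 :=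
  ⟨le_max_left _ _, max_lt one_pos ((min_le_right _ _).trans_lt (by norm_num))⟩

lemma clampedCross_of_mem {r : ℝ} (hr : r ∈ Icc (0 : ℝ) (1 / 2)) (θ : ℝ) :
    S.clampedCross i (r, θ) = S.cross i (r, θ) := by
  simp only [clampedCross]
  rw [min_eq_left hr.2, max_eq_right hr.1]

lemma clampedCross_zero (θ : ℝ) : S.clampedCross i (0, θ) = S.cross i (0, θ) :=
  S.clampedCross_of_mem i ⟨le_rfl, by norm_num⟩ θ

lemma clampedCross_pos (y : ℝ × ℝ) : 0 < S.clampedCross i y := S.cross_pos i _ (clamp_mem _) _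

lemma continuous_clampedCross : Continuous (S.clampedCross i) :=
  (S.contDiffOn_cross i).continuousOn.comp_continuous (by fun_prop)
    fun y => ⟨clamp_mem y.1, mem_univ _⟩

/-- At `r = 0` there is no circle in the surface, and periodicity follows by continuity from `r >
0`. -/
lemma clampedCross_periodic (r θ : ℝ) :
    S.clampedCross i (r, θ + 2 * Real.pi) = S.clampedCross i (r, θ) := by
  have hpos : ∀ r ∈ Ioi (0 : ℝ), ∀ θ,
      S.clampedCross i (r, θ + 2 * Real.pi) = S.clampedCross i (r, θ) := by
    intro r hr θ
    refine S.cross_periodic_of_pos i ⟨?_, (clamp_mem r).2⟩ θ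
    exact lt_max_of_lt_right (lt_min hr (by norm_num))
  have h0 : S.clampedCross i (0, θ + 2 * Real.pi) = S.clampedCross i (0, θ) := by
    have hc : ∀ θ, Tendsto (fun r => S.clampedCross i (r, θ)) (𝓝[>] 0)
        (𝓝 (S.clampedCross i (0, θ))) := fun θ =>
      ((S.continuous_clampedCross i).comp (by fun_prop :
        Continuous fun r : ℝ => ((r, θ) : ℝ × ℝ))).continuousWithinAt
    refine tendsto_nhds_unique (hc _) ((hc θ).congr' ?_)
    filter_upwards [self_mem_nhdsWithin] with r hr using (hpos r hr θ).symm
  rcases le_or_gt r 0 with hr | hr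
  · have : ∀ θ, S.clampedCross i (r, θ) = S.clampedCross i (0, θ) := fun θ => by
      simp only [clampedCross]
      rw [max_eq_left ((min_le_left _ _).trans hr), max_eq_left (min_le_left _ _)]
    rw [this, this, h0]
  · exact hpos r hr θ

/-- For `0 < r < 1/2` the quotient is the integral of `√h(r, θ)`, which depends continuously on `r`
down to `r = 0`. -/
lemma tendsto_circleLength_div : Tendsto (fun r => S.circleLength i r / r) (𝓝[>] 0)
    (𝓝 (∫ θ in (0 : ℝ)..(2 * Real.pi), Real.sqrt (S.clampedCross i (0, θ)))) := by
  have hc : Continuous fun r => ∫ θ in (0 : ℝ)..(2 * Real.pi), Real.sqrt (S.clampedCross i (r, θ)) :=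
    intervalIntegral.continuous_parametric_intervalIntegral_of_continuous'
      (f := fun r θ => Real.sqrt (S.clampedCross i (r, θ)))
      (Real.continuous_sqrt.comp (S.continuous_clampedCross i)) 0 (2 * Real.pi)
  refine (hc.tendsto 0 |>.mono_left nhdsWithin_le_nhds).congr' ?_
  filter_upwards [Ioo_mem_nhdsGT (show (0 : ℝ) < 1 / 2 by norm_num)] with r hr
  have hr' : r ∈ Ioo (0 : ℝ) 1 := ⟨hr.1, hr.2.trans (by norm_num)⟩
  rw [circleLength, eq_div_iff hr.1.ne', mul_comm, ← intervalIntegral.integral_const_mul]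
  refine intervalIntegral.integral_congr fun θ _ => ?_
  rw [S.norm_mfderiv_polar i hr', S.clampedCross_of_mem i ⟨hr.1.le, hr.2.le⟩]

/-- The arc length of the cross section at the tip. -/
def arc (θ : ℝ) : ℝ := ∫ t in (0 : ℝ)..θ, Real.sqrt (S.clampedCross i (0, t))

lemma continuous_sqrt_clampedCross_zero :
    Continuous fun t => Real.sqrt (S.clampedCross i (0, t)) :=
  Real.continuous_sqrt.comp ((S.continuous_clampedCross i).comp (by fun_prop))

lemma hasDerivAt_arc (θ : ℝ) :
    HasDerivAt (S.arc i) (Real.sqrt (S.clampedCross i (0, θ))) θ :=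
  (S.continuous_sqrt_clampedCross_zero i).integral_hasStrictDerivAt 0 θ |>.hasDerivAt

lemma arc_strictMono : StrictMono (S.arc i) :=
  strictMono_of_hasDerivAt_pos (S.hasDerivAt_arc i) fun _ => Real.sqrt_pos.2 (S.clampedCross_pos i _)

lemma arc_add_period (θ : ℝ) :
    S.arc i (θ + 2 * Real.pi) = S.arc i θ + S.arc i (2 * Real.pi) := by
  have hi : ∀ a b, IntervalIntegrable (fun t => Real.sqrt (S.clampedCross i (0, t))) volume a b :=
    fun a b => (S.continuous_sqrt_clampedCross_zero i).intervalIntegrable a b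
  have hper : Function.Periodic (fun t => Real.sqrt (S.clampedCross i (0, t))) (2 * Real.pi) :=
    fun t => by simp only [S.clampedCross_periodic i 0 t]
  have h1 := hper.intervalIntegral_add_eq θ 0
  rw [zero_add] at h1
  rw [arc, arc, arc, ← h1, intervalIntegral.integral_add_adjacent_intervals (hi _ _) (hi _ _)]

lemma arc_zero : S.arc i 0 = 0 := by simp [arc]

lemma arc_two_pi_pos : 0 < S.arc i (2 * Real.pi) := by
  rw [← S.arc_zero i]
  exact S.arc_strictMono i (by positivity)

lemma arc_add_int_mul (θ : ℝ) (k : ℤ) :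
    S.arc i (θ + k * (2 * Real.pi)) = S.arc i θ + k * S.arc i (2 * Real.pi) := by
  induction k using Int.induction_on generalizing θ with
  | zero => simp
  | succ n ih =>
    have := S.arc_add_period i (θ + (n : ℤ) * (2 * Real.pi))
    rw [ih] at this
    push_cast at this ⊢
    rw [show θ + (n + 1) * (2 * Real.pi) = θ + n * (2 * Real.pi) + 2 * Real.pi by ring, this]
    ring
  | pred n ih =>
    have := S.arc_add_period i (θ + ((-n - 1 : ℤ) : ℝ) * (2 * Real.pi))
    rw [show θ + ((-n - 1 : ℤ) : ℝ) * (2 * Real.pi) + 2 * Real.pi =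
      θ + ((-n : ℤ) : ℝ) * (2 * Real.pi) by push_cast; ring, ih] at this
    push_cast at this ⊢
    linarith

lemma arc_surjective : Function.Surjective (S.arc i) := by
  intro y
  have hpos := S.arc_two_pi_pos i
  have hk : ∀ k : ℤ, S.arc i (k * (2 * Real.pi)) = k * S.arc i (2 * Real.pi) := fun k => by
    simpa [S.arc_zero i] using S.arc_add_int_mul i 0 k
  have hcont : Continuous (S.arc i) :=
    continuous_iff_continuousAt.2 fun θ => (S.hasDerivAt_arc i θ).continuousAt
  refine mem_range_of_exists_le_of_exists_ge hcont
    ⟨⌊y / S.arc i (2 * Real.pi)⌋ * (2 * Real.pi), ?_⟩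
    ⟨⌈y / S.arc i (2 * Real.pi)⌉ * (2 * Real.pi), ?_⟩
  · rw [hk, ← le_div_iff₀ hpos]
    exact Int.floor_le _
  · rw [hk, ← div_le_iff₀ hpos]
    exact Int.le_ceil _

/-- The inverse of the arc length. -/
def arcSymm : ℝ ≃o ℝ := ((S.arc_strictMono i).orderIsoOfSurjective _ (S.arc_surjective i)).symm

lemma arc_arcSymm (φ : ℝ) : S.arc i (S.arcSymm i φ) = φ :=
  ((S.arc_strictMono i).orderIsoOfSurjective _ (S.arc_surjective i)).apply_symm_apply φ

lemma hasDerivAt_arcSymm (φ : ℝ) :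
    HasDerivAt (S.arcSymm i) (Real.sqrt (S.clampedCross i (0, S.arcSymm i φ)))⁻¹ φ :=
  (S.hasDerivAt_arc i _).of_local_left_inverse (S.arcSymm i).continuous.continuousAt
    (Real.sqrt_pos.2 (S.clampedCross_pos i _)).ne'
    (Eventually.of_forall fun φ => S.arc_arcSymm i φ)

lemma contDiff_arcSymm : ContDiff ℝ 1 (S.arcSymm i) := by
  refine contDiff_one_iff_deriv.2 ⟨fun φ => (S.hasDerivAt_arcSymm i φ).differentiableAt, ?_⟩
  rw [show deriv (S.arcSymm i) = fun φ => (Real.sqrt (S.clampedCross i (0, S.arcSymm i φ)))⁻¹ from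
    funext fun φ => (S.hasDerivAt_arcSymm i φ).deriv]
  exact ((S.continuous_sqrt_clampedCross_zero i).comp (S.arcSymm i).continuous).inv₀
    fun φ => (Real.sqrt_pos.2 (S.clampedCross_pos i _)).ne'

/-- Each cone has polar coordinates in which the cross section at the tip has unit speed. -/
theorem polarChart_arcSymm :
    PolarChart S i (fun y => S.polar i (y.1, S.arcSymm i y.2))
      (fun y => S.cross i (y.1, S.arcSymm i y.2) / S.cross i (0, S.arcSymm i y.2))
      (S.arc i (2 * Real.pi)) := by
  set G : ℝ × ℝ → ℝ × ℝ := fun y => (y.1, S.arcSymm i y.2) with hG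
  have hGc : ContDiff ℝ 1 G := contDiff_fst.prodMk ((S.contDiff_arcSymm i).comp contDiff_snd)
  have hGmaps : MapsTo G (Ioo 0 1 ×ˢ univ) (Ioo 0 1 ×ˢ univ) := fun y hy => ⟨hy.1, mem_univ _⟩
  have hcross0 : ContDiff ℝ 1 fun θ => S.cross i (0, θ) := by
    rw [← contDiffOn_univ]
    exact ((S.contDiffOn_cross i).of_le (by simp)).comp
      (contDiff_const.prodMk contDiff_id).contDiffOn fun θ _ => ⟨⟨le_rfl, one_pos⟩, mem_univ _⟩
  have h0pos : ∀ θ, 0 < S.cross i (0, θ) := S.cross_pos i 0 ⟨le_rfl, one_pos⟩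
  have hd : ∀ (r φ : ℝ) (v : ℝ × ℝ), fderiv ℝ G (r, φ) v =
      (v.1, v.2 * (Real.sqrt (S.cross i (0, S.arcSymm i φ)))⁻¹) := by
    intro r φ v
    have h1 := (S.hasDerivAt_arcSymm i φ).hasFDerivAt.comp (x := ((r, φ) : ℝ × ℝ))
      (f := Prod.snd) hasFDerivAt_snd
    have h2 := (hasFDerivAt_fst (𝕜 := ℝ) (p := ((r, φ) : ℝ × ℝ))).prodMk h1
    have h3 : fderiv ℝ G (r, φ) = _ := h2.fderiv
    rw [h3, ← S.clampedCross_zero i]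
    simp
  have hmf : ∀ r ∈ Ioo (0 : ℝ) 1, ∀ (φ : ℝ) (v : ℝ × ℝ),
      mfderiv 𝓘(ℝ, ℝ × ℝ) (𝓡∂ 2) (fun y => S.polar i (y.1, S.arcSymm i y.2)) (r, φ) v =
        mfderiv 𝓘(ℝ, ℝ × ℝ) (𝓡∂ 2) (S.polar i) (r, S.arcSymm i φ)
          ((v.1, v.2 * (Real.sqrt (S.cross i (0, S.arcSymm i φ)))⁻¹) : ℝ × ℝ) := by
    intro r hr φ v
    have h1 := mfderiv_comp ((r, φ) : ℝ × ℝ) (I := 𝓘(ℝ, ℝ × ℝ)) (I' := 𝓘(ℝ, ℝ × ℝ))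
      (I'' := 𝓡∂ 2) (g := S.polar i) (f := G)
      (S.mdifferentiableAt_polar i (mem_strip.2 hr))
      (hGc.differentiable one_ne_zero _).mdifferentiableAt
    refine (congrArg (fun A => A v) h1).trans ?_
    refine congrArg (mfderiv 𝓘(ℝ, ℝ × ℝ) (𝓡∂ 2) (S.polar i) (r, S.arcSymm i φ)) ?_
    rw [mfderiv_eq_fderiv]
    exact hd r φ v
  have hvec : ∀ r φ, mfderiv 𝓘(ℝ, ℝ × ℝ) (𝓡∂ 2) (S.polar i) (r, S.arcSymm i φ)
      ((0, (Real.sqrt (S.cross i (0, S.arcSymm i φ)))⁻¹) : ℝ × ℝ) =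
      (Real.sqrt (S.cross i (0, S.arcSymm i φ)))⁻¹ •
        mfderiv 𝓘(ℝ, ℝ × ℝ) (𝓡∂ 2) (S.polar i) (r, S.arcSymm i φ) ((0, 1) : ℝ × ℝ) := by
    intro r φ
    have h1 : ((0, (Real.sqrt (S.cross i (0, S.arcSymm i φ)))⁻¹) : ℝ × ℝ) =
        (Real.sqrt (S.cross i (0, S.arcSymm i φ)))⁻¹ • ((0, 1) : ℝ × ℝ) := by simp
    rw [h1]
    exact map_smul (mfderiv 𝓘(ℝ, ℝ × ℝ) (𝓡∂ 2) (S.polar i) (r, S.arcSymm i φ)) _ _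
  refine
    { pos := S.arc_two_pi_pos i
      smooth := ((S.contMDiffOn_polar i).of_le (by simp)).comp hGc.contMDiff.contMDiffOn hGmaps
      interior := fun r hr φ => S.isInteriorPoint_polar i r hr _
      eq_iff := ?_
      range_eq := ?_
      cross_contDiffOn := ?_
      cross_pos := fun r hr φ => div_pos (S.cross_pos i r ⟨hr.1.le, hr.2⟩ _) (h0pos _)
      inner_radial_radial := ?_
      inner_radial_angular := ?_
      inner_angular_angular := ?_
      cross_tendsto := ?_ }
  · intro r hr r' hr' φ φ'
    rw [S.polar_eq_iff i r hr r' hr']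
    refine and_congr_right fun _ => exists_congr fun k => ?_
    rw [← (S.arc_strictMono i).injective.eq_iff, S.arc_add_int_mul, S.arc_arcSymm, S.arc_arcSymm]
  · intro r hr
    exact (S.arcSymm i).surjective.range_comp fun θ => S.polar i (r, θ)
  · refine ContDiffOn.div ?_ ((hcross0.comp (S.contDiff_arcSymm i)).comp contDiff_snd).contDiffOn
      fun y _ => (h0pos _).ne'
    exact ((S.contDiffOn_cross i).of_le (by simp)).comp hGc.contDiffOn
      fun y hy => ⟨⟨hy.1.1.le, hy.1.2⟩, mem_univ _⟩
  · intro r hr φ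
    rw [hmf r hr φ]
    simpa using S.inner_radial_radial i r hr _
  · intro r hr φ
    rw [hmf r hr φ, hmf r hr φ]
    simp only [zero_mul, one_mul]
    rw [hvec, real_inner_smul_right, S.inner_radial_angular i r hr, mul_zero]
  · intro r hr φ
    rw [hmf r hr φ]
    simp only [one_mul]
    rw [hvec, real_inner_smul_right, real_inner_smul_left, S.inner_angular_angular i r hr,
      ← mul_assoc, ← mul_inv, Real.mul_self_sqrt (h0pos _).le]
    field_simp
  · intro η hη
    have hFc : Continuous fun y : ℝ × ℝ => S.clampedCross i y / S.clampedCross i (0, y.2) :=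
      (S.continuous_clampedCross i).div ((S.continuous_clampedCross i).comp (by fun_prop))
        fun y => (S.clampedCross_pos i _).ne'
    -- Compactness of one period makes the convergence uniform there. Periodicity extends it to all
    -- angles.
    have h1 : ∀ᶠ r in 𝓝 (0 : ℝ), ∀ θ ∈ Icc 0 (2 * Real.pi),
        |S.clampedCross i (r, θ) / S.clampedCross i (0, θ) - 1| < η := by
      refine isCompact_Icc.eventually_forall_of_forall_eventually fun θ _ => ?_
      refine ((hFc.sub continuous_const).abs.continuousAt (x := (0, θ))).eventually_lt
        continuousAt_const ?_
      change |S.clampedCross i (0, θ) / S.clampedCross i (0, θ) - 1| < η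
      rw [div_self (S.clampedCross_pos i _).ne', sub_self, abs_zero]
      exact hη
    obtain ⟨ε, hε, h2⟩ := Metric.eventually_nhds_iff.1 h1
    refine ⟨min ε (1 / 2), ⟨lt_min hε (by norm_num), (min_le_right _ _).trans_lt (by norm_num)⟩,
      fun r hr φ => ?_⟩
    have hr2 : r ∈ Icc (0 : ℝ) (1 / 2) := ⟨hr.1.le, (hr.2.trans_le (min_le_right _ _)).le⟩
    have hper : Function.Periodic
        (fun θ => S.clampedCross i (r, θ) / S.clampedCross i (0, θ)) (2 * Real.pi) := fun θ => by
      simp only [S.clampedCross_periodic]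
    obtain ⟨θ, hθ, he⟩ := hper.exists_mem_Ico₀ (by positivity) (S.arcSymm i φ)
    have h3 := h2 (y := r) (by
      rw [Real.dist_eq, sub_zero, abs_of_pos hr.1]; exact hr.2.trans_le (min_le_left _ _)) θ
      ⟨hθ.1, hθ.2.le⟩
    simp only [S.clampedCross_of_mem i hr2, S.clampedCross_zero i] at he h3
    rw [he]
    exact h3

-- The cone angle is the period `arc (2π)` by uniqueness of limits.
variable {S i} in
lemma HasConeAngle.polarChart {α : ℝ} (hα : S.HasConeAngle i α) :
    PolarChart S i (fun y => S.polar i (y.1, S.arcSymm i y.2))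
      (fun y => S.cross i (y.1, S.arcSymm i y.2) / S.cross i (0, S.arcSymm i y.2)) α := by
  rw [tendsto_nhds_unique hα (S.tendsto_circleLength_div i)]
  exact S.polarChart_arcSymm i

end CrossSection

end ConicalSurface
end

theorem proposition1p3 {M : Type*} [TopologicalSpace M] [T2Space M] [ConnectedSpace M]
    [MeasurableSpace M] [BorelSpace M]
    [ChartedSpace (EuclideanHalfSpace 2) M] [IsManifold (𝓡∂ 2) ∞ M]
    [RiemannianBundle (fun x : M => TangentSpace (𝓡∂ 2) x)]
    [IsContMDiffRiemannianBundle (𝓡∂ 2) ∞ (EuclideanSpace ℝ (Fin 2))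
      (fun x : M => TangentSpace (𝓡∂ 2) x)]
    {ι : Type*} [Finite ι] (S : ConicalSurface M ι)
    (P : ι) (α : ℝ) (hP : S.HasConeAngle P α) (hα : α < 2 * Real.pi)
    (κ : ℝ) (hκ : 0 < κ) (n : ℕ) (γ : Fin n → ℝ → S.Completion) (hγ : S.Divides κ γ)
    (hmin : ∀ γ' : Fin n → ℝ → S.Completion, S.Divides κ γ' → S.length γ ≤ S.length γ') :
    S.tip P ∉ S.trace γ := by
  exact hP.polarChart.tip_notMem_trace hα hκ hγ hmin
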